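/- For integers $m\ge 1$ and real $H\ge 1$ let $\omega(m,H)$ be the infimum of the numbers $r>0$ such that $$|\lambda_0+\lambda_1e+\lambda_2e^2+\dots+\lambda_me^m|>\frac1{H^r}$$ for all $(\lambda_0,\dots,\lambda_m)\in\mathbb Z^{m+1}\setminus\{0\}$ with $\max_{1\le i\le m}|\lambda_i|\le H$ (with $\omega(m,H)=+\infty$ if there is no such $r$). Put $s(2)=e$ and $s(m)=m(\log m)^2$ for $m\ge 3$. For an integer $n\ge 2$ and $x>0$ put $$w_n(x)=1-\frac nx-\frac{n-1}{\log n}\,\frac{\log x}{x},$$ and for $m\ge 2$ let $$\kappa_m=\frac1m\sum_{\substack{p\le \frac{m+1}2\\ p\text{ prime}}}\ \min_{0\le j\le m}\left\{\left\lfloor\frac jp\right\rfloor+\left\lfloor\frac{m-j}p\right\rfloor\right\}\frac{\log p}{p-1}\,w_p\!\left(s(m)e^{s(m)}\right).$$ Let $m\ge 2$ and assume $\log H\ge s(m)e^{s(m)}$. Then $$\omega(m,H)\le\begin{cases} 2+\frac{4.93}{\log\log H}, & m=2;\\ 3+\frac{6.49}{\log\log H}, & m=3;\\ 4+\frac{15.7}{\log\log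 H}, & m=4;\\ m+\left(1-\frac{2\kappa_m}{(\log m)^2}\right)\left(1-\frac{\kappa_m}{\log m}\right)\frac{m^2\log m}{\log\log H}, & 5\le m\le 14;\\ m+\left(1-\frac{1+\kappa_m}{(\log m)^2}\right)\left(1-\frac{\kappa_m}{\log m}\right)\frac{m^2\log m}{\log\log H}, & m\ge 15. \end{cases}$$ Moreover, $$\lim_{m\to\infty}\kappa_m=\kappa:=\sum_{p\text{ prime}}\frac{\log p}{p(p-1)}=0.75536661083\dots,$$ that is, the series converges, the limit exists and equals its sum, and $0.75536661083\le\kappa<0.75536661084$. -/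

import Mathlib

/-- The threshold function: `s(2) = e` and `s(m) = m (log m)²` for `m ≥ 3`. -/
noncomputable def sFun (m : ℕ) : ℝ :=
  if m = 2 then Real.exp 1 else (m : ℝ) * Real.log m ^ 2

/-- `w_n(x) = 1 - n / x - ((n - 1) / log n) * (log x / x)`, used for `n ≥ 2` and `x > 0`. -/
noncomputable def wFun (n : ℕ) (x : ℝ) : ℝ :=
  1 - (n : ℝ) / x - ((n : ℝ) - 1) / Real.log n * (Real.log x / x)

/-- `min_{0 ≤ j ≤ m} (⌊j / p⌋ + ⌊(m - j) / p⌋)`; the division of natural numbers takes the floor. -/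
def minFloorSum (m p : ℕ) : ℕ :=
  (Finset.range (m + 1)).inf' Finset.nonempty_range_add_one (fun j => j / p + (m - j) / p)

/-- `κ_m`; the sum runs over the primes `p` with `p ≤ (m + 1) / 2`, that is, `2 p ≤ m + 1`. -/
noncomputable def kappa (m : ℕ) : ℝ :=
  1 / (m : ℝ) * ∑ p ∈ (Finset.range (m + 2)).filter (fun p : ℕ => p.Prime ∧ 2 * p ≤ m + 1),
    (minFloorSum m p : ℝ) * (Real.log p / ((p : ℝ) - 1)) *
      wFun p (sFun m * Real.exp (sFun m))

/-- The exponents `r > 0` such that `|λ₀ + λ₁ e + ⋯ + λ_m e^m| > H^(-r)` for all nonzero integer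
vectors `λ` with `|λ_i| ≤ H` for `1 ≤ i ≤ m`. -/
def admissibleExponents (m : ℕ) (H : ℝ) : Set ℝ :=
  {r : ℝ | 0 < r ∧ ∀ lam : Fin (m + 1) → ℤ, lam ≠ 0 →
    (∀ i : Fin (m + 1), i ≠ 0 → |(lam i : ℝ)| ≤ H) →
      1 / H ^ r < |∑ i : Fin (m + 1), (lam i : ℝ) * Real.exp 1 ^ (i : ℕ)|}

/-- `ω(m, H)`, the infimum of the admissible exponents, taken in the extended reals
(so that it is `⊤`, not `0`, when no exponent is admissible). -/
noncomputable def omegaE (m : ℕ) (H : ℝ) : EReal :=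
  sInf (Real.toEReal '' admissibleExponents m H)

/-!
The proof makes Hermite's proof of the transcendence of `e` quantitative, and gains from common
factors.

**Approximations.** Let `F = X (X - 1) ⋯ (X - m)` and let `S f = f + f' + f'' + ⋯`, which is
`Polynomial.sumIDeriv`. Hermite's identity says that `e ^ t (S f)(0) - (S f)(t)` is an integral of
`f` over `[0, t]`. For `f = F ^ n F / (X - k)` it is at most a constant times `M ^ n`, where `M`
bounds `|F|` on `[0, m]`. So the integers `(S f)(j)`, `0 ≤ j ≤ m`, are nearly proportional to the
powers `e ^ j`. As `k` varies they form a nonsingular matrix (`eq_zero_of_functional_eq_zero`):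
given nonzero coefficients `λ`, some `k` has `∑ λ_j (S f)(j) ≠ 0`.

**Common factors.** These integers are divisible by `n !`, and every node `i ≠ j` with `i ≡ j`
modulo a prime `p` contributes another copy of the `p`-part of `n !` to `(S f)(j)`. There are at
least `N_p = min_j (⌊j / p⌋ + ⌊(m - j) / p⌋)` such nodes, so `D = n ! ∏ p ^ (v_p (n !) N_p)` is a
common divisor (`hermiteDivisor_dvd`), and a nonzero combination is at least `D` in absolute value.
When `D` outweighs the remainders, the linear form is bounded below by `D / (2 |(S f)(0)|)`
(`omegaE_le_of_hermiteDivisor`). Since `v_p (n !) log p ≈ n log p / (p - 1)`, the gain is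
`n ∑ N_p log p / (p - 1)`, which is about `n m κ_m`.

**Choice of `n`.** Taking the least `n` for which `D` outweighs the remainders gives
`ω(m, H) ≤ m + C / log log H` as soon as a few inequalities hold at the threshold for `H`
(`omegaE_le_add_div`). They are checked by explicit estimates for `m = 2, 3, 4`, by exact rational
arithmetic for `5 ≤ m < 128`, with `M = m ! e ^ (-v)` and `e ^ (v - 1)` at most the `m`-th harmonic
number, and by hand for `m ≥ 128`. The weights `w_p ≤ 1` in `κ_m` only weaken the bounds.

**The limit of `κ_m`.** The limit is taken termwise, by dominated convergence, and the weights tend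
to `1` uniformly. For the digits, `∑ log p / (p (p - 1))` is expressed through the sums
`∑ log p / (p ^ k - 1) = -ζ'(k) / ζ(k)` for `k = 2, 3, 5, 6, 7` up to terms of order `p ^ (-10)`.
The quotient `-ζ'(k) / ζ(k) = (∑ log n / n ^ k) / (∑ 1 / n ^ k)` involves sums over all integers,
which the Euler–Maclaurin formula evaluates (`tsum_log_div_pow_bounds`).
-/

/-! ### Hermite's functional -/

section HermiteFunctional

open Polynomial

theorem sum_eval_sumIDeriv_eq {ι : Type*} (s : Finset ι) (v lam : ι → ℝ) (g : ℝ[X]) :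
    ∑ i ∈ s, lam i * (sumIDeriv g).eval (v i) =
      ∑ i ∈ s, lam i * (sumIDeriv (derivative g)).eval (v i) + ∑ i ∈ s, lam i * g.eval (v i) := by
  rw [← Finset.sum_add_distrib]
  refine Finset.sum_congr rfl fun i _ => ?_
  rw [sumIDeriv_derivative, ← mul_add, ← eval_add, add_comm, ← sumIDeriv_eq_self_add]

theorem nodal_dvd_of_eval_eq_zero {ι : Type*} {s : Finset ι} {v : ι → ℝ}
    (hv : Set.InjOn v s) {g : ℝ[X]} (hg : ∀ i ∈ s, g.eval (v i) = 0) :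
    Lagrange.nodal s v ∣ g := by
  rw [Lagrange.nodal_eq]
  refine Finset.prod_dvd_of_coprime (fun i hi j hj hij => ?_) fun i hi => ?_
  · exact isCoprime_X_sub_C_of_isUnit_sub
      (sub_ne_zero.mpr fun h => hij (hv hi hj h)).isUnit
  · exact dvd_iff_isRoot.mpr (hg i hi)

/-- One step of the descent: the functional kills `F ^ n * g` for all `g` of small degree as soon
as it kills `F ^ (n + 1) * g` for all such `g`. The point is that
`F ^ n * g = (F ^ (n + 1) * q)' + F ^ (n + 1) * u` when `q` interpolates `g / ((n + 1) F')` at the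
roots of `F`. -/
theorem functional_nodal_pow_descent {ι : Type*} [DecidableEq ι] {s : Finset ι} {v : ι → ℝ}
    (hv : Set.InjOn v s) (lam : ι → ℝ) (n : ℕ)
    (h : ∀ g : ℝ[X], g.degree < s.card →
      ∑ i ∈ s, lam i * (sumIDeriv (Lagrange.nodal s v ^ (n + 1) * g)).eval (v i) = 0)
    (g : ℝ[X]) (hg : g.degree < s.card) :
    ∑ i ∈ s, lam i * (sumIDeriv (Lagrange.nodal s v ^ n * g)).eval (v i) = 0 := by
  set F := Lagrange.nodal s v with hF
  have hF' : ∀ i ∈ s, (derivative F).eval (v i) ≠ 0 := by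
    intro i hi
    rw [hF, Lagrange.eval_nodal_derivative_eval_node_eq hi, Lagrange.eval_nodal]
    refine Finset.prod_ne_zero_iff.mpr fun j hj => sub_ne_zero.mpr fun hij => ?_
    exact (Finset.ne_of_mem_erase hj) (hv (Finset.mem_of_mem_erase hj) hi hij.symm)
  set q := Lagrange.interpolate s v
    (fun i => g.eval (v i) / ((n + 1 : ℝ) * (derivative F).eval (v i))) with hq
  have hqd : q.degree < s.card := Lagrange.degree_interpolate_lt _ hv
  have hqe : ∀ i ∈ s, q.eval (v i) = g.eval (v i) / ((n + 1 : ℝ) * (derivative F).eval (v i)) :=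
    fun i hi => Lagrange.eval_interpolate_at_node _ hv hi
  have hFd : F.degree = s.card := Lagrange.degree_nodal
  have hFm : F.Monic := Lagrange.nodal_monic
  obtain ⟨u, hu⟩ : F ∣ g - (C (n + 1 : ℝ) * derivative F * q + F * derivative q) := by
    refine nodal_dvd_of_eval_eq_zero hv fun i hi => ?_
    have h0 : F.eval (v i) = 0 := Lagrange.eval_nodal_at_node hi
    simp only [eval_sub, eval_add, eval_mul, eval_C, h0, hqe i hi]
    have : (n + 1 : ℝ) ≠ 0 := by positivity
    field_simp [hF' i hi]
    ring
  have hud : u.degree < s.card := by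
    by_contra hcon
    push Not at hcon
    have hs0 : s.card ≠ 0 := by
      intro h0
      have hs : s = ∅ := Finset.card_eq_zero.mp h0
      rw [h0] at hg hqd
      have hg0 : g = 0 := by
        by_contra hne
        rw [degree_eq_natDegree hne] at hg
        exact absurd hg (by simp)
      have hq0 : q = 0 := by
        by_contra hne
        rw [degree_eq_natDegree hne] at hqd
        exact absurd hqd (by simp)
      rw [hg0, hq0] at hu
      simp only [mul_zero, derivative_zero, add_zero, sub_zero] at hu
      have : u = 0 := by
        rcases mul_eq_zero.mp hu.symm with h1 | h1
        · exact absurd h1 hFm.ne_zero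
        · exact h1
      rw [this] at hcon
      simp at hcon
    have hu0 : u ≠ 0 := by
      rintro rfl
      simp at hcon
    have hun : s.card ≤ u.natDegree := by
      rw [degree_eq_natDegree hu0] at hcon
      exact_mod_cast hcon
    have hFn : F.natDegree = s.card := Lagrange.natDegree_nodal
    have h1 : (F * u).natDegree = s.card + u.natDegree := by
      rw [natDegree_mul hFm.ne_zero hu0, hFn]
    have hqn : q.natDegree < s.card := by
      by_cases hq0 : q = 0
      · rw [hq0]; simpa using Nat.pos_of_ne_zero hs0
      · rw [degree_eq_natDegree hq0] at hqd; exact_mod_cast hqd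
    have hgn : g.natDegree < s.card := by
      by_cases hg0 : g = 0
      · rw [hg0]; simpa using Nat.pos_of_ne_zero hs0
      · rw [degree_eq_natDegree hg0] at hg; exact_mod_cast hg
    have hF'n : (derivative F).natDegree ≤ s.card := by
      rw [← hFn]; exact (natDegree_derivative_le F).trans (Nat.sub_le _ _)
    have hq'n : (derivative q).natDegree ≤ q.natDegree :=
      (natDegree_derivative_le q).trans (Nat.sub_le _ _)
    have h2 : (g - (C (n + 1 : ℝ) * derivative F * q + F * derivative q)).natDegree ≤
        s.card + q.natDegree := by
      refine (natDegree_sub_le _ _).trans (max_le (by omega) ?_)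
      refine (natDegree_add_le _ _).trans (max_le ?_ ?_)
      · refine natDegree_mul_le.trans (add_le_add ?_ le_rfl)
        exact natDegree_C_mul_le _ _ |>.trans hF'n
      · exact natDegree_mul_le.trans (add_le_add hFn.le hq'n)
    rw [hu, h1] at h2
    omega
  have hsplit : F ^ n * g = derivative (F ^ (n + 1) * q) + F ^ (n + 1) * u := by
    have : g = C (n + 1 : ℝ) * derivative F * q + F * derivative q + F * u := by
      rw [← hu]; ring
    rw [derivative_mul, derivative_pow_succ]
    nth_rw 1 [this]
    simp only [map_add, map_natCast, map_one]
    ring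
  rw [hsplit, map_add]
  simp only [eval_add, mul_add, Finset.sum_add_distrib]
  rw [h u hud, add_zero]
  have h3 := sum_eval_sumIDeriv_eq s v lam (F ^ (n + 1) * q)
  rw [h q hqd] at h3
  have h4 : ∑ i ∈ s, lam i * (F ^ (n + 1) * q).eval (v i) = 0 := by
    refine Finset.sum_eq_zero fun i hi => ?_
    have h0 : F.eval (v i) = 0 := Lagrange.eval_nodal_at_node hi
    simp [h0]
  rw [h4, add_zero] at h3
  exact h3.symm

/-- The values `(sumIDeriv (F ^ n * F / (X - v k))).eval (v j)` form a nonsingular matrix, where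
`F` is the nodal polynomial. -/
theorem eq_zero_of_functional_eq_zero {ι : Type*} [DecidableEq ι] {s : Finset ι} {v : ι → ℝ}
    (hv : Set.InjOn v s) (lam : ι → ℝ) (n : ℕ)
    (h : ∀ k ∈ s, ∑ i ∈ s, lam i *
      (sumIDeriv (Lagrange.nodal s v ^ n * Lagrange.nodal (s.erase k) v)).eval (v i) = 0) :
    ∀ k ∈ s, lam k = 0 := by
  have h1 : ∀ g : ℝ[X], g.degree < s.card →
      ∑ i ∈ s, lam i * (sumIDeriv (Lagrange.nodal s v ^ n * g)).eval (v i) = 0 := by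
    intro g hg
    rw [Lagrange.eq_interpolate hv hg, Lagrange.interpolate_apply, Finset.mul_sum, map_sum]
    simp only [eval_finsetSum, Finset.mul_sum]
    rw [Finset.sum_comm]
    refine Finset.sum_eq_zero fun k hk => ?_
    have e1 : Lagrange.nodal s v ^ n * (C (g.eval (v k)) * Lagrange.basis s v k) =
        (g.eval (v k) * Lagrange.nodalWeight s v k) •
          (Lagrange.nodal s v ^ n * Lagrange.nodal (s.erase k) v) := by
      rw [Lagrange.basis_eq_prod_sub_inv_mul_nodal_div hk, ← Lagrange.nodal_erase_eq_nodal_div hk,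
        smul_eq_C_mul, C_mul]
      ring
    simp only [e1, map_smul, eval_smul, smul_eq_mul]
    rw [← mul_zero (g.eval (v k) * Lagrange.nodalWeight s v k), ← h k hk, Finset.mul_sum]
    refine Finset.sum_congr rfl fun i _ => by ring
  have h2 : ∀ g : ℝ[X], g.degree < s.card →
      ∑ i ∈ s, lam i * (sumIDeriv g).eval (v i) = 0 := by
    clear h
    induction n with
    | zero => simpa using h1
    | succ n ih => exact ih (functional_nodal_pow_descent hv lam n h1)
  intro k hk
  have hd : (Lagrange.basis s v k).degree < s.card := by
    rw [Lagrange.degree_basis hv hk]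
    have := Finset.card_pos.mpr ⟨k, hk⟩
    exact_mod_cast Nat.sub_lt this one_pos
  have h3 := sum_eval_sumIDeriv_eq s v lam (Lagrange.basis s v k)
  rw [h2 _ hd, h2 _ (lt_of_le_of_lt (degree_derivative_le) hd), zero_add,
    Finset.sum_eq_single k] at h3
  · rw [Lagrange.eval_basis_self hv hk, mul_one] at h3
    exact h3.symm
  · intro i hi hik
    rw [Lagrange.eval_basis_of_ne hik.symm hi, mul_zero]
  · intro h; exact absurd hk h

/-- Hermite's identity: `e ^ t` times the value of `sumIDeriv f` at `0` is its value at `t` up to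
an integral of `f` over `[0, t]`. -/
theorem exp_mul_eval_sumIDeriv_sub (f : ℝ[X]) (t : ℝ) :
    Real.exp t * (sumIDeriv f).eval 0 - (sumIDeriv f).eval t =
      ∫ x in (0 : ℝ)..t, Real.exp (t - x) * f.eval x := by
  have hd : ∀ x ∈ Set.uIcc 0 t, HasDerivAt (fun x => -(Real.exp (t - x) * (sumIDeriv f).eval x))
      (Real.exp (t - x) * f.eval x) x := by
    intro x _
    have h1 : HasDerivAt (fun x => Real.exp (t - x)) (Real.exp (t - x) * (0 - 1)) x :=
      ((hasDerivAt_const x t).sub (hasDerivAt_id x)).exp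
    have h2 := (h1.mul ((sumIDeriv f).hasDerivAt x)).neg
    refine HasDerivAt.congr_deriv h2 ?_
    have h3 : (sumIDeriv f).eval x = f.eval x + (derivative (sumIDeriv f)).eval x := by
      nth_rw 1 [sumIDeriv_eq_self_add f]; rw [eval_add]
    simp only [h3]; ring
  rw [intervalIntegral.integral_eq_sub_of_hasDerivAt hd
    (Continuous.intervalIntegrable (by fun_prop) _ _)]
  simp
  ring

/-- Domination on the half line: `(sumIDeriv f).eval 0` is the integral of `e ^ (-x) f` over
`[0, ∞)`, so it is monotone in `f`. -/
theorem abs_eval_sumIDeriv_zero_le {f g : ℝ[X]} (h : ∀ x : ℝ, 0 ≤ x → |f.eval x| ≤ g.eval x) :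
    |(sumIDeriv f).eval 0| ≤ (sumIDeriv g).eval 0 := by
  have key : ∀ p : ℝ[X], (∀ x : ℝ, 0 ≤ x → 0 ≤ p.eval x) → 0 ≤ (sumIDeriv p).eval 0 := by
    intro p hp
    have h1 : ∀ t : ℝ, 0 ≤ t → (sumIDeriv p).eval t / Real.exp t ≤ (sumIDeriv p).eval 0 := by
      intro t ht
      have h2 := exp_mul_eval_sumIDeriv_sub p t
      have h3 : 0 ≤ ∫ x in (0 : ℝ)..t, Real.exp (t - x) * p.eval x :=
        intervalIntegral.integral_nonneg ht fun x hx =>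
          mul_nonneg (Real.exp_pos _).le (hp x hx.1)
      rw [div_le_iff₀ (Real.exp_pos t)]
      linarith
    refine le_of_tendsto (Polynomial.tendsto_div_exp_atTop (sumIDeriv p)) ?_
    filter_upwards [Filter.eventually_ge_atTop 0] with t ht using h1 t ht
  have h1 := key (g - f) fun x hx => by
    rw [eval_sub]; linarith [le_abs_self (f.eval x), h x hx]
  have h2 := key (g + f) fun x hx => by
    rw [eval_add]; linarith [neg_abs_le (f.eval x), h x hx]
  rw [map_sub, eval_sub] at h1
  rw [map_add, eval_add] at h2
  exact abs_le.mpr ⟨by linarith, by linarith⟩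

theorem eval_zero_sumIDeriv_X_pow (N : ℕ) : (sumIDeriv (X ^ N : ℝ[X])).eval 0 = N.factorial := by
  induction N with
  | zero => rw [pow_zero, ← C_1, sumIDeriv_C]; simp
  | succ N ih =>
    rw [sumIDeriv_eq_self_add, ← sumIDeriv_derivative, derivative_X_pow_succ, eval_add]
    have : (C ((N : ℝ) + 1) * X ^ N : ℝ[X]) = ((N : ℝ) + 1) • X ^ N := (smul_eq_C_mul _).symm
    rw [this, map_smul, eval_smul, ih, Nat.factorial_succ]
    push_cast
    simp

end HermiteFunctional

/-! ### Common factors of the Hermite–Padé numbers -/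

section CommonFactors

open Polynomial

theorem factorial_dvd_eval_sumIDeriv (r : ℤ) (a : ℕ) (q : ℤ[X]) :
    (a.factorial : ℤ) ∣ (sumIDeriv ((X - C r) ^ a * q)).eval r := by
  obtain ⟨gp, -, h⟩ := aeval_sumIDeriv (A := ℤ) ((X - C r) ^ a * q) a
  have h1 := h r (by simp [Polynomial.map_mul])
  rw [aeval_def, eval₂_eq_eval_map] at h1
  simp only [algebraMap_int_eq, nsmul_eq_mul] at h1
  have h2 : Polynomial.map (Int.castRingHom ℤ) (sumIDeriv ((X - C r) ^ a * q)) =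
      sumIDeriv ((X - C r) ^ a * q) := by
    rw [show Int.castRingHom ℤ = RingHom.id ℤ from Subsingleton.elim _ _, Polynomial.map_id]
  rw [h2] at h1
  exact ⟨_, h1⟩

theorem pow_padicValNat_factorial_dvd {p : ℕ} (hp : p.Prime) {n h : ℕ} (hh : h ≤ n) :
    p ^ padicValNat p n.factorial ∣ h.factorial * n.choose h * p ^ (n - h) := by
  have := Fact.mk hp
  have h0 : h.factorial * n.choose h ≠ 0 :=
    mul_ne_zero h.factorial_ne_zero (Nat.choose_pos hh).ne'
  have h1 : h.factorial * n.choose h * (n - h).factorial = n.factorial := by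
    rw [mul_comm h.factorial, Nat.choose_mul_factorial_mul_factorial hh]
  have h2 : padicValNat p (h.factorial * n.choose h) + padicValNat p (n - h).factorial =
      padicValNat p n.factorial := by
    rw [← h1, padicValNat.mul h0 (Nat.factorial_ne_zero _)]
  have h3 : padicValNat p (n - h).factorial ≤ n - h := padicValNat_factorial_le p _
  calc p ^ padicValNat p n.factorial ∣
        p ^ (padicValNat p (h.factorial * n.choose h) + (n - h)) := pow_dvd_pow p (by omega)
    _ ∣ _ := by
        rw [pow_add]
        exact mul_dvd_mul pow_padicValNat_dvd dvd_rfl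

/-- Every root of `F` congruent to `r` modulo `p` contributes, besides the factor `a !` coming from
the root `r` itself, another copy of the `p`-part of `n !`. -/
theorem factorial_mul_pow_dvd_eval_sumIDeriv {p : ℕ} (hp : p.Prime) (n : ℕ) (r : ℤ)
    {ι : Type*} (s : Finset ι) (c : ι → ℤ) (hc : ∀ i ∈ s, (p : ℤ) ∣ r - c i) (a : ℕ)
    (q : ℤ[X]) :
    ((a.factorial * (p ^ padicValNat p n.factorial) ^ s.card : ℕ) : ℤ) ∣
      (sumIDeriv ((X - C r) ^ a * ((∏ i ∈ s, (X - C (c i)) ^ n) * q))).eval r := by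
  classical
  induction s using Finset.induction_on generalizing a with
  | empty => simpa using factorial_dvd_eval_sumIDeriv r a q
  | insert i s hi ih =>
    have hc' : ∀ i ∈ s, (p : ℤ) ∣ r - c i := fun j hj => hc j (Finset.mem_insert_of_mem hj)
    obtain ⟨e, he⟩ := hc i (Finset.mem_insert_self i s)
    have hX : (X - C (c i) : ℤ[X]) = (X - C r) + C (p * e) := by
      rw [← he, C_sub]; ring
    have hsplit : (X - C r) ^ a * ((∏ j ∈ insert i s, (X - C (c j)) ^ n) * q) =
        ∑ h ∈ Finset.range (n + 1), ((p * e : ℤ) ^ (n - h) * n.choose h) •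
          ((X - C r) ^ (a + h) * ((∏ j ∈ s, (X - C (c j)) ^ n) * q)) := by
      rw [Finset.prod_insert hi, hX, add_pow]
      simp only [Finset.sum_mul, Finset.mul_sum]
      refine Finset.sum_congr rfl fun h _ => ?_
      rw [smul_eq_C_mul, pow_add]
      simp only [C_mul, C_pow, map_natCast]
      ring
    rw [hsplit, map_sum, eval_finsetSum]
    refine Finset.dvd_sum fun h hh => ?_
    have hh' : h ≤ n := Nat.lt_succ_iff.mp (Finset.mem_range.mp hh)
    rw [map_smul, eval_smul, smul_eq_mul, Finset.card_insert_of_notMem hi]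
    have h1 : ((a + h).factorial * (p ^ padicValNat p n.factorial) ^ s.card *
        (p ^ (n - h) * n.choose h) : ℤ) ∣
        ((p * e : ℤ) ^ (n - h) * n.choose h) *
          (sumIDeriv ((X - C r) ^ (a + h) * ((∏ j ∈ s, (X - C (c j)) ^ n) * q))).eval r := by
      rw [mul_comm]
      refine mul_dvd_mul ?_ (by exact_mod_cast ih hc' (a + h))
      rw [mul_pow]
      exact mul_dvd_mul (Dvd.intro _ rfl) dvd_rfl
    refine dvd_trans ?_ h1
    have h2 : a.factorial * (p ^ padicValNat p n.factorial) ^ (s.card + 1) ∣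
        (a + h).factorial * (p ^ padicValNat p n.factorial) ^ s.card *
          (p ^ (n - h) * n.choose h) := by
      obtain ⟨w, hw⟩ := pow_padicValNat_factorial_dvd hp hh'
      refine ⟨(a + h).choose h * w, ?_⟩
      calc (a + h).factorial * (p ^ padicValNat p n.factorial) ^ s.card *
            (p ^ (n - h) * n.choose h)
          = (a + h).choose h * a.factorial * (p ^ padicValNat p n.factorial) ^ s.card *
            (h.factorial * n.choose h * p ^ (n - h)) := by
            rw [← Nat.add_choose_mul_factorial_mul_factorial a h]; ring
        _ = _ := by rw [hw]; ring
    exact_mod_cast h2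

theorem minFloorSum_le {m j : ℕ} (p : ℕ) (hj : j ≤ m) :
    minFloorSum m p ≤ j / p + (m - j) / p :=
  Finset.inf'_le (fun j => j / p + (m - j) / p) (Finset.mem_range.mpr (Nat.lt_succ_of_le hj))

theorem minFloorSum_eq {p : ℕ} (hp : 0 < p) (m : ℕ) : minFloorSum m p = (m + 1) / p - 1 := by
  apply le_antisymm
  · rcases Nat.lt_or_ge m p with hmp | hmp
    · refine (minFloorSum_le p (Nat.zero_le m)).trans ?_
      simp [Nat.div_eq_of_lt hmp]
    · refine (minFloorSum_le p (show p - 1 ≤ m by omega)).trans ?_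
      rw [Nat.div_eq_of_lt (show p - 1 < p by omega), zero_add,
        show m - (p - 1) = m + 1 - p by omega, Nat.div_eq_sub_div hp (by omega : p ≤ m + 1),
        Nat.add_sub_cancel]
  · refine Finset.le_inf' _ _ fun j hj => ?_
    have hj' : j ≤ m := Nat.lt_succ_iff.mp (Finset.mem_range.mp hj)
    rw [Nat.sub_le_iff_le_add]
    have h1 := Nat.lt_mul_div_succ j hp
    have h2 := Nat.lt_mul_div_succ (m - j) hp
    have h3 : m + 1 < p * (j / p + (m - j) / p + 2) := by
      have : p * (j / p + (m - j) / p + 2) = p * (j / p + 1) + p * ((m - j) / p + 1) := by ring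
      omega
    have h4 := (Nat.div_lt_iff_lt_mul hp).mpr (by rw [mul_comm] at h3; exact h3)
    omega

/-- The indices `i ≠ j` in `[0, m]` with `i ≡ j` modulo `p` number at least `minFloorSum m p`. -/
theorem minFloorSum_le_card {m j p : ℕ} (hp : 0 < p) (hj : j ≤ m) :
    minFloorSum m p ≤
      (((Finset.range (m + 1)).erase j).filter fun i : ℕ => (p : ℤ) ∣ (j : ℤ) - (i : ℤ)).card := by
  classical
  refine (minFloorSum_le p hj).trans ?_
  set A := (Finset.range (j / p)).image fun t => j - p * (t + 1)
  set B := (Finset.range ((m - j) / p)).image fun t => j + p * (t + 1)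
  have hlow : ∀ t < j / p, p * (t + 1) ≤ j := fun t ht =>
    (Nat.mul_le_mul_left p ht).trans (Nat.mul_div_le j p)
  have hhigh : ∀ t < (m - j) / p, p * (t + 1) ≤ m - j := fun t ht =>
    (Nat.mul_le_mul_left p ht).trans (Nat.mul_div_le (m - j) p)
  have hpos : ∀ t, 0 < p * (t + 1) := fun t => Nat.mul_pos hp (Nat.succ_pos t)
  have hA : A.card = j / p := by
    rw [Finset.card_image_of_injOn, Finset.card_range]
    intro t ht u hu h
    have h1 := hlow t (Finset.mem_range.mp ht)
    have h2 := hlow u (Finset.mem_range.mp hu)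
    have h3 : p * (t + 1) = p * (u + 1) := by
      simp only at h
      omega
    exact Nat.succ_injective (Nat.eq_of_mul_eq_mul_left hp h3)
  have hB : B.card = (m - j) / p := by
    rw [Finset.card_image_of_injOn, Finset.card_range]
    intro t _ u _ h
    have h3 : p * (t + 1) = p * (u + 1) := by
      simp only at h
      omega
    exact Nat.succ_injective (Nat.eq_of_mul_eq_mul_left hp h3)
  have hAB : Disjoint A B := by
    rw [Finset.disjoint_left]
    intro x hx hy
    obtain ⟨t, -, rfl⟩ := Finset.mem_image.mp hx
    obtain ⟨u, -, hu⟩ := Finset.mem_image.mp hy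
    have := hpos u
    omega
  rw [← hA, ← hB, ← Finset.card_union_of_disjoint hAB]
  refine Finset.card_le_card fun x hx => ?_
  rw [Finset.mem_filter, Finset.mem_erase, Finset.mem_range]
  rcases Finset.mem_union.mp hx with h | h
  · obtain ⟨t, ht, rfl⟩ := Finset.mem_image.mp h
    have h1 := hlow t (Finset.mem_range.mp ht)
    have h2 := hpos t
    refine ⟨⟨by omega, by omega⟩, ⟨(t + 1 : ℕ), ?_⟩⟩
    rw [Nat.cast_sub h1]
    push_cast
    ring
  · obtain ⟨t, ht, rfl⟩ := Finset.mem_image.mp h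
    have h1 := hhigh t (Finset.mem_range.mp ht)
    have h2 := hpos t
    refine ⟨⟨by omega, by omega⟩, ⟨-(t + 1 : ℕ), ?_⟩⟩
    push_cast
    ring

/-- The common factor `n ! * ∏ p ^ (v_p (n !) * N_p)` of the Hermite–Padé numbers of order `n`,
where `N_p = minFloorSum m p`. -/
noncomputable def hermiteDivisor (m n : ℕ) : ℕ :=
  n.factorial * ∏ p ∈ (Finset.range (m + 1)).filter Nat.Prime,
    p ^ (padicValNat p n.factorial * minFloorSum m p)

theorem hermiteDivisor_pos (m n : ℕ) : 0 < hermiteDivisor m n :=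
  Nat.mul_pos n.factorial_pos <| Finset.prod_pos fun _ hp =>
    pow_pos (Finset.mem_filter.mp hp).2.pos _

theorem factorization_hermiteDivisor_le (m n : ℕ) {p : ℕ} (hp : p.Prime) :
    (hermiteDivisor m n).factorization p ≤ padicValNat p n.factorial * (1 + minFloorSum m p) := by
  have h1 : (∏ q ∈ (Finset.range (m + 1)).filter Nat.Prime,
      q ^ (padicValNat q n.factorial * minFloorSum m q)) ≠ 0 :=
    (Finset.prod_pos fun q hq => pow_pos (Finset.mem_filter.mp hq).2.pos _).ne'
  rw [hermiteDivisor, Nat.factorization_mul n.factorial_ne_zero h1, Finsupp.add_apply, mul_add,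
    mul_one, Nat.factorization_def _ hp]
  refine Nat.add_le_add_left ?_ _
  rw [Nat.factorization_prod (fun q hq => (pow_pos (Finset.mem_filter.mp hq).2.pos _).ne'),
    Finsupp.finsetSum_apply]
  have h2 : ∀ q ∈ (Finset.range (m + 1)).filter Nat.Prime,
      (q ^ (padicValNat q n.factorial * minFloorSum m q)).factorization p =
        if q = p then padicValNat p n.factorial * minFloorSum m p else 0 := by
    intro q hq
    rw [(Finset.mem_filter.mp hq).2.factorization_pow, Finsupp.single_apply]
    split_ifs with h
    · rw [h]
    · rfl
  rw [Finset.sum_congr rfl h2, Finset.sum_ite_eq']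
  split_ifs <;> simp

theorem hermiteDivisor_dvd {m j : ℕ} (n : ℕ) (hj : j ≤ m) (q : ℤ[X]) :
    (hermiteDivisor m n : ℤ) ∣
      (sumIDeriv (Lagrange.nodal (Finset.range (m + 1)) (fun i : ℕ => (i : ℤ)) ^ n * q)).eval
        (j : ℤ) := by
  classical
  set A := (sumIDeriv (Lagrange.nodal (Finset.range (m + 1)) (fun i : ℕ => (i : ℤ)) ^ n * q)).eval
        (j : ℤ) with hA
  rw [Int.natCast_dvd]
  rcases Nat.eq_zero_or_pos A.natAbs with h0 | h0
  · rw [h0]; exact dvd_zero _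
  rw [← Nat.factorization_prime_le_iff_dvd (hermiteDivisor_pos m n).ne' h0.ne']
  intro p hp
  refine (factorization_hermiteDivisor_le m n hp).trans ?_
  rw [← hp.pow_dvd_iff_le_factorization h0.ne', ← Int.natCast_dvd_natCast, Int.dvd_natAbs]
  set S := ((Finset.range (m + 1)).erase j).filter fun i : ℕ => (p : ℤ) ∣ (j : ℤ) - (i : ℤ) with hS
  have hjm : j ∈ Finset.range (m + 1) := Finset.mem_range.mpr (Nat.lt_succ_of_le hj)
  have hF : Lagrange.nodal (Finset.range (m + 1)) (fun i : ℕ => (i : ℤ)) ^ n * q =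
      (X - C (j : ℤ)) ^ n * ((∏ i ∈ S, (X - C (i : ℤ)) ^ n) *
        ((∏ i ∈ ((Finset.range (m + 1)).erase j).filter
          (fun i : ℕ => ¬ (p : ℤ) ∣ (j : ℤ) - (i : ℤ)), (X - C (i : ℤ)) ^ n) * q)) := by
    rw [← mul_assoc (∏ i ∈ S, _), hS, Finset.prod_filter_mul_prod_filter_not, ← mul_assoc,
      Finset.mul_prod_erase _ (fun i : ℕ => (X - C (i : ℤ)) ^ n) hjm, Finset.prod_pow,
      Lagrange.nodal_eq]
  rw [hA, hF]
  refine dvd_trans ?_ (factorial_mul_pow_dvd_eval_sumIDeriv hp n (j : ℤ) S (fun i : ℕ => (i : ℤ))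
    (fun i hi => (Finset.mem_filter.mp hi).2) n _)
  rw [Int.natCast_dvd_natCast, pow_mul, pow_add, pow_one]
  exact mul_dvd_mul pow_padicValNat_dvd
    (pow_dvd_pow _ (minFloorSum_le_card hp.pos hj))

end CommonFactors

/-! ### From Hermite–Padé numbers to exponents -/

section Reduction

open Polynomial

theorem factorial_succ_mul_factorial_succ_le (a b : ℕ) :
    (a + 1).factorial * (b + 1).factorial ≤ (a + b + 1).factorial := by
  induction b with
  | zero => simp
  | succ b ih =>
    rw [Nat.factorial_succ (b + 1), show a + (b + 1) + 1 = (a + b + 1) + 1 by ring,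
      Nat.factorial_succ (a + b + 1)]
    calc (a + 1).factorial * ((b + 1 + 1) * (b + 1).factorial)
        = (b + 1 + 1) * ((a + 1).factorial * (b + 1).factorial) := by ring
      _ ≤ _ := Nat.mul_le_mul (by omega) ih

theorem exists_mem_unit_interval {m : ℕ} (hm : 1 ≤ m) {x : ℝ} (h0 : 0 ≤ x) (hx : x ≤ m) :
    ∃ a b : ℕ, a + b + 1 = m ∧ (a : ℝ) ≤ x ∧ x ≤ a + 1 := by
  rcases lt_or_eq_of_le hx with h | h
  · have h1 : ⌊x⌋₊ < m := (Nat.floor_lt h0).mpr h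
    exact ⟨⌊x⌋₊, m - 1 - ⌊x⌋₊, by omega, Nat.floor_le h0, (Nat.lt_floor_add_one x).le⟩
  · obtain ⟨a, rfl⟩ : ∃ a, m = a + 1 := ⟨m - 1, by omega⟩
    refine ⟨a, 0, by ring, ?_, ?_⟩ <;> rw [h] <;> push_cast <;> linarith

/-- On `[0, m]` any product of distances to distinct nodes among `0, …, m` is at most `m !`. -/
theorem prod_abs_sub_le_factorial {m : ℕ} (hm : 1 ≤ m) {T : Finset ℕ}
    (hT : T ⊆ Finset.range (m + 1)) {x : ℝ} (h0 : 0 ≤ x) (hx : x ≤ m) :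
    ∏ i ∈ T, |x - (i : ℝ)| ≤ m.factorial := by
  obtain ⟨a, b, rfl, ha, ha'⟩ := exists_mem_unit_interval hm h0 hx
  -- `u i` bounds the distance from `x` to the node `i`, and it is at least `1`
  set u : ℕ → ℕ := fun i => if i ≤ a then a + 1 - i else i - a with hu
  have h1 : ∀ i, 1 ≤ u i := by
    intro i
    simp only [hu]
    split_ifs <;> omega
  have h2 : ∀ i : ℕ, |x - (i : ℝ)| ≤ u i := by
    intro i
    simp only [hu]
    split_ifs with h
    · have hi : (i : ℝ) ≤ a := by exact_mod_cast h
      rw [Nat.cast_sub (by omega), abs_of_nonneg (by linarith)]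
      push_cast
      linarith
    · have hi : (a : ℝ) + 1 ≤ i := by exact_mod_cast (by omega : a + 1 ≤ i)
      rw [Nat.cast_sub (by omega), abs_of_nonpos (by linarith)]
      linarith
  have h3 : ∏ i ∈ Finset.range (a + b + 1 + 1), u i = (a + 1).factorial * (b + 1).factorial := by
    rw [show a + b + 1 + 1 = (a + 1) + (b + 1) by ring, Finset.prod_range_add]
    congr 1
    · rw [← Finset.prod_range_add_one_eq_factorial, ← Finset.prod_range_reflect]
      refine Finset.prod_congr rfl fun i hi => ?_
      have := Finset.mem_range.mp hi
      simp only [hu]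
      split_ifs <;> omega
    · rw [← Finset.prod_range_add_one_eq_factorial]
      refine Finset.prod_congr rfl fun i _ => ?_
      simp only [hu]
      split_ifs <;> omega
  calc ∏ i ∈ T, |x - (i : ℝ)| ≤ ∏ i ∈ T, (u i : ℝ) :=
        Finset.prod_le_prod (fun i _ => abs_nonneg _) fun i _ => h2 i
    _ = ((∏ i ∈ T, u i : ℕ) : ℝ) := by push_cast; rfl
    _ ≤ ((∏ i ∈ Finset.range (a + b + 1 + 1), u i : ℕ) : ℝ) := by
        exact_mod_cast Finset.prod_le_prod_of_subset_of_one_le' hT fun i _ _ => h1 i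
    _ ≤ _ := by
        rw [h3]
        exact_mod_cast factorial_succ_mul_factorial_succ_le a b

theorem prod_abs_sub_le_pow {m : ℕ} {T : Finset ℕ}
    (hT : T ⊆ Finset.range (m + 1)) {x : ℝ} (hx : m ≤ x) :
    ∏ i ∈ T, |x - (i : ℝ)| ≤ x ^ T.card := by
  rw [← Finset.prod_const]
  refine Finset.prod_le_prod (fun i _ => abs_nonneg _) fun i hi => ?_
  have h1 : (i : ℝ) ≤ m := by exact_mod_cast Nat.lt_succ_iff.mp (Finset.mem_range.mp (hT hi))
  have h2 : (0 : ℝ) ≤ i := Nat.cast_nonneg i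
  rw [abs_of_nonneg (by linarith)]
  linarith

theorem factorial_pow_le_factorial_mul (m n : ℕ) : m.factorial ^ n ≤ (m * n).factorial := by
  induction n with
  | zero => simp
  | succ n ih =>
    rw [pow_succ, Nat.mul_succ]
    exact (Nat.mul_le_mul_right _ ih).trans 
      (Nat.le_of_dvd (Nat.factorial_pos _) (Nat.factorial_mul_factorial_dvd_factorial_add _ _))

/-- The auxiliary polynomial `F ^ n * F / (X - k)` with `F = ∏ (X - j)`, `0 ≤ j ≤ m`. -/
noncomputable def hermitePoly (R : Type*) [CommRing R] (m n k : ℕ) : R[X] :=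
  Lagrange.nodal (Finset.range (m + 1)) (fun i : ℕ => (i : R)) ^ n *
    Lagrange.nodal ((Finset.range (m + 1)).erase k) (fun i : ℕ => (i : R))

theorem map_hermitePoly (m n k : ℕ) :
    (hermitePoly ℤ m n k).map (Int.castRingHom ℝ) = hermitePoly ℝ m n k := by
  simp [hermitePoly, Lagrange.nodal_eq, Polynomial.map_prod]

theorem eval_sumIDeriv_hermitePoly (m n k j : ℕ) :
    (sumIDeriv (hermitePoly ℝ m n k)).eval (j : ℝ) =
      (((sumIDeriv (hermitePoly ℤ m n k)).eval (j : ℤ) : ℤ) : ℝ) := by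
  rw [← map_hermitePoly, sumIDeriv_map, ← Int.cast_natCast (R := ℝ) j]
  exact Polynomial.eval_intCast_map (Int.castRingHom ℝ) _ _

theorem abs_eval_hermitePoly (m n k : ℕ) (x : ℝ) :
    |(hermitePoly ℝ m n k).eval x| =
      (∏ i ∈ Finset.range (m + 1), |x - (i : ℝ)|) ^ n *
        ∏ i ∈ (Finset.range (m + 1)).erase k, |x - (i : ℝ)| := by
  rw [hermitePoly, eval_mul, eval_pow, Lagrange.eval_nodal, Lagrange.eval_nodal, abs_mul, abs_pow,
    Finset.abs_prod, Finset.abs_prod]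

theorem abs_eval_sumIDeriv_hermitePoly_zero_le {m : ℕ} (hm : 1 ≤ m) (n : ℕ) {k : ℕ}
    (hk : k ∈ Finset.range (m + 1)) :
    |(sumIDeriv (hermitePoly ℝ m n k)).eval 0| ≤ 2 * ((m + 1) * n + m).factorial := by
  have h1 : ∀ x : ℝ, 0 ≤ x → |(hermitePoly ℝ m n k).eval x| ≤
      (X ^ ((m + 1) * n + m) + C ((m.factorial : ℝ) ^ (n + 1)) : ℝ[X]).eval x := by
    intro x hx
    rw [abs_eval_hermitePoly, eval_add, eval_pow, eval_X, eval_C]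
    have hp1 : 0 ≤ ∏ i ∈ Finset.range (m + 1), |x - (i : ℝ)| :=
      Finset.prod_nonneg fun i _ => abs_nonneg _
    have hp2 : 0 ≤ ∏ i ∈ (Finset.range (m + 1)).erase k, |x - (i : ℝ)| :=
      Finset.prod_nonneg fun i _ => abs_nonneg _
    rcases le_total x m with h | h
    · have e1 := prod_abs_sub_le_factorial hm (Finset.Subset.refl _) hx h
      have e2 := prod_abs_sub_le_factorial hm (Finset.erase_subset k (Finset.range (m + 1))) hx h
      have e3 := mul_le_mul (pow_le_pow_left₀ hp1 e1 n) e2 hp2 (by positivity)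
      rw [pow_succ]
      have : 0 ≤ x ^ ((m + 1) * n + m) := by positivity
      linarith
    · have e1 := prod_abs_sub_le_pow (Finset.Subset.refl (Finset.range (m + 1))) h
      have e2 := prod_abs_sub_le_pow (Finset.erase_subset k (Finset.range (m + 1))) h
      rw [Finset.card_range] at e1
      rw [Finset.card_erase_of_mem hk, Finset.card_range, Nat.add_sub_cancel] at e2
      have e3 := mul_le_mul (pow_le_pow_left₀ hp1 e1 n) e2 hp2 (by positivity)
      rw [← pow_mul, ← pow_add] at e3
      have : (0 : ℝ) ≤ (m.factorial : ℝ) ^ (n + 1) := by positivity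
      linarith
  have h2 := abs_eval_sumIDeriv_zero_le h1
  rw [map_add, eval_add, eval_zero_sumIDeriv_X_pow, sumIDeriv_C, eval_C] at h2
  have h3 : (m.factorial : ℝ) ^ (n + 1) ≤ ((m + 1) * n + m).factorial := by
    have h4 := (factorial_pow_le_factorial_mul m (n + 1)).trans
      (Nat.factorial_le (show m * (n + 1) ≤ (m + 1) * n + m by nlinarith))
    exact_mod_cast h4
  linarith

theorem abs_exp_mul_eval_sumIDeriv_hermitePoly_sub_le {m : ℕ} (hm : 1 ≤ m) (n k : ℕ) {M : ℝ}
    (hM : ∀ x : ℝ, 0 ≤ x → x ≤ m → ∏ i ∈ Finset.range (m + 1), |x - (i : ℝ)| ≤ M)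
    {j : ℕ} (hj : j ≤ m) :
    |Real.exp j * (sumIDeriv (hermitePoly ℝ m n k)).eval 0 -
      (sumIDeriv (hermitePoly ℝ m n k)).eval (j : ℝ)| ≤
      (Real.exp j - 1) * (M ^ n * m.factorial) := by
  rw [exp_mul_eval_sumIDeriv_sub]
  have hj0 : (0 : ℝ) ≤ j := Nat.cast_nonneg j
  have hjm : (j : ℝ) ≤ m := by exact_mod_cast hj
  have h1 : ∫ x in (0 : ℝ)..j, Real.exp (j - x) * (M ^ n * m.factorial) =
      (Real.exp j - 1) * (M ^ n * m.factorial) := by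
    rw [intervalIntegral.integral_mul_const]
    congr 1
    rw [intervalIntegral.integral_comp_sub_left (fun x => Real.exp x)]
    simp
  rw [← h1, ← Real.norm_eq_abs]
  refine intervalIntegral.norm_integral_le_of_norm_le hj0 ?_
    (Continuous.intervalIntegrable (by fun_prop) _ _)
  refine Filter.Eventually.of_forall fun x hx => ?_
  rw [Real.norm_eq_abs, abs_mul, abs_of_pos (Real.exp_pos _), abs_eval_hermitePoly]
  have hxm : x ≤ m := hx.2.trans hjm
  refine mul_le_mul_of_nonneg_left ?_ (Real.exp_pos _).le
  have hp1 : 0 ≤ ∏ i ∈ Finset.range (m + 1), |x - (i : ℝ)| :=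
    Finset.prod_nonneg fun i _ => abs_nonneg _
  exact mul_le_mul (pow_le_pow_left₀ hp1 (hM x hx.1.le hxm) n)
    (prod_abs_sub_le_factorial hm (Finset.erase_subset _ _) hx.1.le hxm)
    (Finset.prod_nonneg fun i _ => abs_nonneg _)
    (pow_nonneg (hp1.trans (hM x hx.1.le hxm)) n)

/-- The constant in the bound for the remainders of the simultaneous approximation. -/
noncomputable def remainderConst (m : ℕ) : ℝ :=
  m.factorial * ∑ j ∈ Finset.range (m + 1), (Real.exp j - 1)

/-- If the common factor `D` of the Hermite–Padé numbers outweighs the remainders, then the linear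
form is at least `D` over twice the leading number, because some integer combination of the
Hermite–Padé numbers is nonzero, hence at least `D` in absolute value. -/
theorem omegaE_le_of_hermiteDivisor {m : ℕ} (hm : 1 ≤ m) (n : ℕ) {H M r : ℝ} (hH : 1 ≤ H)
    (hM : ∀ x : ℝ, 0 ≤ x → x ≤ m → ∏ i ∈ Finset.range (m + 1), |x - (i : ℝ)| ≤ M)
    (hr : 0 < r)
    (hD : 2 * H * remainderConst m * M ^ n ≤ hermiteDivisor m n)
    (hA : 4 * ((m + 1) * n + m).factorial < hermiteDivisor m n * H ^ r) :
    omegaE m H ≤ (r : EReal) := by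
  refine sInf_le ⟨r, ⟨hr, fun lam hlam hlamH => ?_⟩, rfl⟩
  set D : ℝ := ((hermiteDivisor m n : ℕ) : ℝ) with hDdef
  have hD0 : 0 < D := by rw [hDdef]; exact_mod_cast hermiteDivisor_pos m n
  set s := Finset.range (m + 1) with hs
  -- the coefficients, extended by zero to all natural numbers
  set l : ℕ → ℤ := fun i => if h : i < m + 1 then lam ⟨i, h⟩ else 0 with hl
  have hlFin : ∀ i : Fin (m + 1), l i = lam i := fun i => by simp only [hl, dif_pos i.2]
  have hsum : ∑ i : Fin (m + 1), (lam i : ℝ) * Real.exp 1 ^ (i : ℕ) =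
      ∑ i ∈ s, (l i : ℝ) * Real.exp i := by
    rw [hs, ← Fin.sum_univ_eq_sum_range (fun i => (l i : ℝ) * Real.exp i) (m + 1)]
    refine Finset.sum_congr rfl fun i _ => ?_
    rw [hlFin, ← Real.exp_nat_mul, mul_one]
  rw [hsum]
  obtain ⟨k, hk, hkne⟩ : ∃ k ∈ s, ∑ i ∈ s, (l i : ℝ) *
      (sumIDeriv (hermitePoly ℝ m n k)).eval (i : ℝ) ≠ 0 := by
    by_contra hcon
    push Not at hcon
    have h1 := eq_zero_of_functional_eq_zero (s := s) (v := fun i : ℕ => (i : ℝ))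
      (fun i _ j _ h => Nat.cast_injective (R := ℝ) h) (fun i => (l i : ℝ)) n hcon
    refine hlam (funext fun i => ?_)
    have h2 := h1 i (Finset.mem_range.mpr i.2)
    rw [← hlFin]
    exact_mod_cast h2
  set A : ℕ → ℝ := fun j => (sumIDeriv (hermitePoly ℝ m n k)).eval (j : ℝ) with hAdef
  have hAint : ∀ j, A j = (((sumIDeriv (hermitePoly ℤ m n k)).eval (j : ℤ) : ℤ) : ℝ) :=
    fun j => eval_sumIDeriv_hermitePoly m n k j
  have hW : D ≤ |∑ i ∈ s, (l i : ℝ) * A i| := by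
    have h1 : ∑ i ∈ s, (l i : ℝ) * A i =
        ((∑ i ∈ s, l i * (sumIDeriv (hermitePoly ℤ m n k)).eval (i : ℤ) : ℤ) : ℝ) := by
      push_cast
      exact Finset.sum_congr rfl fun i _ => by rw [hAint]
    have h2 : (hermiteDivisor m n : ℤ) ∣
        ∑ i ∈ s, l i * (sumIDeriv (hermitePoly ℤ m n k)).eval (i : ℤ) :=
      Finset.dvd_sum fun i hi => Dvd.dvd.mul_left
        (hermiteDivisor_dvd n (Nat.lt_succ_iff.mp (Finset.mem_range.mp hi)) _) _
    have h3 : ∑ i ∈ s, l i * (sumIDeriv (hermitePoly ℤ m n k)).eval (i : ℤ) ≠ 0 := by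
      intro h
      rw [h, Int.cast_zero] at h1
      exact hkne h1
    have h4 := Int.le_of_dvd (abs_pos.mpr h3) ((dvd_abs _ _).mpr h2)
    rw [h1, hDdef, ← Int.cast_abs]
    exact_mod_cast h4
  have hA0 : |A 0| ≤ 2 * ((m + 1) * n + m).factorial := by
    have := abs_eval_sumIDeriv_hermitePoly_zero_le hm n hk
    simpa [hAdef] using this
  have hrem : |∑ i ∈ s, (l i : ℝ) * (Real.exp i * A 0 - A i)| ≤ D / 2 := by
    calc |∑ i ∈ s, (l i : ℝ) * (Real.exp i * A 0 - A i)|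
        ≤ ∑ i ∈ s, |(l i : ℝ) * (Real.exp i * A 0 - A i)| := Finset.abs_sum_le_sum_abs _ _
      _ ≤ ∑ i ∈ s, H * ((Real.exp i - 1) * (M ^ n * m.factorial)) := by
          refine Finset.sum_le_sum fun i hi => ?_
          have him := Nat.lt_succ_iff.mp (Finset.mem_range.mp hi)
          rw [abs_mul]
          rcases Nat.eq_zero_or_pos i with h0 | h0
          · rw [h0]; simp
          · have h1 := abs_exp_mul_eval_sumIDeriv_hermitePoly_sub_le hm n k hM him
            have h2 : |(l i : ℝ)| ≤ H := by
              have := hlamH ⟨i, Finset.mem_range.mp hi⟩ (by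
                intro h; rw [Fin.ext_iff] at h; simp at h; omega)
              rwa [← hlFin] at this
            refine mul_le_mul h2 ?_ (abs_nonneg _) (by linarith)
            simpa [hAdef] using h1
      _ = (2 * H * remainderConst m * M ^ n) / 2 := by
          rw [← Finset.mul_sum, ← Finset.sum_mul, remainderConst]; ring
      _ ≤ D / 2 := by linarith
  have hfin : D / 2 ≤ |∑ i ∈ s, (l i : ℝ) * Real.exp i| * |A 0| := by
    have h1 : (∑ i ∈ s, (l i : ℝ) * Real.exp i) * A 0 =
        ∑ i ∈ s, (l i : ℝ) * A i + ∑ i ∈ s, (l i : ℝ) * (Real.exp i * A 0 - A i) := by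
      rw [Finset.sum_mul, ← Finset.sum_add_distrib]
      exact Finset.sum_congr rfl fun i _ => by ring
    rw [← abs_mul, h1]
    have h2 := abs_sub_abs_le_abs_sub (∑ i ∈ s, (l i : ℝ) * A i)
      (-∑ i ∈ s, (l i : ℝ) * (Real.exp i * A 0 - A i))
    rw [sub_neg_eq_add, abs_neg] at h2
    linarith
  have hHr : 0 < H ^ r := Real.rpow_pos_of_pos (by linarith) r
  rw [div_lt_iff₀ hHr]
  set Λ := |∑ i ∈ s, (l i : ℝ) * Real.exp i|
  have hΛ : 0 ≤ Λ := abs_nonneg _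
  set N : ℝ := (((m + 1) * n + m).factorial : ℝ) with hN
  have hN0 : 0 < N := by rw [hN]; exact_mod_cast Nat.factorial_pos _
  have h1 : D ≤ Λ * (4 * N) := by nlinarith [mul_le_mul_of_nonneg_left hA0 hΛ]
  have h2 : 4 * N < Λ * H ^ r * (4 * N) := by
    calc 4 * N < D * H ^ r := hA
      _ ≤ Λ * (4 * N) * H ^ r := mul_le_mul_of_nonneg_right h1 hHr.le
      _ = _ := by ring
  by_contra hcon
  push Not at hcon
  nlinarith

end Reduction

/-! ### Size of the common factor -/

section CommonFactorSize

theorem mul_log_div_le_log_one_add {p d : ℝ} (hp : 1 < p) (hd : 0 ≤ d) (hdp : d ≤ p - 1) :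
    d * (Real.log p / (p - 1)) ≤ Real.log (1 + d) := by
  have h1 : 0 < p - 1 := by linarith
  have hconc := strictConcaveOn_log_Ioi.concaveOn.2 (show (1 : ℝ) ∈ Set.Ioi 0 by simp)
    (show p ∈ Set.Ioi 0 from by simp; linarith)
    (show 0 ≤ 1 - d / (p - 1) by rw [sub_nonneg, div_le_one h1]; exact hdp)
    (show 0 ≤ d / (p - 1) by positivity) (by ring)
  simp only [smul_eq_mul, Real.log_one, mul_zero, zero_add] at hconc
  have h2 : (1 - d / (p - 1)) * 1 + d / (p - 1) * p = 1 + d := by field_simp; ring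
  rw [h2] at hconc
  calc d * (Real.log p / (p - 1)) = d / (p - 1) * Real.log p := by ring
    _ ≤ _ := hconc

/-- Legendre's formula bounds the `p`-adic valuation of `n !` from below; the digit sum of `n` in
base `p` is at most `(p - 1) log (n + 1) / log p`. -/
theorem le_padicValNat_factorial_mul_log {p : ℕ} (hp : p.Prime) (n : ℕ) :
    n * (Real.log p / (p - 1)) - Real.log (n + 1) ≤ padicValNat p n.factorial * Real.log p := by
  have := Fact.mk hp
  have hp1 : (1 : ℝ) < p := by exact_mod_cast hp.one_lt
  induction n using Nat.strong_induction_on with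
  | _ n ih =>
    rcases Nat.eq_zero_or_pos n with rfl | hn
    · simp
    have hdiv : p * (n / p) + n % p = n := Nat.div_add_mod n p
    have hmod : n % p < p := Nat.mod_lt _ hp.pos
    have hval : padicValNat p n.factorial = padicValNat p (n / p).factorial + n / p := by
      conv_lhs => rw [← hdiv]
      rw [padicValNat_factorial_mul_add _ hmod, padicValNat_factorial_mul]
    have h1 := ih (n / p) (Nat.div_lt_self hn hp.one_lt)
    set q := n / p
    set d := n % p
    have hnr : (n : ℝ) = p * q + d := by exact_mod_cast hdiv.symm
    have hd : (d : ℝ) ≤ p - 1 := by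
      have : (d : ℝ) + 1 ≤ p := by exact_mod_cast hmod
      linarith
    have h2 := mul_log_div_le_log_one_add hp1 (Nat.cast_nonneg d) hd
    have hq : (0 : ℝ) ≤ q := Nat.cast_nonneg q
    have hd0 : (0 : ℝ) ≤ d := Nat.cast_nonneg d
    have h3 : Real.log (1 + d) + Real.log (q + 1) ≤ Real.log (n + 1) := by
      rw [← Real.log_mul (by positivity) (by positivity)]
      refine Real.log_le_log (by positivity) ?_
      rw [hnr]
      nlinarith
    rw [hval, hnr]
    push_cast
    have h4 : (p * q + d : ℝ) * (Real.log p / (p - 1)) =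
        q * Real.log p + q * (Real.log p / (p - 1)) + d * (Real.log p / (p - 1)) := by
      have : (p : ℝ) - 1 ≠ 0 := by linarith
      field_simp
      ring
    rw [h4]
    rw [hnr] at h3
    linarith

/-- The number `∑ N_p` of extra `p`-parts, `N_p = minFloorSum m p`. -/
noncomputable def floorSumTotal (m : ℕ) : ℝ :=
  ∑ p ∈ (Finset.range (m + 1)).filter Nat.Prime, (minFloorSum m p : ℝ)

/-- The sum `∑ N_p log p / (p - 1)`, which is `m` times the value of `kappa m` with its weights
`w_p` replaced by `1`. -/
noncomputable def logFactorTotal (m : ℕ) : ℝ :=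
  ∑ p ∈ (Finset.range (m + 1)).filter Nat.Prime,
    (minFloorSum m p : ℝ) * (Real.log p / ((p : ℝ) - 1))

theorem floorSumTotal_nonneg (m : ℕ) : 0 ≤ floorSumTotal m :=
  Finset.sum_nonneg fun _ _ => Nat.cast_nonneg _

theorem le_log_factorial {n : ℕ} (hn : n ≠ 0) :
    n * Real.log n - n + Real.log n / 2 + 0.9 ≤ Real.log n.factorial := by
  refine le_trans ?_ (Stirling.le_log_factorial_stirling hn)
  have h1 : (1.8 : ℝ) ≤ Real.log (2 * Real.pi) := by
    rw [Real.le_log_iff_exp_le (by positivity)]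
    have h2 : Real.exp 1.8 = Real.exp 1 ^ (9 / 5 : ℝ) := by
      rw [← Real.exp_mul]; norm_num
    have h3 : Real.exp 1.8 ^ 5 ≤ 6.28 ^ 5 := by
      rw [← Real.exp_nat_mul]
      have : ((5 : ℕ) : ℝ) * 1.8 = ((9 : ℕ) : ℝ) * 1 := by norm_num
      rw [this, Real.exp_nat_mul]
      calc Real.exp 1 ^ 9 ≤ 2.7182818286 ^ 9 :=
            pow_le_pow_left₀ (Real.exp_pos 1).le Real.exp_one_lt_d9.le 9
        _ ≤ _ := by norm_num
    have h4 := le_of_pow_le_pow_left₀ (by norm_num) (by norm_num) h3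
    linarith [Real.pi_gt_d2]
  linarith

theorem log_factorial_le {n : ℕ} (hn : n ≠ 0) :
    Real.log n.factorial ≤ n * Real.log n - n + Real.log n / 2 + 1 := by
  obtain ⟨k, rfl⟩ := Nat.exists_eq_succ_of_ne_zero hn
  have h1 : Real.log (Stirling.stirlingSeq (k + 1)) ≤ Real.log (Stirling.stirlingSeq (0 + 1)) :=
    Stirling.log_stirlingSeq'_antitone (Nat.zero_le k)
  rw [Stirling.log_stirlingSeq_formula, zero_add, Stirling.stirlingSeq_one,
    Real.log_div (Real.exp_pos 1).ne' (by positivity), Real.log_exp, Real.log_sqrt (by norm_num),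
    Real.log_mul (by norm_num) (by positivity), Real.log_div (by positivity)
    (Real.exp_pos 1).ne', Real.log_exp] at h1
  simp only [Nat.succ_eq_add_one]
  linarith

theorem le_log_hermiteDivisor (m : ℕ) {n : ℕ} (hn : n ≠ 0) :
    n * Real.log n - n + Real.log n / 2 + 0.9 + n * logFactorTotal m -
      floorSumTotal m * Real.log (n + 1) ≤ Real.log (hermiteDivisor m n) := by
  have h1 : ∀ p ∈ (Finset.range (m + 1)).filter Nat.Prime,
      ((p ^ (padicValNat p n.factorial * minFloorSum m p) : ℕ) : ℝ) ≠ 0 := fun p hp => by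
    exact_mod_cast (pow_pos (Finset.mem_filter.mp hp).2.pos _).ne'
  rw [hermiteDivisor, Nat.cast_mul, Real.log_mul (by exact_mod_cast n.factorial_ne_zero)
    (by rw [Nat.cast_prod]; exact Finset.prod_ne_zero_iff.mpr h1), Nat.cast_prod,
    Real.log_prod h1]
  have h2 : n * logFactorTotal m - floorSumTotal m * Real.log (n + 1) ≤
      ∑ p ∈ (Finset.range (m + 1)).filter Nat.Prime,
        Real.log ((p ^ (padicValNat p n.factorial * minFloorSum m p) : ℕ) : ℝ) := by
    rw [logFactorTotal, floorSumTotal, Finset.mul_sum, Finset.sum_mul, ← Finset.sum_sub_distrib]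
    refine Finset.sum_le_sum fun p hp => ?_
    have h3 := le_padicValNat_factorial_mul_log (Finset.mem_filter.mp hp).2 n
    have h4 : (0 : ℝ) ≤ minFloorSum m p := Nat.cast_nonneg _
    rw [Nat.cast_pow, Real.log_pow]
    push_cast
    nlinarith [mul_le_mul_of_nonneg_left h3 h4]
  linarith [le_log_factorial hn]

end CommonFactorSize

/-! ### Choice of the order of approximation -/

section OrderChoice

/-- The exponential rate `d` of the remainders: up to lower order terms, the remainders over the
common factor are of size `exp (-(n log n - d n))`. -/
noncomputable def remainderRate (m : ℕ) (M : ℝ) : ℝ := 1 + Real.log M - logFactorTotal m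

/-- The constant `B` such that the method gives the exponent `m + B / log n` for order `n`, up to
lower order terms. -/
noncomputable def exponentRate (m : ℕ) (M : ℝ) : ℝ :=
  (m + 1) * (remainderRate m M + Real.log (m + 1) - 1) - Real.log M

theorem log_add_one_mul_le {α β ε x₀ x : ℝ} (hα : 0 ≤ α) (hx₀ : 0 < x₀) (hx : x₀ ≤ x)
    (h : α * Real.log (x₀ + 1) + β ≤ ε * x₀) (hs : α ≤ ε * (x₀ + 1)) :
    α * Real.log (x + 1) + β ≤ ε * x := by
  have h1 : Real.log (x + 1) ≤ Real.log (x₀ + 1) + (x - x₀) / (x₀ + 1) := by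
    have h2 := Real.log_le_sub_one_of_pos (show 0 < (x + 1) / (x₀ + 1) from
      div_pos (by linarith) (by linarith))
    rw [Real.log_div (by linarith) (by linarith)] at h2
    have h3 : (x + 1) / (x₀ + 1) - 1 = (x - x₀) / (x₀ + 1) := by field_simp; ring
    linarith
  have h4 : α * ((x - x₀) / (x₀ + 1)) ≤ ε * (x - x₀) := by
    rw [mul_div_assoc', div_le_iff₀ (by linarith)]
    nlinarith [mul_le_mul_of_nonneg_right hs (sub_nonneg.mpr hx)]
  nlinarith [mul_le_mul_of_nonneg_left h1 hα]

theorem sub_le_mul_log_sub {x y : ℝ} (hx : 0 < x) (hy : 0 < y) :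
    x - y ≤ x * (Real.log x - Real.log y) := by
  have h := Real.log_le_sub_one_of_pos (div_pos hy hx)
  rw [Real.log_div hy.ne' hx.ne'] at h
  have h2 : x * (y / x) = y := by field_simp
  nlinarith [mul_le_mul_of_nonneg_left h hx.le]

theorem exp_div_le_exp_div {y₀ y : ℝ} (h1 : 1 ≤ y₀) (h : y₀ ≤ y) :
    Real.exp y₀ / y₀ ≤ Real.exp y / y := by
  rw [div_le_div_iff₀ (by linarith) (by linarith)]
  have h2 : Real.exp y = Real.exp y₀ * Real.exp (y - y₀) := by rw [← Real.exp_add]; ring_nf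
  have h3 := Real.add_one_le_exp (y - y₀)
  rw [h2]
  have h4 : y ≤ Real.exp (y - y₀) * y₀ := by nlinarith
  nlinarith [mul_le_mul_of_nonneg_left h4 (Real.exp_pos y₀).le]

theorem log_factorial_order_le (m : ℕ) {n : ℕ} (hn : n ≠ 0) :
    Real.log (((m + 1) * n + m).factorial : ℝ) ≤
      1 - (Real.log (m + 1) + Real.log (n + 1)) / 2 +
        (m + 1) * (n * Real.log n + n * (Real.log (m + 1) - 1) + Real.log (n + 1) +
          Real.log (m + 1)) := by
  have hn0 : (0 : ℝ) < n := by exact_mod_cast Nat.pos_of_ne_zero hn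
  have hm0 : (0 : ℝ) ≤ m := Nat.cast_nonneg m
  have hk : ((m + 1) * n + m) + 1 = (m + 1) * (n + 1) := by ring
  have h4 := log_factorial_le (n := ((m + 1) * n + m) + 1) (by omega)
  rw [Nat.factorial_succ, Nat.cast_mul, Real.log_mul (by positivity) (by positivity), hk] at h4
  push_cast at h4
  rw [Real.log_mul (by positivity) (by positivity)] at h4
  have h5 : ((n : ℝ) + 1) * Real.log (n + 1) ≤ n * Real.log n + Real.log (n + 1) + 1 := by
    have := sub_le_mul_log_sub hn0 (show (0 : ℝ) < n + 1 by linarith)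
    linarith
  have h6 := mul_le_mul_of_nonneg_left h5 (show (0 : ℝ) ≤ m + 1 by linarith)
  linarith

set_option maxHeartbeats 1000000 in
/-- The analytic core. The order is the least `n` for which the common factor outweighs the
remainders; such an `n` exists below `X = log H / (ρ log log H)`, and minimality of `n` bounds
`n log n` by `log H + d n` up to lower order terms. The lower order terms are absorbed by `ε₁` and
`ε₂`. -/
theorem omegaE_le_add_div {m : ℕ} (hm : 1 ≤ m) {M C H ρ ε₁ ε₂ X₀ y₀ : ℝ} (hH : 1 ≤ H)
    (hM0 : 0 < M)
    (hM : ∀ x : ℝ, 0 ≤ x → x ≤ m → ∏ i ∈ Finset.range (m + 1), |x - (i : ℝ)| ≤ M)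
    (hc : 0 < remainderConst m)
    (hd : 0 ≤ remainderRate m M) (hB : 0 ≤ exponentRate m M)
    (hT : 0 ≤ 1.05 + (Real.log (2 * remainderConst m) - 0.9) - remainderRate m M)
    (hρ : 0 < ρ) (hε₁ : 0 ≤ ε₁) (hX₀ : 11 ≤ X₀) (hy₀ : 1 ≤ y₀) (hyH : y₀ ≤ Real.log (Real.log H))
    (hXy : X₀ ≤ Real.exp y₀ / (ρ * y₀))
    (hC : exponentRate m M + ε₂ ≤ ρ * C)
    (h1 : (floorSumTotal m + 1 / 2) * Real.log (X₀ + 1) +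
      (1.05 + (Real.log (2 * remainderConst m) - 0.9) - remainderRate m M) ≤ ε₁ * X₀)
    (h1' : floorSumTotal m + 1 / 2 ≤ ε₁ * (X₀ + 1))
    (h2 : ((m + 1) * (floorSumTotal m + 1 / 2) + (m + 1 / 2)) * Real.log (X₀ + 1) +
      ((m + 1) * (1.05 + (Real.log (2 * remainderConst m) - 0.9) - remainderRate m M +
        Real.log (m + 1)) + Real.log 4 + 1.01 - Real.log (m + 1) / 2 -
        Real.log (2 * remainderConst m)) ≤ ε₂ * X₀)
    (h2' : (m + 1) * (floorSumTotal m + 1 / 2) + (m + 1 / 2) ≤ ε₂ * (X₀ + 1))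
    (h3 : 0 ≤ (1 - ρ) * y₀ - Real.log (ρ * y₀) - remainderRate m M - ε₁)
    (h3' : 1 ≤ (1 - ρ) * y₀) (hC0 : 0 ≤ C) :
    omegaE m H ≤ ((m + C / Real.log (Real.log H) : ℝ) : EReal) := by
  set a := floorSumTotal m with ha
  set c := Real.log (2 * remainderConst m) with hcdef
  set d := remainderRate m M with hddef
  set y := Real.log (Real.log H) with hy
  set E := Real.log H with hE
  have ha0 : 0 ≤ a := floorSumTotal_nonneg m
  have hy1 : 1 ≤ y := hy₀.trans hyH
  have hE0 : 0 < E := by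
    rcases lt_or_eq_of_le (Real.log_nonneg hH) with h | h
    · exact h
    · rw [hy, hE, ← h] at hy1; norm_num at hy1
  have hEy : E = Real.exp y := by rw [hy, Real.exp_log hE0]
  set X := E / (ρ * y) with hX
  have hXX : X₀ ≤ X := by
    refine hXy.trans ?_
    rw [hX, hEy, mul_comm ρ y₀, mul_comm ρ y, ← div_div, ← div_div]
    exact div_le_div_of_nonneg_right (exp_div_le_exp_div hy₀ hyH) hρ.le
  have hX11 : 11 ≤ X := hX₀.trans hXX
  have hρy : 0 < ρ * y := by positivity
  have hXE : X * (ρ * y) = E := by rw [hX]; field_simp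
  have hlogX : Real.log X = y - Real.log (ρ * y) := by
    rw [hX, Real.log_div hE0.ne' hρy.ne']
  have hm0 : (0 : ℝ) ≤ m := Nat.cast_nonneg m
  have hX0pos : 0 < X₀ := by linarith only [hX₀]
  have hX1 : True → (a + 1 / 2) * Real.log (X + 1) + (1.05 + (c - 0.9) - d) ≤ ε₁ * X :=
    fun _ => log_add_one_mul_le (by positivity) hX0pos hXX h1 h1'
  have hX2 := fun _ : True => log_add_one_mul_le (by positivity) hX0pos hXX h2 h2'
  clear h1 h1' h2 h2'
  have hkey : d + ε₁ + ρ * y ≤ Real.log X := by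
    have h4 := Real.log_le_sub_one_of_pos (show 0 < y / y₀ by positivity)
    rw [Real.log_div (by linarith) (by linarith)] at h4
    have h5 : y / y₀ - 1 ≤ (1 - ρ) * (y - y₀) := by
      have : y / y₀ - 1 = (y - y₀) / y₀ := by field_simp
      rw [this, div_le_iff₀ (by linarith)]
      linarith only [mul_le_mul_of_nonneg_right h3' (sub_nonneg.mpr hyH)]
    rw [hlogX, Real.log_mul hρ.ne' (by linarith)]
    rw [Real.log_mul hρ.ne' (by linarith)] at h3
    linarith
  clear h3
  have hlogX1 : Real.log X ≤ Real.log (X + 1) := Real.log_le_log (by linarith) (by linarith)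
  have hlogX0 : 0 ≤ Real.log X := Real.log_nonneg (by linarith)
  -- `G n ≥ E` says that the common factor of order `n` outweighs the remainders
  set G : ℕ → ℝ := fun n => Real.log (hermiteDivisor m n) - n * Real.log M - c with hG
  have hGlow : ∀ n : ℕ, n ≠ 0 → n * Real.log n - d * n + Real.log n / 2 - a * Real.log (n + 1) -
      (c - 0.9) ≤ G n := by
    intro n hn
    have := le_log_hermiteDivisor m hn
    simp only [hG, hddef, remainderRate]
    linarith
  have hex : ∃ n : ℕ, n ≠ 0 ∧ E ≤ G n ∧ (n : ℝ) ≤ X := by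
    refine ⟨⌊X⌋₊, ?_, ?_, Nat.floor_le (by linarith)⟩
    · exact (Nat.floor_pos.mpr (by linarith)).ne'
    · have hn1 : (⌊X⌋₊ : ℝ) ≤ X := Nat.floor_le (by linarith)
      have hn2 : X < ⌊X⌋₊ + 1 := Nat.lt_floor_add_one X
      refine le_trans ?_ (hGlow _ (Nat.floor_pos.mpr (by linarith)).ne')
      set n : ℝ := (⌊X⌋₊ : ℝ)
      have hn10 : 10 ≤ n := by linarith
      have e1 := sub_le_mul_log_sub (show 0 < n by linarith) (show 0 < X by linarith)
      have e2 : Real.log X - Real.log n ≤ 1 / 10 := by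
        have := sub_le_mul_log_sub (show 0 < X by linarith) (show 0 < n by linarith)
        have e3 := Real.log_le_sub_one_of_pos (show 0 < X / n by positivity)
        rw [Real.log_div (by linarith) (by linarith)] at e3
        have e4 : X / n - 1 ≤ 1 / 10 := by
          rw [sub_le_iff_le_add, div_le_iff₀ (by linarith)]
          linarith
        linarith
      have e3 : Real.log (n + 1) ≤ Real.log (X + 1) :=
        Real.log_le_log (by linarith) (by linarith)
      have e4 : a * Real.log (n + 1) ≤ a * Real.log (X + 1) := mul_le_mul_of_nonneg_left e3 ha0
      have e5 : (X - 1) * (Real.log X + 1 - d) ≤ n * (Real.log X + 1 - d) :=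
        mul_le_mul_of_nonneg_right (by linarith) (by linarith)
      have e6 : X * (d + ε₁ + ρ * y) ≤ X * Real.log X :=
        mul_le_mul_of_nonneg_left hkey (by linarith)
      linarith only [e1, e2, e4, e5, e6, hX1 trivial, hXE, hlogX1]
  classical
  have hex' : ∃ n : ℕ, n ≠ 0 ∧ E ≤ G n := ⟨_, hex.choose_spec.1, hex.choose_spec.2.1⟩
  set n := Nat.find hex' with hn
  obtain ⟨hn0, hnG⟩ := Nat.find_spec hex'
  rw [← hn] at hn0 hnG
  have hnX : (n : ℝ) ≤ X := by
    obtain ⟨n', h4, h5, h6⟩ := hex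
    have : n ≤ n' := Nat.find_min' hex' ⟨h4, h5⟩
    exact le_trans (by exact_mod_cast this) h6
  have hn1 : (1 : ℝ) ≤ n := by exact_mod_cast Nat.one_le_iff_ne_zero.mpr hn0
  have hnlog : n * Real.log n ≤ E + d * n + (a + 1 / 2) * Real.log X +
      (1.05 + (c - 0.9) - d) := by
    rcases Nat.lt_or_ge n 2 with h | h
    · have : n = 1 := by omega
      rw [this]
      simp only [Nat.cast_one, Real.log_one, mul_zero, mul_one]
      have : 0 ≤ (a + 1 / 2) * Real.log X := by positivity
      linarith
    · obtain ⟨k, hk⟩ : ∃ k, n = k + 1 := ⟨n - 1, by omega⟩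
      have hk0 : k ≠ 0 := by omega
      have hlt : G k < E := by
        have := Nat.find_min hex' (show k < Nat.find hex' by omega)
        by_contra hcon
        exact this ⟨hk0, not_lt.mp hcon⟩
      have h4 := (hGlow k hk0).trans_lt hlt
      have hkn : (n : ℝ) = k + 1 := by exact_mod_cast hk
      have hk1 : (1 : ℝ) ≤ k := by exact_mod_cast Nat.one_le_iff_ne_zero.mpr hk0
      rw [← hkn] at h4
      have h5 : k * (Real.log n - Real.log k) ≤ 1 := by
        have := sub_le_mul_log_sub (show (0 : ℝ) < k by linarith) (show (0 : ℝ) < n by linarith)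
        linarith only [this, hkn]
      have h6 : Real.log n ≤ Real.log X := Real.log_le_log (by linarith) hnX
      -- `n ^ 2 / (n - 1)` increases for `n ≥ 2`
      have h7 : 2 * Real.log n - Real.log k ≤ 2 * Real.log X - Real.log (X - 1) := by
        have e1 : Real.log ((n : ℝ) ^ 2 * (X - 1)) ≤ Real.log (X ^ 2 * k) := by
          refine Real.log_le_log (by
            have : 0 < X - 1 := by linarith
            positivity) ?_
          have : (k : ℝ) = n - 1 := by linarith
          rw [this]
          have e2 : (2 : ℝ) ≤ n := by exact_mod_cast h
          have e3 : 0 ≤ ((n : ℝ) - 2) * (X - 1) :=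
            mul_nonneg (by linarith only [e2]) (by linarith only [hX11])
          linarith only [mul_nonneg (sub_nonneg.mpr hnX)
            (show 0 ≤ ((n : ℝ) - 1) * (X - 1) - 1 by linarith only [e3, hX11])]
        rw [Real.log_mul (by positivity) (by linarith), Real.log_mul (by positivity)
          (by positivity), Real.log_pow, Real.log_pow] at e1
        push_cast at e1
        linarith
      have h8 : Real.log X - Real.log (X - 1) ≤ 1 / 10 := by
        have e3 := Real.log_le_sub_one_of_pos (show 0 < X / (X - 1) from
          div_pos (by linarith) (by linarith))
        rw [Real.log_div (by linarith) (by linarith)] at e3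
        have e4 : X / (X - 1) - 1 ≤ 1 / 10 := by
          rw [sub_le_iff_le_add, div_le_iff₀ (by linarith)]
          linarith
        linarith
      have h9 : a * Real.log n ≤ a * Real.log X := mul_le_mul_of_nonneg_left h6 ha0
      have h10 : n * Real.log n = k * Real.log n + Real.log n := by rw [hkn]; ring
      have h11 : d * n = d * k + d := by rw [hkn]; ring
      linarith only [h4, h5, h7, h8, h9, h10, h11]
  have hfact := log_factorial_order_le m hn0
  have hD0 : (0 : ℝ) < hermiteDivisor m n := by exact_mod_cast hermiteDivisor_pos m n
  refine omegaE_le_of_hermiteDivisor hm n hH hM (by positivity) ?_ ?_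
  · have e1 : Real.log (2 * H * remainderConst m * M ^ n) ≤ Real.log (hermiteDivisor m n) := by
      rw [show 2 * H * remainderConst m * M ^ n = (2 * remainderConst m) * H * M ^ n by ring,
        Real.log_mul (by positivity) (by positivity), Real.log_mul (by positivity) (by positivity),
        Real.log_pow]
      simp only [hG] at hnG
      linarith
    exact (Real.log_le_log_iff (by positivity) hD0).mp e1
  · have hH0 : 0 < H := by linarith
    rw [← Real.log_lt_log_iff (by positivity) (by positivity),
      Real.log_mul (by norm_num) (by positivity), Real.log_mul hD0.ne' (by positivity),
      Real.log_rpow hH0, ← hE]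
    have e1 : (exponentRate m M + ε₂) * X ≤ C / y * E := by
      have : C / y * E = ρ * C * X := by rw [hX]; field_simp
      rw [this]
      exact mul_le_mul_of_nonneg_right hC (by linarith)
    have e2 : exponentRate m M * n ≤ exponentRate m M * X := mul_le_mul_of_nonneg_left hnX hB
    have e3 : Real.log (n + 1) ≤ Real.log (X + 1) := Real.log_le_log (by linarith) (by linarith)
    have e4 := mul_le_mul_of_nonneg_left hnlog (show (0 : ℝ) ≤ m + 1 by linarith)
    have e5 : (m + 1 / 2) * Real.log (n + 1) ≤ (m + 1 / 2) * Real.log (X + 1) :=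
      mul_le_mul_of_nonneg_left e3 (by linarith)
    have e6 : (m + 1) * ((a + 1 / 2) * Real.log X) ≤ (m + 1) * ((a + 1 / 2) * Real.log (X + 1)) :=
      mul_le_mul_of_nonneg_left (mul_le_mul_of_nonneg_left hlogX1 (by linarith)) (by linarith)
    have e7 : exponentRate m M * n = (m + 1) * (d * n) +
        (m + 1) * (n * (Real.log (m + 1) - 1)) - n * Real.log M := by
      rw [exponentRate, ← hddef]; ring
    simp only [hG] at hnG
    have e8 : (m + C / y) * E = m * E + C / y * E := by ring
    rw [e8]
    linarith only [e1, e2, e4, e5, e6, e7, hnG, hfact, hX2 trivial]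

end OrderChoice

/-! ### The maximum of the product of the distances to the nodes -/

section NodalMaximum

/-- For `x = a + t` with `0 ≤ t ≤ 1`, the product of the distances from `x` to `0, …, a + b + 1`. -/
noncomputable def distProd (t : ℝ) (a b : ℕ) : ℝ :=
  (∏ i ∈ Finset.range (a + 1), ((i : ℝ) + t)) * ∏ j ∈ Finset.range (b + 1), ((j : ℝ) + 1 - t)

theorem prod_abs_sub_eq_distProd {a b : ℕ} {x : ℝ} (h0 : (a : ℝ) ≤ x) (h1 : x ≤ a + 1) :
    ∏ i ∈ Finset.range (a + b + 1 + 1), |x - (i : ℝ)| = distProd (x - a) a b := by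
  rw [distProd, show a + b + 1 + 1 = (a + 1) + (b + 1) by ring, Finset.prod_range_add,
    ← Finset.prod_range_reflect (fun i : ℕ => |x - (i : ℝ)|) (a + 1)]
  congr 1
  · refine Finset.prod_congr rfl fun i hi => ?_
    have hi' := Finset.mem_range.mp hi
    have h2 : ((a + 1 - 1 - i : ℕ) : ℝ) = a - i := by
      rw [Nat.add_sub_cancel, Nat.cast_sub (by omega)]
    have h3 : (0 : ℝ) ≤ i := Nat.cast_nonneg i
    rw [h2, abs_of_nonneg (by linarith)]
    ring
  · refine Finset.prod_congr rfl fun j _ => ?_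
    have h3 : (0 : ℝ) ≤ j := Nat.cast_nonneg j
    push_cast
    rw [abs_of_nonpos (by linarith)]
    ring

theorem distProd_symm (t : ℝ) (a b : ℕ) : distProd t a b = distProd (1 - t) b a := by
  rw [distProd, distProd, mul_comm]
  congr 1 <;> exact Finset.prod_congr rfl fun i _ => by ring

theorem distProd_succ_le {t : ℝ} (h0 : 0 ≤ t) (h1 : t ≤ 1) {a b : ℕ} (hab : a + 1 ≤ b) :
    distProd t (a + 1) b ≤ distProd t a (b + 1) := by
  have hQ : 0 ≤ distProd t a b := by
    refine mul_nonneg (Finset.prod_nonneg fun i _ => ?_) (Finset.prod_nonneg fun j _ => ?_)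
    · positivity
    · have : (0 : ℝ) ≤ j := Nat.cast_nonneg j
      linarith
  have e1 : distProd t (a + 1) b = distProd t a b * ((a + 1 : ℕ) + t) := by
    rw [distProd, Finset.prod_range_succ, distProd]; ring
  have e2 : distProd t a (b + 1) = distProd t a b * ((b + 1 : ℕ) + 1 - t) := by
    rw [distProd, Finset.prod_range_succ _ (b + 1), distProd]; ring
  rw [e1, e2]
  refine mul_le_mul_of_nonneg_left ?_ hQ
  have : (a : ℝ) + 1 ≤ b := by exact_mod_cast hab
  push_cast
  linarith

theorem distProd_le_distProd_zero {t : ℝ} (h0 : 0 ≤ t) (h1 : t ≤ 1) {a b : ℕ} (hab : a ≤ b) :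
    distProd t a b ≤ distProd t 0 (a + b) := by
  induction a generalizing b with
  | zero => rw [zero_add]
  | succ a ih =>
    refine (distProd_succ_le h0 h1 hab).trans ?_
    rw [show a + 1 + b = a + (b + 1) by ring]
    exact ih (by omega)

theorem distProd_zero_le {t : ℝ} (h0 : 0 ≤ t) (h1 : t ≤ 1) (n : ℕ) {v : ℝ}
    (hv : Real.exp (v - 1) ≤ ∑ i ∈ Finset.range (n + 1), 1 / ((i : ℝ) + 1)) :
    distProd t 0 n ≤ (n + 1).factorial * Real.exp (-v) := by
  set h := ∑ i ∈ Finset.range (n + 1), 1 / ((i : ℝ) + 1)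
  have e1 : ∏ j ∈ Finset.range (n + 1), ((j : ℝ) + 1 - t) ≤
      (n + 1).factorial * Real.exp (-(t * h)) := by
    have e2 : ((n + 1).factorial : ℝ) = ∏ j ∈ Finset.range (n + 1), ((j : ℝ) + 1) := by
      rw [← Finset.prod_range_add_one_eq_factorial]; push_cast; rfl
    rw [e2, Finset.mul_sum, ← Finset.sum_neg_distrib, Real.exp_sum, ← Finset.prod_mul_distrib]
    refine Finset.prod_le_prod (fun j _ => ?_) fun j _ => ?_
    · have : (0 : ℝ) ≤ j := Nat.cast_nonneg j
      linarith
    · have hj : (0 : ℝ) < j + 1 := by positivity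
      have e3 := Real.add_one_le_exp (-(t * (1 / ((j : ℝ) + 1))))
      have e4 := mul_le_mul_of_nonneg_left e3 hj.le
      refine le_trans (le_of_eq ?_) e4
      field_simp
      ring
  have e5 : distProd t 0 n = t * ∏ j ∈ Finset.range (n + 1), ((j : ℝ) + 1 - t) := by
    simp [distProd]
  rw [e5]
  have e6 : t * Real.exp (-(t * h)) ≤ Real.exp (-v) := by
    have e7 := Real.add_one_le_exp (t * h - 1)
    have e8 : t * Real.exp (v - 1) ≤ Real.exp (t * h - 1) := by
      have := mul_le_mul_of_nonneg_left hv h0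
      linarith
    have e9 : t * Real.exp (-(t * h)) =
        (t * Real.exp (v - 1)) * Real.exp (-(t * h) - (v - 1)) := by
      rw [mul_assoc, ← Real.exp_add]; ring_nf
    calc t * Real.exp (-(t * h)) = _ := e9
      _ ≤ Real.exp (t * h - 1) * Real.exp (-(t * h) - (v - 1)) :=
          mul_le_mul_of_nonneg_right e8 (Real.exp_pos _).le
      _ = Real.exp (-v) := by rw [← Real.exp_add]; ring_nf
  calc t * ∏ j ∈ Finset.range (n + 1), ((j : ℝ) + 1 - t)
      ≤ t * ((n + 1).factorial * Real.exp (-(t * h))) := mul_le_mul_of_nonneg_left e1 h0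
    _ = (n + 1).factorial * (t * Real.exp (-(t * h))) := by ring
    _ ≤ _ := mul_le_mul_of_nonneg_left e6 (by positivity)

/-- The maximum of `|x (x - 1) ⋯ (x - m)|` on `[0, m]` is attained next to the endpoints, where it
is about `m ! / (e H_m)` with `H_m` the harmonic number. -/
theorem prod_abs_sub_le_factorial_mul_exp {m : ℕ} (hm : 1 ≤ m) {v : ℝ}
    (hv : Real.exp (v - 1) ≤ ∑ i ∈ Finset.range m, 1 / ((i : ℝ) + 1)) {x : ℝ} (h0 : 0 ≤ x)
    (hx : x ≤ m) : ∏ i ∈ Finset.range (m + 1), |x - (i : ℝ)| ≤ m.factorial * Real.exp (-v) := by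
  obtain ⟨a, b, rfl, ha, ha'⟩ := exists_mem_unit_interval hm h0 hx
  rw [prod_abs_sub_eq_distProd ha ha']
  rcases le_total a b with h | h
  · exact (distProd_le_distProd_zero (by linarith) (by linarith) h).trans
      (distProd_zero_le (by linarith) (by linarith) _ hv)
  · rw [distProd_symm]
    refine (distProd_le_distProd_zero (by linarith) (by linarith) h).trans ?_
    rw [add_comm b a]
    exact distProd_zero_le (by linarith) (by linarith) _ hv

end NodalMaximum

/-! ### Rational bounds for logarithms -/

section LogBounds

/-- `10 ^ 24 log ((n + 1) / n)`, up to an error of at most `27`, computed in integers from the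
expansion of `artanh (1 / (2 n + 1))`. -/
def logStepFix (n : ℕ) : ℕ :=
  Nat.rec 0 (fun j s => s + 2 * 10 ^ 24 / ((2 * j + 1) * (2 * n + 1) ^ (2 * j + 1))) 26

/-- `10 ^ 24 log n`, up to an error of at most `27 n`. The plain recursor makes the value easy to
compute in the kernel. -/
def logFix (n : ℕ) : ℕ := Nat.rec 0 (fun j s => s + logStepFix (j + 1)) (n - 1)

/-- A rational lower bound for `log n`. -/
def logLo (n : ℕ) : ℚ := logFix n / 10 ^ 24

/-- A rational upper bound for `log n`. -/
def logHi (n : ℕ) : ℚ := (logFix n + 27 * n) / 10 ^ 24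

theorem logStepFix_aux (n k : ℕ) :
    ((Nat.rec 0 (fun j s => s + 2 * 10 ^ 24 / ((2 * j + 1) * (2 * n + 1) ^ (2 * j + 1))) k : ℕ) : ℝ)
      ≤ 2 * 10 ^ 24 * ∑ i ∈ Finset.range k, (1 / (2 * n + 1 : ℝ)) ^ (2 * i + 1) / (2 * i + 1) ∧
    2 * 10 ^ 24 * ∑ i ∈ Finset.range k, (1 / (2 * n + 1 : ℝ)) ^ (2 * i + 1) / (2 * i + 1) ≤
    ((Nat.rec 0 (fun j s => s + 2 * 10 ^ 24 / ((2 * j + 1) * (2 * n + 1) ^ (2 * j + 1))) k : ℕ) : ℝ)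
      + k := by
  induction k with
  | zero => simp
  | succ k ih =>
    set D : ℕ := (2 * k + 1) * (2 * n + 1) ^ (2 * k + 1) with hD
    have hD0 : 0 < D := by positivity
    have hDr : (0 : ℝ) < D := by exact_mod_cast hD0
    have hterm : 2 * 10 ^ 24 * ((1 / (2 * n + 1 : ℝ)) ^ (2 * k + 1) / (2 * k + 1)) =
        2 * 10 ^ 24 / (D : ℝ) := by
      rw [hD, one_div, inv_pow]; push_cast
      field_simp
    have h1 : ((2 * 10 ^ 24 / D : ℕ) : ℝ) ≤ 2 * 10 ^ 24 / (D : ℝ) := by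
      have := @Nat.cast_div_le ℝ _ _ _ (2 * 10 ^ 24) D
      refine this.trans (le_of_eq ?_)
      push_cast
      ring
    have h2 : 2 * 10 ^ 24 / (D : ℝ) ≤ ((2 * 10 ^ 24 / D : ℕ) : ℝ) + 1 := by
      rw [div_le_iff₀ hDr]
      have := Nat.lt_div_mul_add (a := 2 * 10 ^ 24) hD0
      have h3 : 2 * 10 ^ 24 ≤ (2 * 10 ^ 24 / D + 1) * D := by rw [add_mul, one_mul]; exact this.le
      exact_mod_cast h3
    rw [Finset.sum_range_succ, mul_add, hterm]
    push_cast
    push_cast at ih h1 h2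
    constructor <;> linarith [ih.1, ih.2]

theorem logStepFix_bounds {n : ℕ} (hn : 1 ≤ n) :
    (logStepFix n : ℝ) ≤ 10 ^ 24 * (Real.log (n + 1) - Real.log n) ∧
      10 ^ 24 * (Real.log (n + 1) - Real.log n) ≤ logStepFix n + 27 := by
  have hn0 : (1 : ℝ) ≤ n := by exact_mod_cast hn
  set x : ℝ := 1 / (2 * n + 1) with hx
  have hx0 : 0 ≤ x := by positivity
  have hx3 : x ≤ 1 / 3 := by
    rw [hx]
    exact one_div_le_one_div_of_le (by norm_num) (by linarith)
  have hx1 : x < 1 := by linarith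
  have hlog : Real.log ((1 + x) / (1 - x)) = Real.log (n + 1) - Real.log n := by
    rw [← Real.log_div (by linarith) (by linarith)]
    congr 1
    rw [hx]
    field_simp
    ring
  have h1 := Real.sum_range_le_log_div hx0 hx1 26
  have h2 := Real.log_div_le_sum_range_add hx0 hx1 26
  rw [hlog] at h1 h2
  obtain ⟨h3, h4⟩ := logStepFix_aux n 26
  rw [← hx] at h3 h4
  have h5 : 2 * 10 ^ 24 * (x ^ (2 * 26 + 1) / (1 - x ^ 2)) ≤ 1 := by
    have e1 : x ^ (2 * 26 + 1) ≤ (1 / 3) ^ (2 * 26 + 1) := pow_le_pow_left₀ hx0 hx3 _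
    have e2 : x ^ 2 ≤ (1 / 3) ^ 2 := pow_le_pow_left₀ hx0 hx3 _
    have e3 : x ^ (2 * 26 + 1) / (1 - x ^ 2) ≤ (1 / 3) ^ (2 * 26 + 1) / (1 - (1 / 3) ^ 2) :=
      div_le_div₀ (by positivity) e1 (by norm_num) (by linarith)
    refine (mul_le_mul_of_nonneg_left e3 (by positivity)).trans ?_
    norm_num
  change (logStepFix n : ℝ) ≤ _ at h3
  change _ ≤ (logStepFix n : ℝ) + _ at h4
  push_cast at h4
  constructor <;> linarith

theorem logFix_succ {n : ℕ} (hn : 1 ≤ n) : logFix (n + 1) = logFix n + logStepFix n := by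
  obtain ⟨k, rfl⟩ : ∃ k, n = k + 1 := ⟨n - 1, by omega⟩
  rfl

theorem logFix_bounds {n : ℕ} (hn : 1 ≤ n) :
    (logFix n : ℝ) ≤ 10 ^ 24 * Real.log n ∧ 10 ^ 24 * Real.log n ≤ logFix n + 27 * n := by
  induction n, hn using Nat.le_induction with
  | base => simp [logFix]
  | succ n hn ih =>
    obtain ⟨h1, h2⟩ := logStepFix_bounds hn
    rw [logFix_succ hn]
    push_cast
    constructor <;> linarith [ih.1, ih.2]

theorem logLo_le {n : ℕ} (hn : 1 ≤ n) : (logLo n : ℝ) ≤ Real.log n := by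
  rw [logLo]
  push_cast
  rw [div_le_iff₀ (by positivity)]
  linarith [(logFix_bounds hn).1]

theorem le_logHi {n : ℕ} (hn : 1 ≤ n) : Real.log n ≤ (logHi n : ℝ) := by
  rw [logHi]
  push_cast
  rw [le_div_iff₀ (by positivity)]
  linarith [(logFix_bounds hn).2]

theorem le_log_of_le_logLo {n : ℕ} (hn : 1 ≤ n) {q : ℚ} (h : q ≤ logLo n) :
    (q : ℝ) ≤ Real.log n := (Rat.cast_le.mpr h).trans (logLo_le hn)

theorem log_le_of_logHi_le {n : ℕ} (hn : 1 ≤ n) {q : ℚ} (h : logHi n ≤ q) :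
    Real.log n ≤ (q : ℝ) := (le_logHi hn).trans (Rat.cast_le.mpr h)

end LogBounds

/-! ### Lower order terms for five or more points -/

section LowerOrderTerms

theorem minFloorSum_le_div {p : ℕ} (hp : 0 < p) (m : ℕ) : (minFloorSum m p : ℝ) ≤ m / p := by
  rw [minFloorSum_eq hp, le_div_iff₀ (by exact_mod_cast hp)]
  have h1 : (m + 1) / p * p ≤ m + 1 := Nat.div_mul_le_self _ _
  have h2 : ((m + 1) / p - 1) * p ≤ m := by
    rw [Nat.sub_mul, one_mul]
    omega
  exact_mod_cast h2

theorem floorSumTotal_le (m : ℕ) : floorSumTotal m ≤ (m : ℝ) ^ 2 / 2 := by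
  have h1 : floorSumTotal m ≤ ((Finset.range (m + 1)).filter Nat.Prime).card • ((m : ℝ) / 2) := by
    refine Finset.sum_le_card_nsmul _ _ _ fun p hp => ?_
    have hp' := (Finset.mem_filter.mp hp).2
    refine (minFloorSum_le_div hp'.pos m).trans ?_
    have : (2 : ℝ) ≤ p := by exact_mod_cast hp'.two_le
    exact div_le_div_of_nonneg_left (Nat.cast_nonneg m) (by norm_num) this
  have h2 : ((Finset.range (m + 1)).filter Nat.Prime).card ≤ m := by
    have : (Finset.range (m + 1)).filter Nat.Prime ⊆ Finset.Icc 1 m := fun p hp => by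
      have h3 := Finset.mem_filter.mp hp
      exact Finset.mem_Icc.mpr ⟨h3.2.pos, Nat.lt_succ_iff.mp (Finset.mem_range.mp h3.1)⟩
    simpa using Finset.card_le_card this
  refine h1.trans ?_
  rw [nsmul_eq_mul]
  have h3 : (((Finset.range (m + 1)).filter Nat.Prime).card : ℝ) ≤ m := by exact_mod_cast h2
  have h4 : (0 : ℝ) ≤ m := Nat.cast_nonneg m
  nlinarith

theorem logFactorTotal_nonneg (m : ℕ) : 0 ≤ logFactorTotal m := by
  refine Finset.sum_nonneg fun p hp => ?_
  have hp' : (1 : ℝ) < p := by exact_mod_cast (Finset.mem_filter.mp hp).2.one_lt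
  have : 0 < (p : ℝ) - 1 := by linarith
  have := Real.log_pos hp'
  positivity

theorem factorial_le_two_mul_remainderConst {m : ℕ} (hm : 1 ≤ m) :
    (m.factorial : ℝ) ≤ 2 * remainderConst m := by
  have h1 : (1 : ℝ) ≤ ∑ j ∈ Finset.range (m + 1), (Real.exp j - 1) := by
    have h2 : Real.exp ((1 : ℕ) : ℝ) - 1 ≤ ∑ j ∈ Finset.range (m + 1), (Real.exp j - 1) := by
      refine Finset.single_le_sum (f := fun j : ℕ => Real.exp (j : ℝ) - 1) (fun j _ => ?_)
        (Finset.mem_range.mpr (by omega))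
      rw [sub_nonneg]
      exact Real.one_le_exp (Nat.cast_nonneg j)
    have h3 := Real.add_one_le_exp (1 : ℝ)
    rw [Nat.cast_one] at h2
    linarith
  have h0 : (0 : ℝ) ≤ m.factorial := Nat.cast_nonneg _
  rw [remainderConst]
  nlinarith [mul_le_mul_of_nonneg_left h1 h0]

theorem remainderConst_pos {m : ℕ} (hm : 1 ≤ m) : 0 < remainderConst m := by
  have h := factorial_le_two_mul_remainderConst hm
  have : (0 : ℝ) < m.factorial := by exact_mod_cast m.factorial_pos
  linarith

theorem log_two_mul_remainderConst_le {m : ℕ} (hm : 1 ≤ m) :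
    Real.log (2 * remainderConst m) ≤ 1 + m * Real.log m + Real.log m + m := by
  have hm0 : (0 : ℝ) < m := by exact_mod_cast hm
  have h1 : ∑ j ∈ Finset.range (m + 1), (Real.exp j - 1) ≤ m * Real.exp m := by
    rw [Finset.sum_range_succ']
    simp only [Nat.cast_zero, Real.exp_zero, sub_self, add_zero]
    have h2 : ∀ j ∈ Finset.range m, Real.exp ((j + 1 : ℕ) : ℝ) - 1 ≤ Real.exp m := by
      intro j hj
      have h3 : ((j + 1 : ℕ) : ℝ) ≤ m := by exact_mod_cast Finset.mem_range.mp hj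
      linarith [Real.exp_le_exp.mpr h3]
    have := Finset.sum_le_card_nsmul _ _ _ h2
    simpa using this
  have h2 : (m.factorial : ℝ) ≤ (m : ℝ) ^ m := by exact_mod_cast Nat.factorial_le_pow m
  have h3 : 2 * remainderConst m ≤ 2 * ((m : ℝ) ^ m * (m * Real.exp m)) := by
    rw [remainderConst]
    refine mul_le_mul_of_nonneg_left ?_ (by norm_num)
    refine mul_le_mul h2 h1 (Finset.sum_nonneg fun j _ => ?_) (by positivity)
    rw [sub_nonneg]
    exact Real.one_le_exp (Nat.cast_nonneg j)
  have h4 := Real.log_le_log (by linarith [remainderConst_pos hm]) h3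
  have h6 : Real.log (2 * ((m : ℝ) ^ m * (m * Real.exp m))) =
      Real.log 2 + (m * Real.log m + (Real.log m + m)) := by
    rw [Real.log_mul (by norm_num) (by positivity), Real.log_mul (by positivity) (by positivity),
      Real.log_mul (by positivity) (by positivity), Real.log_pow, Real.log_exp]
  have h5 : Real.log 2 ≤ 1 := by linarith [Real.log_two_lt_d9]
  linarith

theorem log_five_gt : (1.609 : ℝ) < Real.log 5 := by
  have := le_log_of_le_logLo (n := 5) (by norm_num) (q := 1.6091) (by decide +kernel)
  norm_num at this ⊢
  linarith

theorem le_exp_of_ge {s : ℝ} (hs : 12.9 ≤ s) : 1.1 * s ^ 5 ≤ Real.exp s := by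
  have h1 : Real.log 12.9 ≤ 2.5575 := by
    have e1 := log_le_of_logHi_le (n := 129) (by norm_num) (q := 4.85982) (by decide +kernel)
    have e2 := le_log_of_le_logLo (n := 10) (by norm_num) (q := 2.30258) (by decide +kernel)
    norm_num at e1 e2
    rw [show (12.9 : ℝ) = 129 / 10 by norm_num, Real.log_div (by norm_num) (by norm_num)]
    linarith
  have h2 := Real.log_le_sub_one_of_pos (show 0 < s / 12.9 by positivity)
  rw [Real.log_div (by linarith) (by norm_num)] at h2
  have h3 := Real.log_le_sub_one_of_pos (show (0 : ℝ) < 1.1 by norm_num)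
  rw [← Real.log_le_iff_le_exp (by positivity), Real.log_mul (by norm_num) (by positivity),
    Real.log_pow]
  push_cast
  have h4 : s / 12.9 ≤ s / 5 - 2.58 + 1 := by
    rw [div_le_iff₀ (by norm_num)]
    linarith
  linarith

theorem twelve_nine_le {m : ℕ} (hm : 5 ≤ m) : 12.9 ≤ (m : ℝ) * Real.log m ^ 2 ∧
    1.609 ≤ Real.log m := by
  have h5 : (5 : ℝ) ≤ m := by exact_mod_cast hm
  have h1 : 1.609 ≤ Real.log m :=
    log_five_gt.le.trans (Real.log_le_log (by norm_num) h5)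
  have h2 : 1.609 ^ 2 ≤ Real.log m ^ 2 := pow_le_pow_left₀ (by norm_num) h1 2
  refine ⟨?_, h1⟩
  calc (12.9 : ℝ) ≤ 5 * 1.609 ^ 2 := by norm_num
    _ ≤ _ := mul_le_mul h5 h2 (by norm_num) (by linarith)

theorem lowerOrder_arith {m s a T c l X : ℝ} (hm : 5 ≤ m) (hs : 12.9 ≤ s) (hms : 2.58 * m ≤ s)
    (ha0 : 0 ≤ a) (ha : a ≤ m ^ 2 / 2) (hT1 : T ≤ 1.3 * s) (hT0 : 0 ≤ T) (hl : l ≤ s)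
    (hl0 : 0 ≤ l) (hc : 0 ≤ c) (hX : 1.1 * s ^ 4 ≤ X) :
    (a + 1 / 2) * s + T ≤ 0.01 * X ∧
    a + 1 / 2 ≤ 0.01 * (X + 1) ∧
    ((m + 1) * (a + 1 / 2) + (m + 1 / 2)) * s +
      ((m + 1) * (T + l) + Real.log 4 + 1.01 - l / 2 - c) ≤ 0.1 * X ∧
    (m + 1) * (a + 1 / 2) + (m + 1 / 2) ≤ 0.1 * (X + 1) := by
  have ha1 : a + 1 / 2 ≤ 1 / 12 * s ^ 2 - 1 / 2 := by
    have e2 : (2.58 * m) ^ 2 ≤ s ^ 2 := pow_le_pow_left₀ (by positivity) hms 2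
    have e3 : 12.9 ^ 2 ≤ s ^ 2 := pow_le_pow_left₀ (by norm_num) hs 2
    linarith only [ha, e2, e3]
  have hs0 : 0 ≤ s := by linarith only [hs]
  have hss : 12.9 * s ≤ s ^ 2 := by
    linarith only [mul_le_mul_of_nonneg_right hs hs0]
  have hss2 : 12.9 * s ^ 2 ≤ s ^ 3 := by
    linarith only [mul_le_mul_of_nonneg_right hs (sq_nonneg s)]
  have hss3 : 12.9 * s ^ 3 ≤ s ^ 4 := by
    linarith only [mul_le_mul_of_nonneg_right hs (pow_nonneg hs0 3)]
  have e2 : m + 1 ≤ 10 / 21 * s := by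
    linarith only [hms, hm]
  have key1 : (a + 1 / 2) * s + T ≤ 0.01 * X := by
    have e1 : (a + 1 / 2) * s ≤ (1 / 12 * s ^ 2 - 1 / 2) * s := mul_le_mul_of_nonneg_right ha1 hs0
    linarith only [e1, hT1, hX, hss, hss2, hss3, hs0]
  have hal : (m + 1) * (a + 1 / 2) + (m + 1 / 2) ≤ 1 / 24 * s ^ 3 := by
    have e1 : (m + 1) * (a + 1 / 2) ≤ (m + 1) * (1 / 12 * s ^ 2 - 1 / 2) :=
      mul_le_mul_of_nonneg_left ha1 (by linarith only [hm])
    have e3 : (m + 1) * (1 / 12 * s ^ 2) ≤ 10 / 21 * s * (1 / 12 * s ^ 2) :=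
      mul_le_mul_of_nonneg_right e2 (by positivity)
    linarith only [e1, e3, hss, hss2, hs, hms, hm]
  refine ⟨key1, ?_, ?_, ?_⟩
  · have e1 : (a + 1 / 2) * 1 ≤ (a + 1 / 2) * s :=
      mul_le_mul_of_nonneg_left (by linarith only [hs]) (by linarith only [ha0])
    linarith only [e1, key1, hT0]
  · have e1 : ((m + 1) * (a + 1 / 2) + (m + 1 / 2)) * s ≤ 1 / 24 * s ^ 3 * s :=
      mul_le_mul_of_nonneg_right hal hs0
    have e3 : (m + 1) * (T + l) ≤ 10 / 21 * s * (2.3 * s) :=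
      mul_le_mul e2 (by linarith only [hT1, hl]) (by positivity) (by positivity)
    have e4 : Real.log 4 ≤ 3 := by
      have := Real.log_le_sub_one_of_pos (show (0 : ℝ) < 4 by norm_num)
      linarith only [this]
    linarith only [e1, e3, e4, hX, hss, hss2, hss3, hs, hc, hl0]
  · linarith only [hX, hss2, hss3, hss, hs, hal]

/-- For `m ≥ 5` all lower order terms are negligible at the threshold, and the estimate reduces to
inequalities between `m`, `log m` and the sums over primes. -/
theorem omegaE_le_of_five_le {m : ℕ} (hm : 5 ≤ m) {v C H ρ y₀ : ℝ} (hH : 1 ≤ H) (hv : 0.85 ≤ v)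
    (hsum : Real.exp (v - 1) ≤ ∑ i ∈ Finset.range m, 1 / ((i : ℝ) + 1))
    (hd : 0 ≤ remainderRate m (m.factorial * Real.exp (-v)))
    (hB : 0 ≤ exponentRate m (m.factorial * Real.exp (-v)))
    (hρ : 0 < ρ) (hρ1 : ρ ≤ 1) (hy : (m : ℝ) * Real.log m ^ 2 ≤ y₀)
    (hyH : y₀ ≤ Real.log (Real.log H))
    (hC : exponentRate m (m.factorial * Real.exp (-v)) + 0.1 ≤ ρ * C)
    (h3 : 0 ≤ (1 - ρ) * y₀ - Real.log (ρ * y₀) -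
      remainderRate m (m.factorial * Real.exp (-v)) - 0.01)
    (h3' : 1 ≤ (1 - ρ) * y₀) (hC0 : 0 ≤ C) :
    omegaE m H ≤ ((m + C / Real.log (Real.log H) : ℝ) : EReal) := by
  obtain ⟨hs, hL⟩ := twelve_nine_le hm
  have hm1 : 1 ≤ m := by omega
  have hm5 : (5 : ℝ) ≤ m := by exact_mod_cast hm
  have hf0 : (0 : ℝ) < m.factorial := by exact_mod_cast m.factorial_pos
  have hM0 : 0 < (m.factorial : ℝ) * Real.exp (-v) := mul_pos hf0 (Real.exp_pos _)
  -- everything is bounded in terms of `s = m (log m) ^ 2`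
  obtain ⟨s, hsdef⟩ : ∃ s : ℝ, s = (m : ℝ) * Real.log m ^ 2 := ⟨_, rfl⟩
  rw [← hsdef] at hs hy
  have hexp := le_exp_of_ge hs
  have hs0 : 0 < s := by linarith only [hs]
  obtain ⟨X, hX⟩ : ∃ X : ℝ, X = Real.exp s / s := ⟨_, rfl⟩
  have hXs : X * s = Real.exp s := by rw [hX]; field_simp
  have hX5 : 1.1 * s ^ 4 ≤ X := by
    rw [hX, le_div_iff₀ hs0]
    linarith only [hexp]
  have hX11 : 11 ≤ X := by
    have hs4 : 12.9 ^ 4 ≤ s ^ 4 := pow_le_pow_left₀ (by norm_num) hs 4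
    linarith only [hs4, hX5]
  have hlogX : Real.log (X + 1) ≤ s := by
    rw [Real.log_le_iff_le_exp (by linarith only [hX11]), ← hXs]
    nlinarith only [hX11, hs]
  have hms : 2.58 * m ≤ s := by
    have e1 : 1.609 ^ 2 ≤ Real.log m ^ 2 := pow_le_pow_left₀ (by norm_num) hL 2
    have e2 := mul_le_mul_of_nonneg_left e1 (show (0 : ℝ) ≤ m by linarith only [hm5])
    linarith only [e2, hsdef, hm5]
  have hmLs : 1.6 * (m * Real.log m) ≤ s := by
    have e1 : 0 ≤ m * Real.log m := mul_nonneg (by linarith only [hm5]) (by linarith only [hL])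
    have e2 := mul_le_mul_of_nonneg_left hL e1
    linarith only [e1, e2, hsdef]
  have hLs : 8 * Real.log m ≤ s := by
    have e1 := mul_le_mul_of_nonneg_right hm5 (show 0 ≤ Real.log m by linarith only [hL])
    linarith only [e1, hmLs]
  have hc1 := log_two_mul_remainderConst_le hm1
  have hF0 : 0 ≤ Real.log (m.factorial : ℝ) := Real.log_nonneg (by exact_mod_cast m.factorial_pos)
  have hFc : Real.log (m.factorial : ℝ) ≤ Real.log (2 * remainderConst m) :=
    Real.log_le_log hf0 (factorial_le_two_mul_remainderConst hm1)
  have hdF : remainderRate m (m.factorial * Real.exp (-v)) ≤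
      Real.log (m.factorial : ℝ) + 0.15 := by
    rw [remainderRate, Real.log_mul hf0.ne' (Real.exp_pos _).ne', Real.log_exp]
    linarith only [logFactorTotal_nonneg m, hv]
  have hT0 : 0 ≤ 1.05 + (Real.log (2 * remainderConst m) - 0.9) -
      remainderRate m (m.factorial * Real.exp (-v)) := by linarith only [hdF, hFc]
  have hT1 : 1.05 + (Real.log (2 * remainderConst m) - 0.9) -
      remainderRate m (m.factorial * Real.exp (-v)) ≤ 1.3 * s := by
    linarith only [hd, hc1, hmLs, hLs, hms, hs]
  have hL1 : Real.log ((m : ℝ) + 1) ≤ s := by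
    have e1 := Real.log_le_sub_one_of_pos (show (0 : ℝ) < m + 1 by linarith only [hm5])
    linarith only [e1, hms, hm5]
  have hL10 : 0 ≤ Real.log ((m : ℝ) + 1) := Real.log_nonneg (by linarith only [hm5])
  have ha0 := floorSumTotal_nonneg m
  obtain ⟨k1, k2, k3, k4⟩ := lowerOrder_arith hm5 hs hms ha0 (floorSumTotal_le m) hT1 hT0 hL1 hL10
    (hF0.trans hFc) hX5
  have g1 : X ≤ Real.exp y₀ / (ρ * y₀) := by
    rw [hX]
    refine (exp_div_le_exp_div (by linarith only [hs]) hy).trans ?_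
    have hy0 : 0 < y₀ := by linarith only [hs, hy]
    exact div_le_div_of_nonneg_left (Real.exp_pos _).le (by positivity)
      (mul_le_of_le_one_left hy0.le hρ1)
  have hy1 : 1 ≤ y₀ := by linarith only [hs, hy]
  refine omegaE_le_add_div hm1 (ρ := ρ) (ε₁ := 0.01) (ε₂ := 0.1) (X₀ := X) (y₀ := y₀) hH
    hM0 (fun x h0 hx => prod_abs_sub_le_factorial_mul_exp hm1 hsum h0 hx) (remainderConst_pos hm1)
    hd hB hT0 hρ (by norm_num) hX11 hy1 hyH g1 hC ?_ k2 ?_ k4 h3 h3' hC0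
  · have e1 := mul_le_mul_of_nonneg_left hlogX
      (show 0 ≤ floorSumTotal m + 1 / 2 by linarith only [ha0])
    linarith only [e1, k1]
  · have e1 := mul_le_mul_of_nonneg_left hlogX (show 0 ≤
      ((m : ℝ) + 1) * (floorSumTotal m + 1 / 2) + (m + 1 / 2) by positivity)
    linarith only [e1, k3]

end LowerOrderTerms

/-! ### Few points -/

section FewPoints

theorem log_div_le_of_logHi {a b : ℕ} (ha : 1 ≤ a) (hb : 1 ≤ b) {q : ℚ}
    (h : logHi a - logLo b ≤ q) : Real.log ((a : ℝ) / b) ≤ q := by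
  rw [Real.log_div (by positivity) (by positivity)]
  have h1 : ((logHi a - logLo b : ℚ) : ℝ) ≤ q := Rat.cast_le.mpr h
  push_cast at h1
  linarith [le_logHi ha, logLo_le hb]

theorem le_log_div_of_logLo {a b : ℕ} (ha : 1 ≤ a) (hb : 1 ≤ b) {q : ℚ}
    (h : q ≤ logLo a - logHi b) : (q : ℝ) ≤ Real.log ((a : ℝ) / b) := by
  rw [Real.log_div (by positivity) (by positivity)]
  have h1 : (q : ℝ) ≤ ((logLo a - logHi b : ℚ) : ℝ) := Rat.cast_le.mpr h
  push_cast at h1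
  linarith [logLo_le ha, le_logHi hb]

/-- If `log H ≥ s e ^ s` then `log log H ≥ s + log s`. -/
theorem add_log_le_log_log {s H : ℝ} (hs : 0 < s) (h : s * Real.exp s ≤ Real.log H) :
    s + Real.log s ≤ Real.log (Real.log H) := by
  have h1 : 0 < s * Real.exp s := mul_pos hs (Real.exp_pos s)
  have h2 := Real.log_le_log h1 h
  rw [Real.log_mul hs.ne' (Real.exp_pos s).ne', Real.log_exp] at h2
  linarith

/-- The maximum is `2 / (3 √3) = 0.3849…`. -/
theorem prod_abs_sub_le_two {x : ℝ} (h0 : 0 ≤ x) (hx : x ≤ 2) :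
    ∏ i ∈ Finset.range (2 + 1), |x - (i : ℝ)| ≤ 77 / 200 := by
  rw [← Finset.abs_prod]
  simp only [Finset.prod_range_succ, Finset.prod_range_zero]
  push_cast
  refine abs_le_of_sq_le_sq ?_ (by norm_num)
  have h1 : 0 ≤ ((x - 1) ^ 2 - 1 / 3) ^ 2 * (4 / 3 - (x - 1) ^ 2) :=
    mul_nonneg (sq_nonneg _) (by nlinarith)
  linarith

theorem prod_abs_sub_le_three {x : ℝ} (h0 : 0 ≤ x) (hx : x ≤ 3) :
    ∏ i ∈ Finset.range (3 + 1), |x - (i : ℝ)| ≤ 1 := by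
  rw [← Finset.abs_prod]
  simp only [Finset.prod_range_succ, Finset.prod_range_zero]
  push_cast
  have h1 : 0 ≤ x * (3 - x) := mul_nonneg h0 (by linarith)
  have h2 : x * (3 - x) ≤ 9 / 4 := by nlinarith [sq_nonneg (x - 3 / 2)]
  rw [abs_le]
  constructor
  · nlinarith [sq_nonneg (x * (3 - x) - 1)]
  · nlinarith [mul_nonneg h1 (sub_nonneg.mpr h2)]

/-- In the centred variable the product of the distances to `0, …, 4` is
`|t (t ^ 2 - 1) (t ^ 2 - 4)|`, with a maximum `3.631…` on `[-2, 2]` at `|t| = 1.6444…`. -/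
theorem quintic_nonneg {t : ℝ} (h : -2 ≤ t) (ht : t ≤ 2) :
    0 ≤ 3.64 + (t ^ 5 - 5 * t ^ 3 + 4 * t) := by
  have h1 : 0 ≤ (t + 2) * ((t + 0.6444) ^ 2 + 0.1) :=
    mul_nonneg (by linarith) (by positivity)
  -- the cofactor of `(t - 1.6444) ^ 2` in the division with remainder
  have h2 : 0 ≤ (t - 1.6444) ^ 2 *
      (t ^ 3 + 2 * 1.6444 * t ^ 2 + (3 * 1.6444 ^ 2 - 5) * t + (4 * 1.6444 ^ 3 - 10 * 1.6444)) :=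
    mul_nonneg (sq_nonneg _) (by nlinarith)
  linarith

theorem prod_abs_sub_le_four {x : ℝ} (h0 : 0 ≤ x) (hx : x ≤ 4) :
    ∏ i ∈ Finset.range (4 + 1), |x - (i : ℝ)| ≤ 3.64 := by
  rw [← Finset.abs_prod]
  simp only [Finset.prod_range_succ, Finset.prod_range_zero]
  push_cast
  rw [abs_le]
  have h1 := quintic_nonneg (t := x - 2) (by linarith) (by linarith)
  have h2 := quintic_nonneg (t := 2 - x) (by linarith) (by linarith)
  constructor <;> linarith

theorem floorSumTotal_two : floorSumTotal 2 = 0 := by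
  have h : (Finset.range (2 + 1)).filter Nat.Prime = {2} := by decide +kernel
  rw [floorSumTotal, h, Finset.sum_singleton, minFloorSum_eq (by norm_num)]
  norm_num

theorem logFactorTotal_two : logFactorTotal 2 = 0 := by
  have h : (Finset.range (2 + 1)).filter Nat.Prime = {2} := by decide +kernel
  rw [logFactorTotal, h, Finset.sum_singleton, minFloorSum_eq (by norm_num)]
  norm_num

theorem floorSumTotal_three : floorSumTotal 3 = 1 := by
  have h : (Finset.range (3 + 1)).filter Nat.Prime = {2, 3} := by decide +kernel
  rw [floorSumTotal, h, Finset.sum_pair (by norm_num), minFloorSum_eq (by norm_num),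
    minFloorSum_eq (by norm_num)]
  norm_num

theorem logFactorTotal_three : logFactorTotal 3 = Real.log 2 := by
  have h : (Finset.range (3 + 1)).filter Nat.Prime = {2, 3} := by decide +kernel
  rw [logFactorTotal, h, Finset.sum_pair (by norm_num), minFloorSum_eq (by norm_num),
    minFloorSum_eq (by norm_num)]
  norm_num

theorem floorSumTotal_four : floorSumTotal 4 = 1 := by
  have h : (Finset.range (4 + 1)).filter Nat.Prime = {2, 3} := by decide +kernel
  rw [floorSumTotal, h, Finset.sum_pair (by norm_num), minFloorSum_eq (by norm_num),
    minFloorSum_eq (by norm_num)]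
  norm_num

theorem logFactorTotal_four : logFactorTotal 4 = Real.log 2 := by
  have h : (Finset.range (4 + 1)).filter Nat.Prime = {2, 3} := by decide +kernel
  rw [logFactorTotal, h, Finset.sum_pair (by norm_num), minFloorSum_eq (by norm_num),
    minFloorSum_eq (by norm_num)]
  norm_num

theorem two_mul_remainderConst_two :
    2 * remainderConst 2 = 4 * (Real.exp 1 + Real.exp 1 ^ 2 - 2) := by
  simp only [remainderConst, Finset.sum_range_succ, Finset.sum_range_zero, ← Real.exp_nat_mul]
  norm_num [Nat.factorial]
  ring

theorem two_mul_remainderConst_three :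
    2 * remainderConst 3 = 12 * (Real.exp 1 + Real.exp 1 ^ 2 + Real.exp 1 ^ 3 - 3) := by
  simp only [remainderConst, Finset.sum_range_succ, Finset.sum_range_zero, ← Real.exp_nat_mul]
  norm_num [Nat.factorial]
  ring

theorem two_mul_remainderConst_four : 2 * remainderConst 4 =
    48 * (Real.exp 1 + Real.exp 1 ^ 2 + Real.exp 1 ^ 3 + Real.exp 1 ^ 4 - 4) := by
  simp only [remainderConst, Finset.sum_range_succ, Finset.sum_range_zero, ← Real.exp_nat_mul]
  norm_num [Nat.factorial]
  ring

theorem exp_one_pow_bounds : 7.38 ≤ Real.exp 1 ^ 2 ∧ Real.exp 1 ^ 2 ≤ 7.39 ∧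
    20 ≤ Real.exp 1 ^ 3 ∧ Real.exp 1 ^ 3 ≤ 20.0856 ∧
    54 ≤ Real.exp 1 ^ 4 ∧ Real.exp 1 ^ 4 ≤ 54.6 := by
  have h1 := Real.exp_one_gt_d9.le
  have h2 := Real.exp_one_lt_d9.le
  have l := fun k : ℕ => pow_le_pow_left₀ (by norm_num) h1 k
  have u := fun k : ℕ => pow_le_pow_left₀ (Real.exp_pos 1).le h2 k
  refine ⟨?_, ?_, ?_, ?_, ?_, ?_⟩
  · exact le_trans (by norm_num) (l 2)
  · exact (u 2).trans (by norm_num)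
  · exact le_trans (by norm_num) (l 3)
  · exact (u 3).trans (by norm_num)
  · exact le_trans (by norm_num) (l 4)
  · exact (u 4).trans (by norm_num)

/-- Here `log log H ≥ e + 1`, and the method has room to spare: the parameters `ρ`, `ε₁`, `ε₂` may
vary by several per cent. -/
theorem omegaE_two_le {H : ℝ} (hH : 1 ≤ H)
    (h : sFun 2 * Real.exp (sFun 2) ≤ Real.log H) :
    omegaE 2 H ≤ ((2 + 4.93 / Real.log (Real.log H) : ℝ) : EReal) := by
  have he1 := Real.exp_one_gt_d9
  have he2 := Real.exp_one_lt_d9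
  obtain ⟨p1, p2, -⟩ := exp_one_pow_bounds
  have hy : 3.71 ≤ Real.log (Real.log H) := by
    rw [sFun, if_pos rfl] at h
    have := add_log_le_log_log (Real.exp_pos 1) h
    rw [Real.log_exp] at this
    linarith
  have hM1 : (-0.9546 : ℝ) ≤ Real.log (77 / 200) := by
    have := le_log_div_of_logLo (a := 77) (b := 200) (by norm_num) (by norm_num)
      (q := -0.9546) (by decide +kernel)
    norm_num at this ⊢; exact this
  have hM2 : Real.log (77 / 200) ≤ (-0.9545 : ℝ) := by
    have := log_div_le_of_logHi (a := 77) (b := 200) (by norm_num) (by norm_num)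
      (q := -0.9545) (by decide +kernel)
    norm_num at this ⊢; exact this
  have hl1 : (1.0986 : ℝ) ≤ Real.log 3 := by
    have := le_log_of_le_logLo (n := 3) (by norm_num) (q := 1.0986) (by decide +kernel)
    norm_num at this ⊢; exact this
  have hl2 : Real.log 3 ≤ (1.09862 : ℝ) := by
    have := log_le_of_logHi_le (n := 3) (by norm_num) (q := 1.09862) (by decide +kernel)
    norm_num at this ⊢; exact this
  have hl4 : Real.log 4 ≤ (1.3863 : ℝ) := by
    have := log_le_of_logHi_le (n := 4) (by norm_num) (q := 1.3863) (by decide +kernel)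
    norm_num at this ⊢; exact this
  have hX : Real.log (19.5 + 1) ≤ (3.0205 : ℝ) := by
    have := log_div_le_of_logHi (a := 41) (b := 2) (by norm_num) (by norm_num)
      (q := 3.0205) (by decide +kernel)
    norm_num at this ⊢; exact this
  have hρy : Real.log (0.56 * 3.71) ≤ (0.7324 : ℝ) := by
    have := log_div_le_of_logHi (a := 208) (b := 100) (by norm_num) (by norm_num)
      (q := 0.7324) (by decide +kernel)
    refine (Real.log_le_log (by norm_num) (show (0.56 * 3.71 : ℝ) ≤ 208 / 100 by norm_num)).trans ?_
    norm_num at this ⊢; exact this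
  have hXy : (19.5 : ℝ) ≤ Real.exp 3.71 / (0.56 * 3.71) := by
    have := log_div_le_of_logHi (a := 406) (b := 10) (by norm_num) (by norm_num)
      (q := 3.71) (by decide +kernel)
    rw [Real.log_le_iff_le_exp (by norm_num)] at this
    rw [le_div_iff₀ (by norm_num)]
    norm_num at this ⊢; linarith
  have hc1 : (3.465 : ℝ) ≤ Real.log (2 * remainderConst 2) := by
    rw [two_mul_remainderConst_two]
    have := le_log_div_of_logLo (a := 320) (b := 10) (by norm_num) (by norm_num)
      (q := 3.465) (by decide +kernel)
    norm_num at this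
    refine le_trans ?_ (Real.log_le_log (x := 32) (by norm_num) (by linarith))
    norm_num; exact this
  have hc2 : Real.log (2 * remainderConst 2) ≤ (3.482 : ℝ) := by
    rw [two_mul_remainderConst_two]
    have := log_div_le_of_logHi (a := 65) (b := 2) (by norm_num) (by norm_num)
      (q := 3.482) (by decide +kernel)
    norm_num at this
    refine le_trans (Real.log_le_log (y := 65 / 2) (by linarith) (by linarith)) ?_
    norm_num; exact this
  have hd : remainderRate 2 (77 / 200) = 1 + Real.log (77 / 200) := by
    rw [remainderRate, logFactorTotal_two, sub_zero]
  have hB : exponentRate 2 (77 / 200) =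
      3 * (remainderRate 2 (77 / 200) + Real.log 3 - 1) - Real.log (77 / 200) := by
    rw [exponentRate]; norm_num
  have h23 : Real.log (2 + 1) = Real.log 3 := by norm_num
  have := omegaE_le_add_div (m := 2) (M := 77 / 200) (C := 4.93) (ρ := 0.56) (ε₁ := 0.27)
    (ε₂ := 1.32) (X₀ := 19.5) (y₀ := 3.71) (by norm_num) hH (by norm_num)
    (fun x h0 hx => prod_abs_sub_le_two h0 (by exact_mod_cast hx)) (remainderConst_pos (by norm_num))
    (by rw [hd]; linarith) (by rw [hB, hd]; linarith) (by rw [hd]; linarith) (by norm_num)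
    (by norm_num) (by norm_num) (by norm_num) hy hXy (by rw [hB, hd]; linarith)
    (by rw [floorSumTotal_two, hd]; linarith) (by rw [floorSumTotal_two]; norm_num)
    (by rw [floorSumTotal_two, hd]; push_cast; rw [h23]; linarith)
    (by rw [floorSumTotal_two]; norm_num) (by rw [hd]; linarith) (by norm_num) (by norm_num)
  exact_mod_cast this

/-- Here the constant `6.49` is nearly the best that the method gives: `ρ = 0.6432` satisfies both
`B + ε₂ ≤ 6.49 ρ` and the condition that bounds `ρ` from above, with less than one per cent to
spare. Both `ε₁` and `ε₂` are close to the least values admissible at `X₀ = 42.8`. -/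
theorem omegaE_three_le {H : ℝ} (hH : 1 ≤ H)
    (h : sFun 3 * Real.exp (sFun 3) ≤ Real.log H) :
    omegaE 3 H ≤ ((3 + 6.49 / Real.log (Real.log H) : ℝ) : EReal) := by
  have he1 := Real.exp_one_gt_d9
  have he2 := Real.exp_one_lt_d9
  obtain ⟨p1, p2, p3, p4, -⟩ := exp_one_pow_bounds
  have hl1 : (1.098612 : ℝ) ≤ Real.log 3 := by
    have := le_log_of_le_logLo (n := 3) (by norm_num) (q := 1.098612) (by decide +kernel)
    norm_num at this ⊢; exact this
  have hy : 4.907 ≤ Real.log (Real.log H) := by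
    rw [sFun, if_neg (by norm_num)] at h
    push_cast at h
    have h1 : (3.6208 : ℝ) ≤ 3 * Real.log 3 ^ 2 := by
      have := pow_le_pow_left₀ (by norm_num) hl1 2
      linarith
    have h2 := add_log_le_log_log (by linarith) h
    have h3 := Real.log_le_log (by norm_num) (show (362 / 100 : ℝ) ≤ 3 * Real.log 3 ^ 2 by linarith)
    have h4 := le_log_div_of_logLo (a := 362) (b := 100) (by norm_num) (by norm_num)
      (q := 1.28647) (by decide +kernel)
    norm_num at h3 h4
    linarith
  have hl21 : (0.69314 : ℝ) ≤ Real.log 2 := by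
    have := le_log_of_le_logLo (n := 2) (by norm_num) (q := 0.69314) (by decide +kernel)
    norm_num at this ⊢; exact this
  have hl22 : Real.log 2 ≤ (0.69315 : ℝ) := by
    have := log_le_of_logHi_le (n := 2) (by norm_num) (q := 0.69315) (by decide +kernel)
    norm_num at this ⊢; exact this
  have hl4 : Real.log 4 = 2 * Real.log 2 := by
    rw [show (4 : ℝ) = 2 ^ 2 by norm_num, Real.log_pow]; norm_num
  have hX : Real.log (42.8 + 1) ≤ (3.7797 : ℝ) := by
    have := log_div_le_of_logHi (a := 219) (b := 5) (by norm_num) (by norm_num)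
      (q := 3.7797) (by decide +kernel)
    norm_num at this ⊢; exact this
  have hρy : Real.log (0.6432 * 4.907) ≤ (1.15 : ℝ) := by
    have := log_div_le_of_logHi (a := 60) (b := 19) (by norm_num) (by norm_num)
      (q := 1.15) (by decide +kernel)
    refine (Real.log_le_log (by norm_num)
      (show (0.6432 * 4.907 : ℝ) ≤ 60 / 19 by norm_num)).trans ?_
    norm_num at this ⊢; exact this
  have hXy : (42.8 : ℝ) ≤ Real.exp 4.907 / (0.6432 * 4.907) := by
    have := log_div_le_of_logHi (a := 946) (b := 7) (by norm_num) (by norm_num)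
      (q := 4.907) (by decide +kernel)
    rw [Real.log_le_iff_le_exp (by norm_num)] at this
    rw [le_div_iff₀ (by norm_num)]
    norm_num at this ⊢; linarith
  have hc1 : (5.78 : ℝ) ≤ Real.log (2 * remainderConst 3) := by
    rw [two_mul_remainderConst_three]
    have := le_log_div_of_logLo (a := 325) (b := 1) (by norm_num) (by norm_num)
      (q := 5.78) (by decide +kernel)
    norm_num at this
    refine le_trans ?_ (Real.log_le_log (x := 325) (by norm_num) (by linarith))
    norm_num; exact this
  have hc2 : Real.log (2 * remainderConst 3) ≤ (5.789 : ℝ) := by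
    rw [two_mul_remainderConst_three]
    have := log_div_le_of_logHi (a := 653) (b := 2) (by norm_num) (by norm_num)
      (q := 5.789) (by decide +kernel)
    norm_num at this
    refine le_trans (Real.log_le_log (y := 653 / 2) (by linarith) (by linarith)) ?_
    norm_num; exact this
  have hd : remainderRate 3 1 = 1 - Real.log 2 := by
    rw [remainderRate, logFactorTotal_three, Real.log_one, add_zero]
  have hB : exponentRate 3 1 = 4 * Real.log 2 := by
    rw [exponentRate, hd, Real.log_one]
    norm_num
    rw [hl4]; ring
  have h34 : Real.log (3 + 1) = 2 * Real.log 2 := by rw [← hl4]; norm_num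
  have := omegaE_le_add_div (m := 3) (M := 1) (C := 6.49) (ρ := 0.6432) (ε₁ := 0.265)
    (ε₂ := 1.4) (X₀ := 42.8) (y₀ := 4.907) (by norm_num) hH (by norm_num)
    (fun x h0 hx => prod_abs_sub_le_three h0 (by exact_mod_cast hx))
    (remainderConst_pos (by norm_num))
    (by rw [hd]; linarith) (by rw [hB]; linarith) (by rw [hd]; linarith) (by norm_num)
    (by norm_num) (by norm_num) (by norm_num) hy hXy (by rw [hB]; linarith)
    (by rw [floorSumTotal_three, hd]; linarith) (by rw [floorSumTotal_three]; norm_num)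
    (by rw [floorSumTotal_three, hd]; push_cast; rw [h34, hl4]; linarith)
    (by rw [floorSumTotal_three]; norm_num) (by rw [hd]; linarith) (by norm_num) (by norm_num)
  exact_mod_cast this

theorem omegaE_four_le {H : ℝ} (hH : 1 ≤ H)
    (h : sFun 4 * Real.exp (sFun 4) ≤ Real.log H) :
    omegaE 4 H ≤ ((4 + 15.7 / Real.log (Real.log H) : ℝ) : EReal) := by
  have he1 := Real.exp_one_gt_d9
  have he2 := Real.exp_one_lt_d9
  obtain ⟨p1, p2, p3, p4, p5, p6⟩ := exp_one_pow_bounds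
  have hl21 : (0.69314 : ℝ) ≤ Real.log 2 := by
    have := le_log_of_le_logLo (n := 2) (by norm_num) (q := 0.69314) (by decide +kernel)
    norm_num at this ⊢; exact this
  have hl22 : Real.log 2 ≤ (0.69315 : ℝ) := by
    have := log_le_of_logHi_le (n := 2) (by norm_num) (q := 0.69315) (by decide +kernel)
    norm_num at this ⊢; exact this
  have hl4 : Real.log 4 = 2 * Real.log 2 := by
    rw [show (4 : ℝ) = 2 ^ 2 by norm_num, Real.log_pow]; norm_num
  have hy : 9.72 ≤ Real.log (Real.log H) := by
    rw [sFun, if_neg (by norm_num)] at h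
    push_cast at h
    have h1 : (7.687 : ℝ) ≤ 4 * Real.log 4 ^ 2 := by
      have := pow_le_pow_left₀ (by norm_num) hl21 2
      rw [hl4]
      linarith
    have h2 := add_log_le_log_log (by linarith) h
    have h3 := Real.log_le_log (by norm_num) (show (768 / 100 : ℝ) ≤ 4 * Real.log 4 ^ 2 by linarith)
    have h4 := le_log_div_of_logLo (a := 192) (b := 25) (by norm_num) (by norm_num)
      (q := 2.038) (by decide +kernel)
    norm_num at h3 h4
    linarith
  have hM1 : (1.2919 : ℝ) ≤ Real.log 3.64 := by
    have := le_log_div_of_logLo (a := 364) (b := 100) (by norm_num) (by norm_num)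
      (q := 1.2919) (by decide +kernel)
    norm_num at this ⊢; exact this
  have hM2 : Real.log 3.64 ≤ (1.292 : ℝ) := by
    have := log_div_le_of_logHi (a := 364) (b := 100) (by norm_num) (by norm_num)
      (q := 1.292) (by decide +kernel)
    norm_num at this ⊢; exact this
  have hl51 : (1.609 : ℝ) ≤ Real.log 5 := by
    have := le_log_of_le_logLo (n := 5) (by norm_num) (q := 1.609) (by decide +kernel)
    norm_num at this ⊢; exact this
  have hl52 : Real.log 5 ≤ (1.60944 : ℝ) := by
    have := log_le_of_logHi_le (n := 5) (by norm_num) (q := 1.60944) (by decide +kernel)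
    norm_num at this ⊢; exact this
  have hX : Real.log (2700 + 1) ≤ (7.903 : ℝ) := by
    have := log_le_of_logHi_le (n := 52) (by norm_num) (q := 7.903 / 2) (by decide +kernel)
    refine (Real.log_le_log (by norm_num) (show (2700 + 1 : ℝ) ≤ 52 ^ 2 by norm_num)).trans ?_
    rw [Real.log_pow]
    norm_num at this ⊢; linarith
  have hρy : Real.log (0.63 * 9.72) ≤ (1.8124 : ℝ) := by
    have := log_div_le_of_logHi (a := 49) (b := 8) (by norm_num) (by norm_num)
      (q := 1.8124) (by decide +kernel)
    refine (Real.log_le_log (by norm_num)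
      (show (0.63 * 9.72 : ℝ) ≤ 49 / 8 by norm_num)).trans ?_
    norm_num at this ⊢; exact this
  have hXy : (2700 : ℝ) ≤ Real.exp 9.72 / (0.63 * 9.72) := by
    have := log_le_of_logHi_le (n := 129) (by norm_num) (q := 9.72 / 2) (by decide +kernel)
    have h5 : Real.log (129 ^ 2) ≤ 9.72 := by
      rw [Real.log_pow]
      norm_num at this ⊢; linarith
    rw [Real.log_le_iff_le_exp (by norm_num)] at h5
    rw [le_div_iff₀ (by norm_num)]
    norm_num at h5 ⊢; linarith
  have hc1 : (8.2 : ℝ) ≤ Real.log (2 * remainderConst 4) := by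
    rw [two_mul_remainderConst_four]
    have := le_log_of_le_logLo (n := 61) (by norm_num) (q := 8.2 / 2) (by decide +kernel)
    refine le_trans ?_ (Real.log_le_log (x := 61 ^ 2) (by norm_num) (by linarith))
    rw [Real.log_pow]
    norm_num at this ⊢; linarith
  have hc2 : Real.log (2 * remainderConst 4) ≤ (8.29 : ℝ) := by
    rw [two_mul_remainderConst_four]
    have := log_le_of_logHi_le (n := 63) (by norm_num) (q := 8.29 / 2) (by decide +kernel)
    refine le_trans (Real.log_le_log (y := 63 ^ 2) (by linarith) (by linarith)) ?_
    rw [Real.log_pow]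
    norm_num at this ⊢; linarith
  have hd : remainderRate 4 3.64 = 1 + Real.log 3.64 - Real.log 2 := by
    rw [remainderRate, logFactorTotal_four]
  have hB : exponentRate 4 3.64 =
      5 * (1 + Real.log 3.64 - Real.log 2 + Real.log 5 - 1) - Real.log 3.64 := by
    rw [exponentRate, hd]
    norm_num
  have h45 : Real.log (4 + 1) = Real.log 5 := by norm_num
  have := omegaE_le_add_div (m := 4) (M := 3.64) (C := 15.7) (ρ := 0.63) (ε₁ := 0.007)
    (ε₂ := 0.06) (X₀ := 2700) (y₀ := 9.72) (by norm_num) hH (by norm_num)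
    (fun x h0 hx => prod_abs_sub_le_four h0 (by exact_mod_cast hx))
    (remainderConst_pos (by norm_num))
    (by rw [hd]; linarith) (by rw [hB]; linarith) (by rw [hd]; linarith) (by norm_num)
    (by norm_num) (by norm_num) (by norm_num) hy hXy (by rw [hB]; linarith)
    (by rw [floorSumTotal_four, hd]; linarith) (by rw [floorSumTotal_four]; norm_num)
    (by rw [floorSumTotal_four, hd]; push_cast; rw [h45, hl4]; linarith)
    (by rw [floorSumTotal_four]; norm_num) (by rw [hd]; linarith) (by norm_num) (by norm_num)
  exact_mod_cast this

end FewPoints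

/-! ### From five to `127` points -/

section ModeratelyManyPoints

/-- Sufficient numerical conditions for the bound on `ω(m, H)`, in terms of bounds for `log m`,
`log (m + 1)` and the sum over primes `logFactorTotal m`. -/
theorem omegaE_le_of_numerical {m : ℕ} (hm : 5 ≤ m)
    {H v l₁ l₂ l₃ K₁ K₂ E ρ a b e : ℝ} (hH : 1 ≤ H)
    (hs : sFun m * Real.exp (sFun m) ≤ Real.log H) (hv : 0.85 ≤ v)
    (hsum : Real.exp (v - 1) ≤ ∑ i ∈ Finset.range m, 1 / ((i : ℝ) + 1))
    (hl₁0 : 1.6 ≤ l₁) (hl₁ : l₁ ≤ Real.log m) (hl₂ : Real.log m ≤ l₂)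
    (hl₃ : Real.log (m + 1) ≤ l₃) (hK₁ : K₁ ≤ logFactorTotal m) (hK₂ : logFactorTotal m ≤ K₂)
    (hE : m * e ≤ E) (c1 : 0 ≤ m * l₁ + 1 - m - v - K₂)
    (c2 : 0 ≤ m * (m * l₁ - m) - m * v - (m + 1) * K₂ + (m + 1) * l₁)
    (c3 : E ≤ m * l₁ ^ 2) (c4 : K₂ ≤ m * l₁) (hρ0 : 0 < ρ) (hρ1 : ρ ≤ 1)
    (c5 : (m * ((m + 1 / 2) * l₂ - m + 1) - m * v - (m + 1) * K₁ + (m + 1) * l₃ + 0.1) * l₂ ^ 2 ≤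
      ρ * ((m * l₁ ^ 2 - E) * (m * l₁ - K₂)))
    (ha : 0 < a) (hb : Real.log a ≤ b) (c8 : 0 ≤ 1 - ρ - ρ / (m * a))
    (c6 : 0 ≤ (1 - ρ - ρ / (m * a)) * (m * l₁ ^ 2 + l₁ + 0.9) - (l₂ + b - 1) -
      (1 + ((m + 1 / 2) * l₂ - m + 1) - v - K₁) - 0.01)
    (c7 : 1 ≤ (1 - ρ) * (m * l₁ ^ 2 + l₁ + 0.9)) :
    omegaE m H ≤ ((m + (1 - e / Real.log m ^ 2) * (1 - logFactorTotal m / m / Real.log m) *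
      ((m : ℝ) ^ 2 * Real.log m / Real.log (Real.log H)) : ℝ) : EReal) := by
  have hm5 : (5 : ℝ) ≤ m := by exact_mod_cast hm
  have hm0 : (0 : ℝ) < m := by linarith
  obtain ⟨L, hL⟩ : ∃ L, L = Real.log m := ⟨_, rfl⟩
  obtain ⟨K, hK⟩ : ∃ K, K = logFactorTotal m := ⟨_, rfl⟩
  obtain ⟨F, hF⟩ : ∃ F, F = Real.log m.factorial := ⟨_, rfl⟩
  obtain ⟨L', hL'⟩ : ∃ L', L' = Real.log ((m : ℝ) + 1) := ⟨_, rfl⟩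
  have hF1 : m * L - m ≤ F := by
    have := le_log_factorial (n := m) (by omega)
    rw [← hL, ← hF] at this
    linarith
  have hF2 : F ≤ (m + 1 / 2) * L - m + 1 := by
    have := log_factorial_le (n := m) (by omega)
    rw [← hL, ← hF] at this
    linarith
  rw [← hL] at hl₁ hl₂
  rw [← hK] at hK₁ hK₂
  rw [← hL'] at hl₃
  have hLL' : L ≤ L' := by
    rw [hL, hL']
    exact Real.log_le_log hm0 (by linarith)
  have hL0 : 0 < L := by linarith
  have hd : remainderRate m (m.factorial * Real.exp (-v)) = 1 + F - v - K := by
    rw [remainderRate, Real.log_mul (by positivity) (Real.exp_pos _).ne', Real.log_exp, ← hF, ← hK]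
    ring
  have hB : exponentRate m (m.factorial * Real.exp (-v)) =
      m * F - m * v - (m + 1) * K + (m + 1) * L' := by
    rw [exponentRate, hd, Real.log_mul (by positivity) (Real.exp_pos _).ne', Real.log_exp, ← hF,
      ← hL']
    ring
  have hsq : l₁ ^ 2 ≤ L ^ 2 := pow_le_pow_left₀ (by linarith) hl₁ 2
  have hsq2 : L ^ 2 ≤ l₂ ^ 2 := pow_le_pow_left₀ hL0.le hl₂ 2
  have hml : m * l₁ ≤ m * L := mul_le_mul_of_nonneg_left hl₁ hm0.le
  have hml2 : m * L ≤ m * l₂ := mul_le_mul_of_nonneg_left hl₂ hm0.le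
  have hmF1 := mul_le_mul_of_nonneg_left hF1 hm0.le
  have hmF2 := mul_le_mul_of_nonneg_left hF2 hm0.le
  have hmml : m * (m * l₁) ≤ m * (m * L) := mul_le_mul_of_nonneg_left hml hm0.le
  have hmml2 : m * (m * L) ≤ m * (m * l₂) := mul_le_mul_of_nonneg_left hml2 hm0.le
  have hmsq : m * l₁ ^ 2 ≤ m * L ^ 2 := mul_le_mul_of_nonneg_left hsq hm0.le
  have hmK1 : (m + 1) * K₁ ≤ (m + 1) * K := mul_le_mul_of_nonneg_left hK₁ (by linarith)
  have hmK2 : (m + 1) * K ≤ (m + 1) * K₂ := mul_le_mul_of_nonneg_left hK₂ (by linarith)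
  have hmL1 : (m + 1) * l₁ ≤ (m + 1) * L' := mul_le_mul_of_nonneg_left (by linarith) (by linarith)
  have hmL3 : (m + 1) * L' ≤ (m + 1) * l₃ := mul_le_mul_of_nonneg_left hl₃ (by linarith)
  -- `log log H ≥ s + log s` with `s = m L ^ 2`, and `log s = L + 2 log L`
  obtain ⟨y₀, hy₀⟩ : ∃ y₀ : ℝ, y₀ = m * L ^ 2 + L + 0.9 := ⟨_, rfl⟩
  have hyl : m * l₁ ^ 2 + l₁ + 0.9 ≤ y₀ := by linarith
  have hy0 : 0 < y₀ := by
    have : 0 ≤ m * l₁ ^ 2 := by positivity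
    linarith
  have hyH : y₀ ≤ Real.log (Real.log H) := by
    have hsf : sFun m = m * L ^ 2 := by rw [sFun, if_neg (by omega), hL]
    rw [hsf] at hs
    have h1 := add_log_le_log_log (by positivity) hs
    have h2 : 0.45 ≤ Real.log L := by
      have h3 : (0.45 : ℝ) ≤ Real.log ((8 : ℕ) / (5 : ℕ)) := by
        have := le_log_div_of_logLo (a := 8) (b := 5) (by norm_num) (by norm_num)
          (q := 0.45) (by decide +kernel)
        norm_num at this ⊢
        exact this
      exact h3.trans (Real.log_le_log (by norm_num) (by norm_num; linarith))
    rw [Real.log_mul hm0.ne' (by positivity), Real.log_pow, ← hL] at h1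
    push_cast at h1
    linarith
  have hC : exponentRate m (m.factorial * Real.exp (-v)) + 0.1 ≤
      ρ * ((1 - e / L ^ 2) * (1 - K / m / L) * (m ^ 2 * L)) := by
    have e1 : (1 - e / L ^ 2) * (1 - K / m / L) * (m ^ 2 * L) =
        (m * L ^ 2 - m * e) * (m * L - K) / L ^ 2 := by
      field_simp
    have e2 : (m * l₁ ^ 2 - E) * (m * l₁ - K₂) ≤ (m * L ^ 2 - m * e) * (m * L - K) :=
      mul_le_mul (by linarith) (by linarith) (sub_nonneg.mpr c4) (by linarith)
    rw [e1, ← mul_div_assoc, le_div_iff₀ (by positivity), hB]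
    have e3 : 0 ≤ m * F - m * v - (m + 1) * K + (m + 1) * L' + 0.1 := by linarith
    have e4 : m * F - m * v - (m + 1) * K + (m + 1) * L' + 0.1 ≤
      m * ((m + 1 / 2) * l₂ - m + 1) - m * v - (m + 1) * K₁ + (m + 1) * l₃ + 0.1 := by
      linarith
    calc _ ≤ _ := mul_le_mul e4 hsq2 (by positivity) (by linarith)
      _ ≤ _ := c5
      _ ≤ _ := mul_le_mul_of_nonneg_left e2 hρ0.le
  have hC0 : 0 ≤ (1 - e / L ^ 2) * (1 - K / m / L) * (m ^ 2 * L) := by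
    have e1 : 0 ≤ ρ * ((1 - e / L ^ 2) * (1 - K / m / L) * (m ^ 2 * L)) := by
      refine le_trans ?_ hC
      rw [hB]
      linarith
    exact nonneg_of_mul_nonneg_right e1 hρ0
  -- the logarithm is replaced by its tangent at `m * a`
  have hlog : Real.log (ρ * y₀) ≤ L + b - 1 + ρ / (m * a) * y₀ := by
    have e1 : ρ * y₀ = m * (a * (ρ / (m * a) * y₀)) := by field_simp
    have e0 : 0 < ρ / (m * a) * y₀ := by positivity
    have e2 := Real.log_le_sub_one_of_pos e0
    rw [e1, Real.log_mul hm0.ne' (by positivity), Real.log_mul ha.ne' e0.ne', ← hL]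
    linarith
  have hmy := mul_le_mul_of_nonneg_left hyl c8
  have hmy2 := mul_le_mul_of_nonneg_left hyl (sub_nonneg.mpr hρ1)
  have := omegaE_le_of_five_le hm (v := v)
    (C := (1 - e / L ^ 2) * (1 - K / m / L) * (m ^ 2 * L)) (ρ := ρ) (y₀ := y₀) hH hv hsum
    (by rw [hd]; linarith) (by rw [hB]; linarith) hρ0 hρ1 (by rw [← hL]; linarith) hyH hC
    (by rw [hd]; linarith) (by linarith) hC0
  rw [← hL, ← hK]
  rwa [mul_div_assoc] at this

/-- A rational lower bound for `logFactorTotal m`. -/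
def logFactorLo (m : ℕ) : ℚ :=
  ∑ p ∈ (Finset.range (m + 1)).filter Nat.Prime, (((m + 1) / p - 1 : ℕ) : ℚ) * (logLo p / (p - 1))

/-- A rational upper bound for `logFactorTotal m`. -/
def logFactorHi (m : ℕ) : ℚ :=
  ∑ p ∈ (Finset.range (m + 1)).filter Nat.Prime, (((m + 1) / p - 1 : ℕ) : ℚ) * (logHi p / (p - 1))

theorem logFactorLo_le (m : ℕ) : (logFactorLo m : ℝ) ≤ logFactorTotal m := by
  rw [logFactorLo, logFactorTotal, Rat.cast_sum]
  refine Finset.sum_le_sum fun p hp => ?_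
  have hp' := (Finset.mem_filter.mp hp).2
  have h1 : (1 : ℝ) < p := by exact_mod_cast hp'.one_lt
  rw [minFloorSum_eq hp'.pos]
  push_cast
  have := logLo_le hp'.one_lt.le
  gcongr

theorem le_logFactorHi (m : ℕ) : logFactorTotal m ≤ (logFactorHi m : ℝ) := by
  rw [logFactorHi, logFactorTotal, Rat.cast_sum]
  refine Finset.sum_le_sum fun p hp => ?_
  have hp' := (Finset.mem_filter.mp hp).2
  have h1 : (1 : ℝ) < p := by exact_mod_cast hp'.one_lt
  rw [minFloorSum_eq hp'.pos]
  push_cast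
  have := le_logHi hp'.one_lt.le
  gcongr

/-- An upper bound for the exponent constant, used to choose the order of approximation. -/
def exponentHi (m : ℕ) (v : ℚ) : ℚ :=
  (m * ((m + 1 / 2) * logHi m - m + 1) - m * v - (m + 1) * logFactorLo m +
    (m + 1) * logHi (m + 1) + 1 / 10) * logHi m ^ 2

/-- A lower bound for the constant to be reached, with `E` a bound for `m` times the numerator in
the second order term. -/
def targetLo (m : ℕ) (E : ℚ) : ℚ := (m * logLo m ^ 2 - E) * (m * logLo m - logFactorHi m)

/-- The rational inequalities that imply the hypotheses of `omegaE_le_of_numerical`, with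
`ρ = exponentHi m v / targetLo m E`. -/
def NumericalConditions (m : ℕ) (v E : ℚ) (a : ℕ) : Prop :=
  8 / 5 ≤ logLo m ∧
  0 ≤ m * logLo m + 1 - m - v - logFactorHi m ∧
  0 ≤ m * (m * logLo m - m) - m * v - (m + 1) * logFactorHi m + (m + 1) * logLo m ∧
  E < m * logLo m ^ 2 ∧ logFactorHi m < m * logLo m ∧
  0 < exponentHi m v ∧ exponentHi m v ≤ targetLo m E ∧
  0 ≤ 1 - exponentHi m v / targetLo m E - exponentHi m v / targetLo m E / (m * a) ∧
  0 ≤ (1 - exponentHi m v / targetLo m E - exponentHi m v / targetLo m E / (m * a)) *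
      (m * logLo m ^ 2 + logLo m + 9 / 10) - (logHi m + logHi a - 1) -
      (1 + ((m + 1 / 2) * logHi m - m + 1) - v - logFactorLo m) - 1 / 100 ∧
  1 ≤ (1 - exponentHi m v / targetLo m E) * (m * logLo m ^ 2 + logLo m + 9 / 10)

instance (m : ℕ) (v E : ℚ) (a : ℕ) : Decidable (NumericalConditions m v E a) :=
  inferInstanceAs (Decidable (_ ∧ _))

theorem omegaE_le_of_numericalConditions {m : ℕ} (hm : 5 ≤ m) {H e : ℝ} {v E : ℚ} {a : ℕ}
    (hH : 1 ≤ H) (hs : sFun m * Real.exp (sFun m) ≤ Real.log H) (hv : (0.85 : ℝ) ≤ v)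
    (hsum : Real.exp (v - 1) ≤ ∑ i ∈ Finset.range m, 1 / ((i : ℝ) + 1))
    (hE : m * e ≤ E) (ha : 1 ≤ a) (h : NumericalConditions m v E a) :
    omegaE m H ≤ ((m + (1 - e / Real.log m ^ 2) * (1 - logFactorTotal m / m / Real.log m) *
      ((m : ℝ) ^ 2 * Real.log m / Real.log (Real.log H)) : ℝ) : EReal) := by
  have hm1 : 1 ≤ m := by omega
  obtain ⟨h0, h1, h2, h3, h4, h5, h6, h7, h8, h9⟩ := h
  have ht : 0 < targetLo m E := mul_pos (sub_pos.mpr h3) (sub_pos.mpr h4)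
  have hL' := le_logHi (n := m + 1) (by omega)
  push_cast at hL'
  refine omegaE_le_of_numerical hm hH hs hv hsum (l₁ := logLo m) (l₂ := logHi m)
    (l₃ := logHi (m + 1)) (K₁ := logFactorLo m) (K₂ := logFactorHi m) (E := E)
    (ρ := (exponentHi m v / targetLo m E : ℚ)) (a := a) (b := logHi a) ?_ (logLo_le hm1)
    (le_logHi hm1) hL' (logFactorLo_le m) (le_logFactorHi m) hE ?_ ?_ ?_ ?_ ?_ ?_ ?_ ?_ (le_logHi ha)
    ?_ ?_ ?_
  · have := (Rat.cast_le (K := ℝ)).mpr h0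
    push_cast at this
    linarith
  · have := (Rat.cast_le (K := ℝ)).mpr h1
    push_cast at this
    linarith
  · have := (Rat.cast_le (K := ℝ)).mpr h2
    push_cast at this
    linarith
  · have := (Rat.cast_lt (K := ℝ)).mpr h3
    push_cast at this
    linarith
  · have := (Rat.cast_lt (K := ℝ)).mpr h4
    push_cast at this
    linarith
  · exact_mod_cast div_pos h5 ht
  · exact_mod_cast (div_le_one ht).mpr h6
  · have e1 : ((targetLo m E : ℚ) : ℝ) =
        (m * (logLo m : ℝ) ^ 2 - E) * (m * logLo m - logFactorHi m) := by
      rw [targetLo]; push_cast; ring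
    have e2 : ((exponentHi m v : ℚ) : ℝ) = (m * ((m + 1 / 2) * (logHi m : ℝ) - m + 1) - m * v -
        (m + 1) * logFactorLo m + (m + 1) * logHi (m + 1) + 0.1) * (logHi m : ℝ) ^ 2 := by
      rw [exponentHi]; push_cast; ring
    have e3 : ((targetLo m E : ℚ) : ℝ) ≠ 0 := by exact_mod_cast ht.ne'
    rw [← e1, ← e2, Rat.cast_div, div_mul_cancel₀ _ e3]
  · exact_mod_cast ha
  · exact_mod_cast h7
  · have := (Rat.cast_le (K := ℝ)).mpr h8
    push_cast at this ⊢
    linarith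
  · have := (Rat.cast_le (K := ℝ)).mpr h9
    push_cast at this ⊢
    linarith

theorem numericalConditions_of_le_fourteen : ∀ m ∈ Finset.Icc 5 14,
    NumericalConditions m 1.82 (2 * logFactorHi m) 3 := by decide +kernel

theorem numericalConditions_of_lt : ∀ m ∈ Finset.Ico 15 128,
    NumericalConditions m 2.19 (m + logFactorHi m) 7 := by decide +kernel

theorem exp_sub_one_le_harmonic {m n a b : ℕ} {v : ℝ} {q : ℚ} (hmn : n ≤ m) (ha : 1 ≤ a)
    (hb : 1 ≤ b) (hn : (a / b : ℚ) ≤ ∑ i ∈ Finset.range n, 1 / ((i : ℚ) + 1))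
    (hv : v - 1 ≤ q) (h : q ≤ logLo a - logHi b) :
    Real.exp (v - 1) ≤ ∑ i ∈ Finset.range m, 1 / ((i : ℝ) + 1) := by
  have h1 : Real.exp (v - 1) ≤ (a : ℝ) / b := by
    rw [← Real.le_log_iff_exp_le (by positivity)]
    exact hv.trans (le_log_div_of_logLo ha hb h)
  have h2 := (Rat.cast_le (K := ℝ)).mpr hn
  push_cast at h2
  refine h1.trans (h2.trans (Finset.sum_le_sum_of_subset_of_nonneg ?_ fun i _ _ => by positivity))
  exact Finset.range_mono hmn

theorem omegaE_le_of_le_fourteen {m : ℕ} (hm : 5 ≤ m) (hm' : m ≤ 14) {H : ℝ} (hH : 1 ≤ H)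
    (hs : sFun m * Real.exp (sFun m) ≤ Real.log H) :
    omegaE m H ≤ ((m + (1 - 2 * (logFactorTotal m / m) / Real.log m ^ 2) *
      (1 - logFactorTotal m / m / Real.log m) *
      ((m : ℝ) ^ 2 * Real.log m / Real.log (Real.log H)) : ℝ) : EReal) := by
  have hm0 : (0 : ℝ) < m := by exact_mod_cast (show 0 < m by omega)
  -- `exp 0.82 < H_5 = 137 / 60`
  refine omegaE_le_of_numericalConditions hm hH hs (v := 1.82) (by norm_num)
    (exp_sub_one_le_harmonic (a := 137) (b := 60) (q := 0.82) hm (by norm_num) (by norm_num)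
      (by decide +kernel) (by norm_num) (by decide +kernel)) ?_ (by norm_num)
    (numericalConditions_of_le_fourteen m (Finset.mem_Icc.mpr ⟨hm, hm'⟩))
  push_cast
  have := le_logFactorHi m
  field_simp
  linarith

theorem omegaE_le_of_lt {m : ℕ} (hm : 15 ≤ m) (hm' : m < 128) {H : ℝ} (hH : 1 ≤ H)
    (hs : sFun m * Real.exp (sFun m) ≤ Real.log H) :
    omegaE m H ≤ ((m + (1 - (1 + logFactorTotal m / m) / Real.log m ^ 2) *
      (1 - logFactorTotal m / m / Real.log m) *
      ((m : ℝ) ^ 2 * Real.log m / Real.log (Real.log H)) : ℝ) : EReal) := by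
  have hm0 : (0 : ℝ) < m := by exact_mod_cast (show 0 < m by omega)
  -- `exp 1.19 < 33 / 10 < H_15`
  refine omegaE_le_of_numericalConditions (by omega) hH hs (v := 2.19) (by norm_num)
    (exp_sub_one_le_harmonic (a := 33) (b := 10) (q := 1.19) hm (by norm_num) (by norm_num)
      (by decide +kernel) (by norm_num) (by decide +kernel)) ?_ (by norm_num)
    (numericalConditions_of_lt m (Finset.mem_Ico.mpr ⟨hm, hm'⟩))
  push_cast
  have := le_logFactorHi m
  field_simp
  linarith

end ModeratelyManyPoints

/-! ### At least `128` points -/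

section ManyPoints

/-- The inequality between `m`, `L = log m` and `k = logFactorTotal m / m` to which the bound for
large `m` reduces. The terms `m L ^ 4` cancel; there remains `m k L ^ 3`, up to lower powers
of `L`, against `1.5 L ^ 5`, and `L ^ 3 ≤ m`. -/
theorem manyPoints_arith {L k m : ℝ} (hL : 4.85 ≤ L) (hk : 0.341 ≤ k) (hk1 : k ≤ 1)
    (hm : L ^ 3 ≤ m) :
    (m * (L - 1 - k) + 2.25 * L + 0.01) * ((L ^ 2 - (1 + k)) * (L - k)) ≤
      L ^ 2 * (m * ((L ^ 2 - (1 + k)) * (L - k)) -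
        (m * (L - 1 - k) + (1.5 * L - 1 - k)) * L ^ 2) := by
  have hL0 : 0 ≤ L := by linarith
  have hG : 0 ≤ k * L ^ 3 + (1 + k) * ((L - k) * (L - 1 - k)) := by
    have h1 : 0 ≤ k * L ^ 3 := mul_nonneg (by linarith) (by positivity)
    have h2 : 0 ≤ (1 + k) * ((L - k) * (L - 1 - k)) :=
      mul_nonneg (by linarith) (mul_nonneg (by linarith) (by linarith))
    linarith
  have h1 : L ^ 3 * (k * L ^ 3 + (1 + k) * ((L - k) * (L - 1 - k))) ≤
      m * (k * L ^ 3 + (1 + k) * ((L - k) * (L - 1 - k))) := mul_le_mul_of_nonneg_right hm hG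
  have h2 : 0.341 * L ^ 3 + 1.341 * ((L - 1) * (L - 2)) ≤
      k * L ^ 3 + (1 + k) * ((L - k) * (L - 1 - k)) := by
    have e1 : 0.341 * L ^ 3 ≤ k * L ^ 3 := mul_le_mul_of_nonneg_right hk (by positivity)
    have e2 : (L - 1) * (L - 2) ≤ (L - k) * (L - 1 - k) :=
      mul_le_mul (by linarith) (by linarith) (by linarith) (by linarith)
    have e3 : 1.341 * ((L - 1) * (L - 2)) ≤ (1 + k) * ((L - k) * (L - 1 - k)) :=
      mul_le_mul (by linarith) e2 (mul_nonneg (by linarith) (by linarith)) (by linarith)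
    linarith
  have hLL : 4.85 * L ≤ L ^ 2 := by linarith [mul_le_mul_of_nonneg_right hL hL0]
  have hLLL : 4.85 * L ^ 2 ≤ L ^ 3 := by
    linarith [mul_le_mul_of_nonneg_right hL (sq_nonneg L)]
  have h3 : 1.5 * L ^ 2 + 0.91 * L + 0.01 ≤ 0.341 * L ^ 3 + 1.341 * ((L - 1) * (L - 2)) := by
    linarith
  have h4 := mul_le_mul_of_nonneg_left (h3.trans h2) (pow_nonneg hL0 3)
  have h5 : (L ^ 2 - (1 + k)) * (L - k) ≤ L ^ 3 := by
    have e1 : (L ^ 2 - (1 + k)) * (L - k) ≤ L ^ 2 * L :=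
      mul_le_mul (by linarith) (by linarith) (by linarith) (sq_nonneg L)
    linarith
  have h6 : (2.25 * L + 0.01) * ((L ^ 2 - (1 + k)) * (L - k)) ≤ (2.25 * L + 0.01) * L ^ 3 :=
    mul_le_mul_of_nonneg_left h5 (by linarith)
  have h7 : 0.341 * L ^ 4 ≤ k * L ^ 4 := mul_le_mul_of_nonneg_right hk (by positivity)
  linarith [pow_nonneg hL0 4]

/-- The contribution of the prime `2`. -/
theorem le_logFactorTotal {m : ℕ} (hm : 1 ≤ m) :
    (m / 2 - 1 : ℝ) * Real.log 2 ≤ logFactorTotal m := by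
  have hterm : ∀ p ∈ (Finset.range (m + 1)).filter Nat.Prime,
      0 ≤ (minFloorSum m p : ℝ) * (Real.log p / ((p : ℝ) - 1)) := fun p hp => by
    have hp' := (Finset.mem_filter.mp hp).2
    have h1 : (1 : ℝ) < p := by exact_mod_cast hp'.one_lt
    have := Real.log_nonneg h1.le
    have : 0 < (p : ℝ) - 1 := by linarith
    positivity
  rcases Nat.lt_or_ge m 2 with h | h
  · have hm1 : m = 1 := by omega
    subst hm1
    have := Real.log_nonneg (show (1 : ℝ) ≤ 2 by norm_num)
    have h0 := Finset.sum_nonneg hterm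
    rw [← logFactorTotal] at h0
    push_cast
    linarith
  · refine le_trans ?_ (Finset.single_le_sum hterm
      (Finset.mem_filter.mpr ⟨Finset.mem_range.mpr (show 2 < m + 1 by omega), Nat.prime_two⟩))
    rw [minFloorSum_eq (by norm_num)]
    have h1 : m ≤ 2 * ((m + 1) / 2 - 1) + 2 := by omega
    have h2 : (m : ℝ) ≤ 2 * ((m + 1) / 2 - 1 : ℕ) + 2 := by exact_mod_cast h1
    have := Real.log_nonneg (show (1 : ℝ) ≤ 2 by norm_num)
    push_cast
    norm_num only [div_one]
    exact mul_le_mul_of_nonneg_right (by linarith) this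

theorem log_pow_three_le {m : ℝ} (hm : 128 ≤ m) : 4.85 ≤ Real.log m ∧ Real.log m ^ 3 ≤ m := by
  have h1 : (4.85 : ℝ) ≤ Real.log m := by
    have e1 := Real.log_two_gt_d9
    have e2 := Real.log_le_log (by norm_num) hm
    rw [show (128 : ℝ) = 2 ^ 7 by norm_num, Real.log_pow] at e2
    push_cast at e2
    linarith
  refine ⟨h1, ?_⟩
  obtain ⟨L, hL⟩ : ∃ L, L = Real.log m := ⟨_, rfl⟩
  rw [← hL] at h1 ⊢
  have h2 : m = Real.exp L := by rw [hL, Real.exp_log (by linarith)]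
  rw [h2, ← Real.log_le_iff_le_exp (by positivity), Real.log_pow]
  have h3 := Real.log_le_sub_one_of_pos (show 0 < L / 4.85 by positivity)
  have h4 : Real.log (4.85 : ℝ) ≤ 1.6 := by
    have := log_div_le_of_logHi (a := 97) (b := 20) (by norm_num) (by norm_num) (q := 1.6)
      (by decide +kernel)
    norm_num at this ⊢
    exact this
  rw [Real.log_div (by linarith) (by norm_num)] at h3
  have h5 : L / 4.85 ≤ 1 + (L - 4.85) / 4.85 := by
    rw [sub_div]
    norm_num
  have h6 : (L - 4.85) / 4.85 ≤ (L - 4.85) / 3 :=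
    div_le_div_of_nonneg_left (by linarith) (by norm_num) (by norm_num)
  push_cast
  linarith

theorem log_le_mul_of_large {L : ℝ} (hL : 4.85 ≤ L) : Real.log L ≤ 0.375 * L := by
  have h1 := Real.log_le_sub_one_of_pos (show 0 < L / Real.exp 1 by positivity)
  rw [Real.log_div (by linarith) (Real.exp_pos 1).ne', Real.log_exp] at h1
  have h2 : L / Real.exp 1 ≤ 0.375 * L := by
    rw [div_le_iff₀ (Real.exp_pos 1)]
    nlinarith [Real.exp_one_gt_d9]
  linarith

theorem omegaE_le_of_large {m : ℕ} (hm : 128 ≤ m) {H : ℝ} (hH : 1 ≤ H)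
    (hK1 : logFactorTotal m ≤ m)
    (hs : sFun m * Real.exp (sFun m) ≤ Real.log H) :
    omegaE m H ≤ ((m + (1 - (1 + logFactorTotal m / m) / Real.log m ^ 2) *
      (1 - logFactorTotal m / m / Real.log m) *
      ((m : ℝ) ^ 2 * Real.log m / Real.log (Real.log H)) : ℝ) : EReal) := by
  have hm128 : (128 : ℝ) ≤ m := by exact_mod_cast hm
  have hm0 : (0 : ℝ) < m := by linarith
  obtain ⟨hL485, hLm⟩ := log_pow_three_le hm128
  obtain ⟨L, hL⟩ : ∃ L, L = Real.log m := ⟨_, rfl⟩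
  obtain ⟨k, hk⟩ : ∃ k, k = logFactorTotal m / m := ⟨_, rfl⟩
  obtain ⟨F, hF⟩ : ∃ F, F = Real.log m.factorial := ⟨_, rfl⟩
  have hkm : logFactorTotal m = m * k := by rw [hk]; field_simp
  have hF1 : m * L - m ≤ F := by
    have := le_log_factorial (n := m) (by omega)
    rw [← hL, ← hF] at this
    linarith
  have hF2 : F ≤ (m + 1 / 2) * L - m + 1 := by
    have := log_factorial_le (n := m) (by omega)
    rw [← hL, ← hF] at this
    linarith
  have hL' : Real.log ((m : ℝ) + 1) ≤ L + 1 / m := by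
    have e1 := Real.log_le_sub_one_of_pos (show (0 : ℝ) < (m + 1) / m by positivity)
    rw [Real.log_div (by positivity) hm0.ne', ← hL] at e1
    have e2 : ((m : ℝ) + 1) / m - 1 = 1 / m := by field_simp; ring
    linarith
  have hLL' : L ≤ Real.log ((m : ℝ) + 1) := by
    rw [hL]
    exact Real.log_le_log hm0 (by linarith)
  obtain ⟨L', hL'def⟩ : ∃ L', L' = Real.log ((m : ℝ) + 1) := ⟨_, rfl⟩
  rw [← hL'def] at hL' hLL'
  rw [← hL] at hL485 hLm
  have hk1 : k ≤ 1 := by rw [hk]; exact (div_le_one hm0).mpr hK1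
  have hk0 : 0.341 ≤ k := by
    rw [hk, le_div_iff₀ hm0]
    refine le_trans ?_ (le_logFactorTotal (m := m) (by omega))
    nlinarith [Real.log_two_gt_d9]
  have harith := manyPoints_arith hL485 hk0 hk1 hLm
  have hL0 : 0 < L := by linarith
  have hd : remainderRate m (m.factorial * Real.exp (-2.19)) = 1 + F - 2.19 - m * k := by
    rw [remainderRate, Real.log_mul (by positivity) (Real.exp_pos _).ne', Real.log_exp, ← hF, hkm]
    ring
  have hB : exponentRate m (m.factorial * Real.exp (-2.19)) =
      m * F - m * 2.19 - (m + 1) * (m * k) + (m + 1) * L' := by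
    rw [exponentRate, hd, Real.log_mul (by positivity) (Real.exp_pos _).ne', Real.log_exp, ← hF,
      ← hL'def]
    ring
  have hmF1 := mul_le_mul_of_nonneg_left hF1 hm0.le
  have hmF2 := mul_le_mul_of_nonneg_left hF2 hm0.le
  have hL23 : 23 * L ≤ m := by
    have e1 : 4.85 ^ 2 ≤ L ^ 2 := pow_le_pow_left₀ (by norm_num) hL485 2
    have e2 := mul_le_mul_of_nonneg_right e1 hL0.le
    linarith
  have hmk : m * k ≤ m := by simpa using mul_le_mul_of_nonneg_left hk1 hm0.le
  have hmk0 : 0 ≤ m * k := by positivity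
  have hmL : 4.85 * m ≤ m * L := by linarith [mul_le_mul_of_nonneg_left hL485 hm0.le]
  have hB1 : exponentRate m (m.factorial * Real.exp (-2.19)) + 0.1 ≤
      m * (m * (L - 1 - k) + (1.5 * L - 1 - k)) := by
    rw [hB]
    have e1 : ((m : ℝ) + 1) * L' ≤ (m + 1) * (L + 1 / m) :=
      mul_le_mul_of_nonneg_left hL' (by linarith)
    have e2 : ((m : ℝ) + 1) * (L + 1 / m) = m * L + L + 1 + 1 / m := by field_simp; ring
    have e3 : 1 / (m : ℝ) ≤ 1 := (div_le_one hm0).mpr (by linarith)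
    linarith
  have hB0 : 0 ≤ exponentRate m (m.factorial * Real.exp (-2.19)) := by
    rw [hB]
    have e1 : 0 ≤ ((m : ℝ) + 1) * L' := mul_nonneg (by linarith) (by linarith)
    have e2 := mul_le_mul_of_nonneg_left hmL hm0.le
    have e3 := mul_le_mul_of_nonneg_left hmk hm0.le
    have e4 := mul_le_mul_of_nonneg_left hm128 hm0.le
    linarith
  have hL2 : 4.85 ^ 2 ≤ L ^ 2 := pow_le_pow_left₀ (by norm_num) hL485 2
  -- `m ^ 2 * D / L ^ 2` is the constant to be reached, and `m * N` is what the method needs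
  obtain ⟨D, hD⟩ : ∃ D, D = (L ^ 2 - (1 + k)) * (L - k) := ⟨_, rfl⟩
  have hD0 : 0 < D := by rw [hD]; exact mul_pos (by linarith) (by linarith)
  obtain ⟨N, hN⟩ : ∃ N, N = m * (L - 1 - k) + (1.5 * L - 1 - k) := ⟨_, rfl⟩
  have hN0 : 0 < N := by
    rw [hN]
    have e1 : 0 < m * (L - 1 - k) := mul_pos hm0 (by linarith)
    linarith
  rw [← hD, ← hN] at harith
  rw [← hN] at hB1
  obtain ⟨ρ, hρ⟩ : ∃ ρ, ρ = N * L ^ 2 / (m * D) := ⟨_, rfl⟩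
  have hρ0 : 0 < ρ := by rw [hρ]; positivity
  have hgain : m * (L - 1 - k) + 2.25 * L + 0.01 ≤ (1 - ρ) * (m * L ^ 2) := by
    have e1 : (1 - ρ) * (m * L ^ 2) = L ^ 2 * (m * D - N * L ^ 2) / D := by
      rw [hρ]; field_simp
    rw [e1, le_div_iff₀ hD0]
    exact harith
  have hmLk : 0 ≤ m * (L - 1 - k) := mul_nonneg hm0.le (by linarith)
  have hρ1 : ρ ≤ 1 := by
    by_contra h
    have e1 : (1 - ρ) * (m * L ^ 2) ≤ 0 :=
      mul_nonpos_of_nonpos_of_nonneg (by linarith) (by positivity)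
    linarith
  have hyH : m * L ^ 2 ≤ Real.log (Real.log H) := by
    have hsf : sFun m = m * L ^ 2 := by rw [sFun, if_neg (by omega), hL]
    rw [hsf] at hs
    have h1 := add_log_le_log_log (by positivity) hs
    have h2 : 0 ≤ Real.log (m * L ^ 2) :=
      Real.log_nonneg (by linarith [mul_le_mul hm128 hL2 (by norm_num) hm0.le])
    linarith
  have hlog : Real.log (ρ * (m * L ^ 2)) ≤ 1.75 * L := by
    have e1 : ρ * (m * L ^ 2) ≤ m * L ^ 2 := mul_le_of_le_one_left (by positivity) hρ1
    have e2 := Real.log_le_log (by positivity) e1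
    rw [Real.log_mul hm0.ne' (by positivity), Real.log_pow, ← hL] at e2
    have e3 := log_le_mul_of_large hL485
    push_cast at e2
    linarith
  have hC : m * N = ρ * ((1 - (1 + k) / L ^ 2) * (1 - k / L) * (m ^ 2 * L)) := by
    have e1 : (1 - (1 + k) / L ^ 2) * (1 - k / L) * (m ^ 2 * L) = m ^ 2 * D / L ^ 2 := by
      rw [hD]; field_simp
    rw [e1, hρ]; field_simp
  have hC0 : 0 ≤ (1 - (1 + k) / L ^ 2) * (1 - k / L) * (m ^ 2 * L) := by
    have e1 : 0 ≤ ρ * ((1 - (1 + k) / L ^ 2) * (1 - k / L) * (m ^ 2 * L)) := by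
      rw [← hC]; positivity
    exact nonneg_of_mul_nonneg_right e1 hρ0
  have := omegaE_le_of_five_le (m := m) (by omega) (v := 2.19)
    (C := (1 - (1 + k) / L ^ 2) * (1 - k / L) * (m ^ 2 * L)) (ρ := ρ) (y₀ := m * L ^ 2) hH
    (by norm_num)
    (exp_sub_one_le_harmonic (n := 15) (a := 33) (b := 10) (q := 1.19) (by omega) (by norm_num)
      (by norm_num) (by decide +kernel) (by norm_num) (by decide +kernel))
    (by rw [hd]; linarith) hB0 hρ0 hρ1 (by rw [hL]) hyH (hB1.trans hC.le)
    (by rw [hd]; linarith) (by linarith) hC0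
  rw [← hL, ← hk]
  rwa [mul_div_assoc] at this

end ManyPoints

/-! ### The limit of `kappa` -/

section KappaLimit

theorem summable_log_prime_div : Summable (fun p : Nat.Primes =>
    Real.log (p : ℕ) / (((p : ℕ) : ℝ) * (((p : ℕ) : ℝ) - 1))) := by
  have h1 : Summable (fun n : ℕ => 4 * (n : ℝ) ^ (-(3 / 2) : ℝ)) :=
    (Real.summable_nat_rpow.mpr (by norm_num)).mul_left 4
  have h2 : Summable (fun p : Nat.Primes => 4 * ((p : ℕ) : ℝ) ^ (-(3 / 2) : ℝ)) :=
    h1.comp_injective Subtype.val_injective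
  refine h2.of_nonneg_of_le (fun p => ?_) (fun p => ?_)
  · have hp : (1 : ℝ) < (p : ℕ) := by exact_mod_cast p.2.one_lt
    exact div_nonneg (Real.log_nonneg hp.le) (mul_nonneg (by linarith) (by linarith))
  · have hp : (2 : ℝ) ≤ (p : ℕ) := by exact_mod_cast p.2.two_le
    have hp0 : (0 : ℝ) < (p : ℕ) := by linarith
    have e1 := Real.log_le_rpow_div hp0.le (show (0 : ℝ) < 1 / 2 by norm_num)
    rw [div_le_iff₀ (mul_pos hp0 (by linarith))]
    have e2 : ((p : ℕ) : ℝ) ^ (-(3 / 2) : ℝ) * (p : ℕ) ^ 2 = ((p : ℕ) : ℝ) ^ (1 / 2 : ℝ) := by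
      rw [← Real.rpow_natCast, ← Real.rpow_add hp0]
      norm_num
    have e3 : 0 ≤ ((p : ℕ) : ℝ) ^ (-(3 / 2) : ℝ) := by positivity
    have e4 : ((p : ℕ) : ℝ) ^ 2 / 2 ≤ (p : ℕ) * ((p : ℕ) - 1) := by nlinarith
    calc Real.log (p : ℕ) ≤ 4 * (((p : ℕ) : ℝ) ^ (-(3 / 2) : ℝ) * ((p : ℕ) ^ 2 / 2)) := by
          rw [← mul_div_assoc, e2]
          linarith
      _ ≤ 4 * (((p : ℕ) : ℝ) ^ (-(3 / 2) : ℝ) * ((p : ℕ) * ((p : ℕ) - 1))) := by gcongr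
      _ = _ := by ring

theorem minFloorSum_eq_zero {m p : ℕ} (hp : 0 < p) (h : m + 1 < 2 * p) : minFloorSum m p = 0 := by
  rw [minFloorSum_eq hp]
  have : (m + 1) / p < 2 := (Nat.div_lt_iff_lt_mul hp).mpr h
  omega

theorem logFactorTotal_div_eq_tsum (m : ℕ) : logFactorTotal m / m =
    ∑' p : Nat.Primes, (minFloorSum m p : ℝ) / m * (Real.log (p : ℕ) / (((p : ℕ) : ℝ) - 1)) := by
  have h := tsum_subtype {p : ℕ | p.Prime}
    (fun p : ℕ => (minFloorSum m p : ℝ) / m * (Real.log p / ((p : ℝ) - 1)))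
  refine Eq.trans ?_ h.symm
  rw [tsum_eq_sum (s := Finset.range (m + 1)), logFactorTotal, Finset.sum_filter, Finset.sum_div]
  · refine Finset.sum_congr rfl fun p _ => ?_
    by_cases hp : p.Prime
    · rw [if_pos hp, Set.indicator_of_mem (by exact hp)]
      ring
    · rw [if_neg hp, Set.indicator_of_notMem (by exact hp), zero_div]
  · intro p hp
    rw [Finset.mem_range] at hp
    by_cases hp' : p.Prime
    · rw [Set.indicator_of_mem (by exact hp'), minFloorSum_eq_zero hp'.pos
        (by have := hp'.two_le; omega)]
      simp
    · rw [Set.indicator_of_notMem (by exact hp')]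

theorem logFactorTotal_term_le {m p : ℕ} (hm : 0 < m) (hp : p.Prime) :
    (minFloorSum m p : ℝ) / m * (Real.log p / ((p : ℝ) - 1)) ≤ Real.log p / ((p : ℝ) * (p - 1)) := by
  have hp1 : (1 : ℝ) < p := by exact_mod_cast hp.one_lt
  have hm0 : (0 : ℝ) < m := by exact_mod_cast hm
  have h1 : (minFloorSum m p : ℝ) / m ≤ 1 / p := by
    rw [div_le_iff₀ hm0]
    refine (minFloorSum_le_div hp.pos m).trans (le_of_eq ?_)
    ring
  have h2 : 0 ≤ Real.log p / ((p : ℝ) - 1) := div_nonneg (Real.log_nonneg hp1.le) (by linarith)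
  refine (mul_le_mul_of_nonneg_right h1 h2).trans (le_of_eq ?_)
  rw [div_mul_div_comm, one_mul]

theorem logFactorTotal_term_nonneg (m : ℕ) {p : ℕ} (hp : p.Prime) :
    0 ≤ (minFloorSum m p : ℝ) / m * (Real.log p / ((p : ℝ) - 1)) := by
  have hp1 : (1 : ℝ) < p := by exact_mod_cast hp.one_lt
  exact mul_nonneg (by positivity) (div_nonneg (Real.log_nonneg hp1.le) (by linarith))

theorem logFactorTotal_div_le {m : ℕ} (hm : 0 < m) : logFactorTotal m / m ≤
    ∑' p : Nat.Primes, Real.log (p : ℕ) / (((p : ℕ) : ℝ) * (((p : ℕ) : ℝ) - 1)) := by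
  rw [logFactorTotal_div_eq_tsum]
  refine Summable.tsum_le_tsum (fun p => logFactorTotal_term_le hm p.2) ?_ summable_log_prime_div
  exact summable_log_prime_div.of_nonneg_of_le (fun p => logFactorTotal_term_nonneg m p.2)
    (fun p => logFactorTotal_term_le hm p.2)

theorem tendsto_minFloorSum_div {p : ℕ} (hp : 0 < p) :
    Filter.Tendsto (fun m : ℕ => (minFloorSum m p : ℝ) / m) Filter.atTop (nhds (1 / p)) := by
  have hp0 : (0 : ℝ) < p := by exact_mod_cast hp
  have h1 : Filter.Tendsto (fun m : ℕ => 1 / (p : ℝ) - 2 / (m : ℝ)) Filter.atTop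
      (nhds (1 / p - 0)) := tendsto_const_nhds.sub (tendsto_const_div_atTop_nhds_zero_nat 2)
  rw [sub_zero] at h1
  refine tendsto_of_tendsto_of_tendsto_of_le_of_le' h1 tendsto_const_nhds ?_ ?_
  · filter_upwards [Filter.eventually_gt_atTop 0] with m hm
    have hm0 : (0 : ℝ) < m := by exact_mod_cast hm
    rw [le_div_iff₀ hm0, sub_mul, div_mul_cancel₀ _ hm0.ne', minFloorSum_eq hp]
    have e1 : m ≤ p * ((m + 1) / p - 1 + 2) := by
      have h2 := Nat.div_add_mod (m + 1) p
      have h3 := Nat.mod_lt (m + 1) hp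
      have h4 : (m + 1) / p + 1 ≤ (m + 1) / p - 1 + 2 := by omega
      have h5 := Nat.mul_le_mul_left p h4
      rw [mul_add] at h5
      omega
    have e2 : (m : ℝ) ≤ p * (((m + 1) / p - 1 : ℕ) + 2) := by exact_mod_cast e1
    have e3 : 1 / (p : ℝ) * m ≤ ((m + 1) / p - 1 : ℕ) + 2 := by
      rw [one_div, inv_mul_le_iff₀ hp0]
      exact e2
    linarith
  · filter_upwards [Filter.eventually_gt_atTop 0] with m hm
    have hm0 : (0 : ℝ) < m := by exact_mod_cast hm
    rw [div_le_iff₀ hm0]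
    refine (minFloorSum_le_div hp m).trans (le_of_eq ?_)
    ring

theorem tendsto_logFactorTotal_div : Filter.Tendsto (fun m : ℕ => logFactorTotal m / m) Filter.atTop
    (nhds (∑' p : Nat.Primes,
      Real.log (p : ℕ) / (((p : ℕ) : ℝ) * (((p : ℕ) : ℝ) - 1)))) := by
  simp_rw [logFactorTotal_div_eq_tsum]
  refine tendsto_tsum_of_dominated_convergence summable_log_prime_div (fun p => ?_) ?_
  · have h := (tendsto_minFloorSum_div p.2.pos).mul_const
      (Real.log (p : ℕ) / (((p : ℕ) : ℝ) - 1))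
    rwa [div_mul_div_comm, one_mul] at h
  · filter_upwards [Filter.eventually_gt_atTop 0] with m hm p
    rw [Real.norm_of_nonneg (logFactorTotal_term_nonneg m p.2)]
    exact logFactorTotal_term_le hm p.2

theorem le_sFun {m : ℕ} (hm : 2 ≤ m) : (m : ℝ) ≤ sFun m := by
  rw [sFun]
  split_ifs with h
  · subst h
    have := Real.exp_one_gt_d9
    push_cast
    linarith
  · have h3 : (3 : ℝ) ≤ m := by exact_mod_cast (show 3 ≤ m by omega)
    have h1 : 1 ≤ Real.log m := by
      rw [Real.le_log_iff_exp_le (by linarith)]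
      linarith [Real.exp_one_lt_d9]
    have h2 : 1 ≤ Real.log m ^ 2 := one_le_pow₀ h1
    nlinarith

theorem wFun_le_one {p : ℕ} (hp : p.Prime) {x : ℝ} (hx : 1 ≤ x) : wFun p x ≤ 1 := by
  have hp1 : (1 : ℝ) < p := by exact_mod_cast hp.one_lt
  have h1 : 0 ≤ (p : ℝ) / x := by positivity
  have h2 : 0 ≤ ((p : ℝ) - 1) / Real.log p * (Real.log x / x) :=
    mul_nonneg (div_nonneg (by linarith) (Real.log_nonneg hp1.le))
      (div_nonneg (Real.log_nonneg hx) (by linarith))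
  rw [wFun]
  linarith

theorem le_wFun {m p : ℕ} (hm : 2 ≤ m) (hp : p.Prime) (hpm : p ≤ m) :
    1 - 4 * (m * Real.exp (-m)) ≤ wFun p (sFun m * Real.exp (sFun m)) := by
  have hp1 : (2 : ℝ) ≤ p := by exact_mod_cast hp.two_le
  have hpm' : (p : ℝ) ≤ m := by exact_mod_cast hpm
  obtain ⟨s, hs⟩ : ∃ s, s = sFun m := ⟨_, rfl⟩
  have hms := le_sFun hm
  rw [← hs] at hms ⊢
  have hs1 : 1 ≤ s := by linarith
  have hs0 : 0 < s := by linarith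
  have hlog2 := Real.log_two_gt_d9
  have hlogp : Real.log 2 ≤ Real.log p := Real.log_le_log (by norm_num) hp1
  have he : Real.exp (-s) ≤ Real.exp (-m) := Real.exp_le_exp.mpr (by linarith)
  have h1 : (p : ℝ) / (s * Real.exp s) ≤ m * Real.exp (-s) := by
    rw [Real.exp_neg, ← div_eq_mul_inv]
    exact div_le_div₀ (by linarith) hpm' (Real.exp_pos s)
      (le_mul_of_one_le_left (Real.exp_pos s).le hs1)
  have h2 : Real.log (s * Real.exp s) / (s * Real.exp s) ≤ 2 * Real.exp (-s) := by
    rw [Real.log_mul hs0.ne' (Real.exp_pos s).ne', Real.log_exp, div_le_iff₀ (by positivity)]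
    have e1 : 2 * Real.exp (-s) * (s * Real.exp s) = 2 * s := by
      rw [Real.exp_neg]; field_simp
    rw [e1]
    linarith [Real.log_le_sub_one_of_pos hs0]
  have h3 : ((p : ℝ) - 1) / Real.log p ≤ m / 0.69 :=
    div_le_div₀ (by linarith) (by linarith) (by norm_num) (by linarith)
  have h4 : 0 ≤ Real.log (s * Real.exp s) / (s * Real.exp s) := by
    have e1 : 1 ≤ s * Real.exp s := by
      nlinarith [Real.one_le_exp hs0.le]
    exact div_nonneg (Real.log_nonneg e1) (by linarith)
  have h5 := mul_le_mul h3 h2 h4 (by positivity)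
  have h6 : (m : ℝ) / 0.69 * (2 * Real.exp (-s)) ≤ 3 * (m * Real.exp (-s)) := by
    have : 0 ≤ m * Real.exp (-s) := by positivity
    have e2 : (m : ℝ) / 0.69 * (2 * Real.exp (-s)) = (2 / 0.69) * (m * Real.exp (-s)) := by ring
    rw [e2]
    exact mul_le_mul_of_nonneg_right (by norm_num) this
  have h7 : (m : ℝ) * Real.exp (-s) ≤ m * Real.exp (-m) :=
    mul_le_mul_of_nonneg_left he (by positivity)
  rw [wFun]
  linarith

theorem kappa_eq {m : ℕ} (hm : 1 ≤ m) : kappa m =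
    (∑ p ∈ (Finset.range (m + 1)).filter Nat.Prime, (minFloorSum m p : ℝ) *
      (Real.log p / ((p : ℝ) - 1)) * wFun p (sFun m * Real.exp (sFun m))) / m := by
  rw [kappa, one_div_mul_eq_div]
  congr 1
  refine Finset.sum_subset (fun p hp => ?_) (fun p hp hp' => ?_)
  · rw [Finset.mem_filter, Finset.mem_range] at hp ⊢
    exact ⟨by omega, hp.2.1⟩
  · rw [Finset.mem_filter, Finset.mem_range] at hp hp'
    have h2 : m + 1 < 2 * p := by
      by_contra h
      exact hp' ⟨by omega, hp.2, by omega⟩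
    rw [minFloorSum_eq_zero hp.2.pos h2]
    simp

theorem kappa_le {m : ℕ} (hm : 2 ≤ m) : kappa m ≤ logFactorTotal m / m := by
  rw [kappa_eq (by omega), logFactorTotal]
  refine div_le_div_of_nonneg_right (Finset.sum_le_sum fun p hp => ?_) (by positivity)
  have hp' := (Finset.mem_filter.mp hp).2
  have hp1 : (1 : ℝ) < p := by exact_mod_cast hp'.one_lt
  refine mul_le_of_le_one_right (mul_nonneg (by positivity)
    (div_nonneg (Real.log_nonneg hp1.le) (by linarith))) (wFun_le_one hp' ?_)
  have h1 := le_sFun hm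
  have h2 : (2 : ℝ) ≤ m := by exact_mod_cast hm
  nlinarith [Real.one_le_exp (show 0 ≤ sFun m by linarith)]

theorem le_kappa {m : ℕ} (hm : 2 ≤ m) :
    logFactorTotal m / m * (1 - 4 * (m * Real.exp (-m))) ≤ kappa m := by
  rw [kappa_eq (by omega), logFactorTotal, div_mul_eq_mul_div, Finset.sum_mul]
  refine div_le_div_of_nonneg_right (Finset.sum_le_sum fun p hp => ?_) (by positivity)
  obtain ⟨hpm, hp'⟩ := Finset.mem_filter.mp hp
  have hp1 : (1 : ℝ) < p := by exact_mod_cast hp'.one_lt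
  refine mul_le_mul_of_nonneg_left (le_wFun hm hp' ?_) (mul_nonneg (by positivity)
    (div_nonneg (Real.log_nonneg hp1.le) (by linarith)))
  rw [Finset.mem_range] at hpm
  omega

theorem tendsto_kappa : Filter.Tendsto kappa Filter.atTop (nhds (∑' p : Nat.Primes,
    Real.log (p : ℕ) / (((p : ℕ) : ℝ) * (((p : ℕ) : ℝ) - 1)))) := by
  have h1 : Filter.Tendsto (fun m : ℕ => (m : ℝ) * Real.exp (-m)) Filter.atTop (nhds 0) := by
    have := (Real.tendsto_pow_mul_exp_neg_atTop_nhds_zero 1).comp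
      (tendsto_natCast_atTop_atTop (R := ℝ))
    simpa [Function.comp_def] using this
  have h2 := tendsto_logFactorTotal_div.mul ((tendsto_const_nhds (x := (1 : ℝ))).sub
    (h1.const_mul 4))
  rw [mul_zero, sub_zero, mul_one] at h2
  refine tendsto_of_tendsto_of_tendsto_of_le_of_le' h2 tendsto_logFactorTotal_div ?_ ?_
  · filter_upwards [Filter.eventually_ge_atTop 2] with m hm using le_kappa hm
  · filter_upwards [Filter.eventually_ge_atTop 2] with m hm using kappa_le hm

end KappaLimit

/-! ### Euler–Maclaurin summation -/

section EulerMaclaurin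

/-- The Euler–Maclaurin formula of order four on one unit interval, with the remainder
`∫ f⁗(x + t) t² (1 - t)² / 24` estimated by `0 ≤ t² (1 - t)² / 24 ≤ 1 / 384`. Here `F` is an
antiderivative of `f₀`, and `f₁`, …, `f₄` are its derivatives. -/
theorem eulerMaclaurin_step {F f₀ f₁ f₂ f₃ f₄ : ℝ → ℝ} {x : ℝ}
    (hF : ∀ y, x ≤ y → HasDerivAt F (f₀ y) y) (h₀ : ∀ y, x ≤ y → HasDerivAt f₀ (f₁ y) y)
    (h₁ : ∀ y, x ≤ y → HasDerivAt f₁ (f₂ y) y) (h₂ : ∀ y, x ≤ y → HasDerivAt f₂ (f₃ y) y)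
    (h₃ : ∀ y, x ≤ y → HasDerivAt f₃ (f₄ y) y) (h₄ : ∀ y, x ≤ y → 0 ≤ f₄ y) :
    0 ≤ F (x + 1) - F x - (f₀ (x + 1) + f₀ x) / 2 + (f₁ (x + 1) - f₁ x) / 12 ∧
    F (x + 1) - F x - (f₀ (x + 1) + f₀ x) / 2 + (f₁ (x + 1) - f₁ x) / 12 ≤
      (f₃ (x + 1) - f₃ x) / 384 := by
  obtain ⟨Φ, hΦ⟩ : ∃ Φ : ℝ → ℝ, Φ = fun t =>
      (t ^ 2 - 2 * t ^ 3 + t ^ 4) / 24 * f₃ (x + t) - (2 * t - 6 * t ^ 2 + 4 * t ^ 3) / 24 * f₂ (x + t)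
        + (2 - 12 * t + 12 * t ^ 2) / 24 * f₁ (x + t) - (-12 + 24 * t) / 24 * f₀ (x + t)
        + F (x + t) := ⟨_, rfl⟩
  have hshift : ∀ {g g' : ℝ → ℝ}, (∀ y, x ≤ y → HasDerivAt g (g' y) y) → ∀ t, 0 ≤ t →
      HasDerivAt (fun t => g (x + t)) (g' (x + t)) t := fun hg t ht =>
    (hg (x + t) (by linarith)).comp_const_add x t
  have hder : ∀ t, 0 ≤ t →
      HasDerivAt Φ ((t ^ 2 - 2 * t ^ 3 + t ^ 4) / 24 * f₄ (x + t)) t := by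
    intro t ht
    have p1 : HasDerivAt (fun t : ℝ => (t ^ 2 - 2 * t ^ 3 + t ^ 4) / 24)
        ((2 * t - 6 * t ^ 2 + 4 * t ^ 3) / 24) t := by
      have := ((((hasDerivAt_id t).pow 2).sub (((hasDerivAt_id t).pow 3).const_mul 2)).add
        ((hasDerivAt_id t).pow 4)).div_const 24
      refine this.congr_deriv ?_
      simp
      ring
    have p2 : HasDerivAt (fun t : ℝ => (2 * t - 6 * t ^ 2 + 4 * t ^ 3) / 24)
        ((2 - 12 * t + 12 * t ^ 2) / 24) t := by
      have := ((((hasDerivAt_id t).const_mul 2).sub (((hasDerivAt_id t).pow 2).const_mul 6)).add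
        (((hasDerivAt_id t).pow 3).const_mul 4)).div_const 24
      refine this.congr_deriv ?_
      simp
      ring
    have p3 : HasDerivAt (fun t : ℝ => (2 - 12 * t + 12 * t ^ 2) / 24)
        ((-12 + 24 * t) / 24) t := by
      have := ((((hasDerivAt_id t).const_mul 12).const_sub 2).add
        (((hasDerivAt_id t).pow 2).const_mul 12)).div_const 24
      refine this.congr_deriv ?_
      simp
      ring
    have p4 : HasDerivAt (fun t : ℝ => (-12 + 24 * t) / 24) 1 t := by
      have := (((hasDerivAt_id t).const_mul 24).const_add (-12)).div_const 24
      refine this.congr_deriv ?_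
      norm_num
    rw [hΦ]
    refine (((((p1.mul (hshift h₃ t ht)).sub (p2.mul (hshift h₂ t ht))).add
      (p3.mul (hshift h₁ t ht))).sub (p4.mul (hshift h₀ t ht))).add
      (hshift hF t ht)).congr_deriv ?_
    ring
  have hint : ∀ t ∈ interior (Set.Icc (0 : ℝ) 1), 0 ≤ t := fun t ht =>
    (interior_subset ht).1
  constructor
  · have hmono : MonotoneOn Φ (Set.Icc 0 1) := by
      refine monotoneOn_of_deriv_nonneg (convex_Icc 0 1)
        (fun t ht => (hder t ht.1).continuousAt.continuousWithinAt)
        (fun t ht => (hder t (hint t ht)).differentiableAt.differentiableWithinAt) fun t ht => ?_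
      rw [(hder t (hint t ht)).deriv]
      refine mul_nonneg ?_ (h₄ _ (by linarith [hint t ht]))
      have : t ^ 2 - 2 * t ^ 3 + t ^ 4 = (t * (1 - t)) ^ 2 := by ring
      rw [this]
      positivity
    have := hmono (Set.left_mem_Icc.mpr zero_le_one) (Set.right_mem_Icc.mpr zero_le_one)
      zero_le_one
    simp only [hΦ] at this
    norm_num at this
    linarith
  · have hder' : ∀ t, 0 ≤ t → HasDerivAt (fun t => Φ t - f₃ (x + t) / 384)
        ((t ^ 2 - 2 * t ^ 3 + t ^ 4) / 24 * f₄ (x + t) - f₄ (x + t) / 384) t := fun t ht =>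
      (hder t ht).sub ((hshift h₃ t ht).div_const 384)
    have hanti : AntitoneOn (fun t => Φ t - f₃ (x + t) / 384) (Set.Icc 0 1) := by
      refine antitoneOn_of_deriv_nonpos (convex_Icc 0 1)
        (fun t ht => (hder' t ht.1).continuousAt.continuousWithinAt)
        (fun t ht => (hder' t (hint t ht)).differentiableAt.differentiableWithinAt) fun t ht => ?_
      rw [(hder' t (hint t ht)).deriv]
      have e1 := h₄ (x + t) (by linarith [hint t ht])
      obtain ⟨t0, t1⟩ := interior_subset ht
      have e2 : (t ^ 2 - 2 * t ^ 3 + t ^ 4) / 24 ≤ 1 / 384 := by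
        have e3 : t * (1 - t) ≤ 1 / 4 := by nlinarith [sq_nonneg (t - 1 / 2)]
        have e4 : (t * (1 - t)) ^ 2 ≤ (1 / 4) ^ 2 :=
          pow_le_pow_left₀ (mul_nonneg t0 (by linarith)) e3 2
        linarith
      linarith [mul_le_mul_of_nonneg_right e2 e1]
    have := hanti (Set.left_mem_Icc.mpr zero_le_one) (Set.right_mem_Icc.mpr zero_le_one)
      zero_le_one
    simp only [hΦ] at this
    norm_num at this
    linarith

/-- Summation of the Euler–Maclaurin formula over `[N, ∞)`. -/
theorem eulerMaclaurin_tsum {F f₀ f₁ f₂ f₃ f₄ : ℝ → ℝ} {N : ℕ}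
    (hF : ∀ y, (N : ℝ) ≤ y → HasDerivAt F (f₀ y) y)
    (h₀ : ∀ y, (N : ℝ) ≤ y → HasDerivAt f₀ (f₁ y) y)
    (h₁ : ∀ y, (N : ℝ) ≤ y → HasDerivAt f₁ (f₂ y) y)
    (h₂ : ∀ y, (N : ℝ) ≤ y → HasDerivAt f₂ (f₃ y) y)
    (h₃ : ∀ y, (N : ℝ) ≤ y → HasDerivAt f₃ (f₄ y) y) (h₄ : ∀ y, (N : ℝ) ≤ y → 0 ≤ f₄ y)
    (lF : Filter.Tendsto F Filter.atTop (nhds 0)) (l₀ : Filter.Tendsto f₀ Filter.atTop (nhds 0))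
    (l₁ : Filter.Tendsto f₁ Filter.atTop (nhds 0)) (l₃ : Filter.Tendsto f₃ Filter.atTop (nhds 0))
    (hs : Summable fun n : ℕ => f₀ n) :
    -F N + f₀ N / 2 - f₁ N / 12 + f₃ N / 384 ≤ ∑' n : ℕ, f₀ ((n + N : ℕ) : ℝ) ∧
    ∑' n : ℕ, f₀ ((n + N : ℕ) : ℝ) ≤ -F N + f₀ N / 2 - f₁ N / 12 := by
  obtain ⟨G, hG⟩ : ∃ G : ℝ → ℝ, G = fun x => -F x + f₀ x / 2 - f₁ x / 12 := ⟨_, rfl⟩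
  have hbounds : ∀ M : ℕ, G N - G ((M + N : ℕ) : ℝ) - (f₃ ((M + N : ℕ) : ℝ) - f₃ N) / 384 ≤
      ∑ n ∈ Finset.range M, f₀ ((n + N : ℕ) : ℝ) ∧
      ∑ n ∈ Finset.range M, f₀ ((n + N : ℕ) : ℝ) ≤ G N - G ((M + N : ℕ) : ℝ) := by
    intro M
    induction M with
    | zero => simp
    | succ M ih =>
      have hle : ∀ y : ℝ, ((M + N : ℕ) : ℝ) ≤ y → (N : ℝ) ≤ y := fun y hy => by
        refine le_trans ?_ hy
        exact_mod_cast Nat.le_add_left N M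
      obtain ⟨e1, e2⟩ := eulerMaclaurin_step (x := ((M + N : ℕ) : ℝ)) (fun y hy => hF y (hle y hy))
        (fun y hy => h₀ y (hle y hy)) (fun y hy => h₁ y (hle y hy)) (fun y hy => h₂ y (hle y hy))
        (fun y hy => h₃ y (hle y hy)) (fun y hy => h₄ y (hle y hy))
      have e3 : ((M + 1 + N : ℕ) : ℝ) = ((M + N : ℕ) : ℝ) + 1 := by push_cast; ring
      rw [Finset.sum_range_succ, e3]
      simp only [hG] at ih ⊢
      constructor <;> linarith [ih.1, ih.2]
  have hsN : Summable fun n : ℕ => f₀ ((n + N : ℕ) : ℝ) :=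
    (summable_nat_add_iff (f := fun n : ℕ => f₀ (n : ℝ)) N).mpr hs
  have hlim := hsN.hasSum.tendsto_sum_nat
  have hcast : Filter.Tendsto (fun M : ℕ => ((M + N : ℕ) : ℝ)) Filter.atTop Filter.atTop :=
    tendsto_natCast_atTop_atTop.comp (Filter.tendsto_add_atTop_nat N)
  have lG : Filter.Tendsto G Filter.atTop (nhds 0) := by
    rw [hG]
    simpa using (lF.neg.add (l₀.div_const 2)).sub (l₁.div_const 12)
  have lim1 : Filter.Tendsto (fun M : ℕ => G N - G ((M + N : ℕ) : ℝ)) Filter.atTop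
      (nhds (G N - 0)) := tendsto_const_nhds.sub (lG.comp hcast)
  have lim2 : Filter.Tendsto (fun M : ℕ => G N - G ((M + N : ℕ) : ℝ) -
      (f₃ ((M + N : ℕ) : ℝ) - f₃ N) / 384) Filter.atTop (nhds (G N - 0 - (0 - f₃ N) / 384)) :=
    lim1.sub (((l₃.comp hcast).sub tendsto_const_nhds).div_const 384)
  have b1 := le_of_tendsto_of_tendsto' lim2 hlim fun M => (hbounds M).1
  have b2 := le_of_tendsto_of_tendsto' hlim lim1 fun M => (hbounds M).2
  simp only [hG] at b1 b2
  constructor <;> linarith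

theorem hasDerivAt_log_div_pow (k : ℕ) (a b : ℝ) {x : ℝ} (hx : 0 < x) :
    HasDerivAt (fun x => (a * Real.log x + b) / x ^ k)
      ((-k * a * Real.log x + (a - k * b)) / x ^ (k + 1)) x := by
  have h1 : HasDerivAt (fun x => a * Real.log x + b) (a * x⁻¹) x :=
    ((Real.hasDerivAt_log hx.ne').const_mul a).add_const b
  refine (h1.div (hasDerivAt_pow k x) (by positivity)).congr_deriv ?_
  rcases k with _ | k
  · simp
    field_simp
  · rw [Nat.add_sub_cancel]
    field_simp
    push_cast
    ring

theorem tendsto_log_div_pow {k : ℕ} (hk : 1 ≤ k) (a b : ℝ) :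
    Filter.Tendsto (fun x : ℝ => (a * Real.log x + b) / x ^ k) Filter.atTop (nhds 0) := by
  have h1 : Filter.Tendsto (fun x : ℝ => Real.log x / x ^ k) Filter.atTop (nhds 0) := by
    have := isLittleO_log_rpow_atTop (show (0 : ℝ) < k by exact_mod_cast hk)
    simpa only [Real.rpow_natCast] using this.tendsto_div_nhds_zero
  have h2 : Filter.Tendsto (fun x : ℝ => 1 / x ^ k) Filter.atTop (nhds 0) := by
    simp_rw [one_div]
    exact (Filter.tendsto_pow_atTop (by omega)).inv_tendsto_atTop
  have := (h1.const_mul a).add (h2.const_mul b)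
  rw [mul_zero, mul_zero, add_zero] at this
  refine this.congr fun x => ?_
  ring

theorem summable_log_div_pow {k : ℕ} (hk : 2 ≤ k) (a b : ℝ) :
    Summable fun n : ℕ => (a * Real.log n + b) / (n : ℝ) ^ k := by
  have h1 : Summable fun n : ℕ => Real.log n / (n : ℝ) ^ k := by
    refine ((Real.summable_nat_rpow (p := (-(3 / 2) : ℝ))).mpr (by norm_num) |>.mul_left
      2).of_nonneg_of_le (fun n => div_nonneg (Real.log_natCast_nonneg n) (by positivity))
      fun n => ?_
    rcases Nat.eq_zero_or_pos n with rfl | hn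
    · simp only [CharP.cast_eq_zero, Real.log_zero, zero_div]
      positivity
    · have hn0 : (0 : ℝ) < n := by exact_mod_cast hn
      have hn1 : (1 : ℝ) ≤ n := by exact_mod_cast hn
      have e1 := Real.log_le_rpow_div hn0.le (show (0 : ℝ) < 1 / 2 by norm_num)
      have e2 : (n : ℝ) ^ (-(3 / 2) : ℝ) * (n : ℝ) ^ 2 = (n : ℝ) ^ (1 / 2 : ℝ) := by
        rw [← Real.rpow_natCast, ← Real.rpow_add hn0]
        norm_num
      have e3 : (n : ℝ) ^ 2 ≤ (n : ℝ) ^ k := pow_le_pow_right₀ hn1 hk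
      rw [div_le_iff₀ (by positivity)]
      calc Real.log n ≤ 2 * ((n : ℝ) ^ (-(3 / 2) : ℝ) * (n : ℝ) ^ 2) := by rw [e2]; linarith
        _ ≤ 2 * ((n : ℝ) ^ (-(3 / 2) : ℝ) * (n : ℝ) ^ k) := by gcongr
        _ = _ := by ring
  have h2 : Summable fun n : ℕ => 1 / (n : ℝ) ^ k :=
    Real.summable_one_div_nat_pow.mpr (by omega)
  refine ((h1.mul_left a).add (h2.mul_left b)).congr fun n => ?_
  ring

/-- The Euler–Maclaurin value of `∑_{n ≥ N} (a log n + b) / n ^ k`, where `l` stands for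
`log N`: the integral plus two correction terms. -/
def tailValue {K : Type} [Field K] (k : ℕ) (a b l : K) (N : ℕ) : K :=
  (a / (k - 1) * l + (a / (k - 1) + b) / (k - 1)) / (N : K) ^ (k - 1) +
    (a * l + b) / (2 * (N : K) ^ k) - (-k * a * l + (a - k * b)) / (12 * (N : K) ^ (k + 1))

/-- The error bound that goes with `tailValue`, from the third derivative. -/
def tailError {K : Type} [Field K] (k : ℕ) (a b l : K) (N : ℕ) : K :=
  ((k + 2) * (k + 1) * k * a * l + ((k + 2) * (k + 1) * k * b -
    ((k + 1) * k + (k + 2) * k + (k + 2) * (k + 1)) * a)) / (384 * (N : K) ^ (k + 3))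

theorem tsum_log_div_pow_bounds {k N : ℕ} (hk : 2 ≤ k) (hN : 1 ≤ N) {a b : ℝ} (ha : 0 ≤ a)
    (h : 0 ≤ (k + 3) * (k + 2) * (k + 1) * k * (a * Real.log N + b) - ((k + 2) * (k + 1) * k +
      (k + 3) * ((k + 1) * k + (k + 2) * k + (k + 2) * (k + 1))) * a) :
    tailValue k a b (Real.log N) N - tailError k a b (Real.log N) N ≤
      ∑' n : ℕ, (a * Real.log ((n + N : ℕ) : ℝ) + b) / ((n + N : ℕ) : ℝ) ^ k ∧
    ∑' n : ℕ, (a * Real.log ((n + N : ℕ) : ℝ) + b) / ((n + N : ℕ) : ℝ) ^ k ≤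
      tailValue k a b (Real.log N) N := by
  obtain ⟨j, rfl⟩ : ∃ j, k = j + 2 := ⟨k - 2, by omega⟩
  have hN0 : (0 : ℝ) < N := by exact_mod_cast hN
  have hj : (0 : ℝ) < (j : ℝ) + 1 := by positivity
  push_cast at h
  have d := fun (k : ℕ) (a b : ℝ) (y : ℝ) (hy : (N : ℝ) ≤ y) =>
    hasDerivAt_log_div_pow k a b (hN0.trans_le hy)
  obtain ⟨b1, b2⟩ := eulerMaclaurin_tsum (N := N)
    (F := fun x => (-a / (j + 1) * Real.log x + (-a / (j + 1) - b) / (j + 1)) / x ^ (j + 1))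
    (f₀ := fun x => (a * Real.log x + b) / x ^ (j + 2)) (fun y hy => (d _ _ _ y hy).congr_deriv
      (by push_cast; field_simp; ring)) (fun y hy => d _ _ _ y hy) (fun y hy => d _ _ _ y hy)
    (fun y hy => d _ _ _ y hy) (fun y hy => d _ _ _ y hy) (fun y hy => by
      have hl := Real.log_le_log hN0 hy
      refine div_nonneg ?_ (pow_nonneg (hN0.trans_le hy).le _)
      have hmul := mul_le_mul_of_nonneg_left hl
        (show 0 ≤ ((j : ℝ) + 2 + 3) * (j + 2 + 2) * (j + 2 + 1) * (j + 2) * a by positivity)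
      push_cast
      linarith)
    (tendsto_log_div_pow (by omega) _ _) (tendsto_log_div_pow (by omega) _ _)
    (tendsto_log_div_pow (by omega) _ _) (tendsto_log_div_pow (by omega) _ _)
    (summable_log_div_pow hk a b)
  have hj1 : j + 2 - 1 = j + 1 := rfl
  have hj2 : ((j + 2 : ℕ) : ℝ) - 1 = j + 1 := by push_cast; ring
  have v1 : tailValue (j + 2) a b (Real.log N) N =
      -((-a / (j + 1) * Real.log N + (-a / (j + 1) - b) / (j + 1)) / (N : ℝ) ^ (j + 1)) +
      (a * Real.log N + b) / (N : ℝ) ^ (j + 2) / 2 -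
      (-((j + 2 : ℕ) : ℝ) * a * Real.log N + (a - ((j + 2 : ℕ) : ℝ) * b)) /
        (N : ℝ) ^ (j + 2 + 1) / 12 := by
    rw [tailValue, hj1, hj2]
    ring
  refine ⟨le_trans (le_of_eq ?_) b1, b2.trans_eq v1.symm⟩
  rw [v1, tailError]
  push_cast
  ring

end EulerMaclaurin

/-! ### Sums over primes from sums over all integers -/

section PrimeSums

open ArithmeticFunction in
theorem tsum_vonMangoldt_mul_tsum {k : ℕ} (hk : 2 ≤ k) :
    (∑' n : ℕ, vonMangoldt n / (n : ℝ) ^ k) * ∑' n : ℕ, 1 / (n : ℝ) ^ k =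
      ∑' n : ℕ, Real.log n / (n : ℝ) ^ k := by
  have hk1 : 1 < ((k : ℂ)).re := by
    rw [Complex.natCast_re]
    exact_mod_cast hk
  have hL : ∀ g : ℕ → ℝ, LSeries (fun n => (g n : ℂ)) k =
      ((∑' n : ℕ, g n / (n : ℝ) ^ k : ℝ) : ℂ) := by
    intro g
    rw [LSeries, Complex.ofReal_tsum]
    refine tsum_congr fun n => ?_
    rw [LSeries.term_def]
    split_ifs with h
    · subst h
      rw [Nat.cast_zero, zero_pow (by omega), div_zero, Complex.ofReal_zero]
    · rw [Complex.cpow_natCast]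
      push_cast
      rfl
  have h1 := LSeries_convolution' (LSeriesSummable_vonMangoldt hk1)
    (LSeriesSummable_one_iff.mpr hk1)
  rw [convolution_vonMangoldt_const_one, hL,
    show (1 : ℕ → ℂ) = fun n => ((fun _ => 1 : ℕ → ℝ) n : ℂ) by ext; simp, hL] at h1
  have h2 : (fun n : ℕ => Complex.log n) = fun n : ℕ => ((Real.log n : ℝ) : ℂ) := by
    ext n
    rw [Complex.natCast_log]
  rw [h2, hL] at h1
  exact_mod_cast h1.symm

open ArithmeticFunction in
theorem summable_vonMangoldt_div_pow {k : ℕ} (hk : 2 ≤ k) :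
    Summable fun n : ℕ => vonMangoldt n / (n : ℝ) ^ k := by
  have h := summable_log_div_pow hk 1 0
  simp only [one_mul, add_zero] at h
  exact h.of_nonneg_of_le (fun n => div_nonneg vonMangoldt_nonneg (by positivity)) fun n =>
    div_le_div_of_nonneg_right vonMangoldt_le_log (by positivity)

/-- The sum `∑ log p / (p ^ k - 1)` over the primes is minus the logarithmic derivative of the zeta
function at `k`, a quotient of two sums over all integers. -/
theorem tsum_primes_eq_div {k : ℕ} (hk : 2 ≤ k) :
    ∑' p : Nat.Primes, Real.log (p : ℕ) / (((p : ℕ) : ℝ) ^ k - 1) =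
      (∑' n : ℕ, Real.log n / (n : ℝ) ^ k) / ∑' n : ℕ, 1 / (n : ℝ) ^ k := by
  have hz : 0 < ∑' n : ℕ, 1 / (n : ℝ) ^ k := by
    refine (Real.summable_one_div_nat_pow.mpr (by omega)).tsum_pos (fun n => by positivity) 1 ?_
    simp
  rw [eq_div_iff hz.ne', ← tsum_vonMangoldt_mul_tsum hk]
  congr 1
  rw [tsum_eq_tsum_primes_of_support_subset_prime_powers (summable_vonMangoldt_div_pow hk)]
  · refine tsum_congr fun p => ?_
    have hp : (1 : ℝ) < (p : ℕ) := by exact_mod_cast p.2.one_lt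
    have hpk : (1 : ℝ) < ((p : ℕ) : ℝ) ^ k := one_lt_pow₀ hp (by omega)
    have hr : (((p : ℕ) : ℝ) ^ k)⁻¹ < 1 := inv_lt_one_of_one_lt₀ hpk
    have hterm : ∀ j : ℕ, ArithmeticFunction.vonMangoldt ((p : ℕ) ^ (j + 1)) /
        (((p : ℕ) ^ (j + 1) : ℕ) : ℝ) ^ k =
        Real.log (p : ℕ) * (((p : ℕ) : ℝ) ^ k)⁻¹ * ((((p : ℕ) : ℝ) ^ k)⁻¹) ^ j := fun j => by
      rw [ArithmeticFunction.vonMangoldt_apply_pow (by omega),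
        ArithmeticFunction.vonMangoldt_apply_prime p.2]
      push_cast
      rw [← pow_mul, mul_comm (j + 1) k, pow_mul, pow_succ, div_eq_mul_inv, mul_inv, inv_pow]
      ring
    simp_rw [hterm]
    rw [tsum_mul_left, tsum_geometric_of_lt_one (by positivity) hr]
    have : ((p : ℕ) : ℝ) ^ k - 1 ≠ 0 := by linarith
    field_simp
  · intro n hn
    rw [Function.mem_support] at hn
    have : ArithmeticFunction.vonMangoldt n ≠ 0 := fun h => hn (by rw [h, zero_div])
    exact ArithmeticFunction.vonMangoldt_ne_zero_iff.mp this

theorem summable_primes_div {k : ℕ} (hk : 2 ≤ k) :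
    Summable fun p : Nat.Primes => Real.log (p : ℕ) / (((p : ℕ) : ℝ) ^ k - 1) := by
  refine summable_log_prime_div.of_nonneg_of_le (fun p => ?_) (fun p => ?_)
  · have hp : (1 : ℝ) < (p : ℕ) := by exact_mod_cast p.2.one_lt
    exact div_nonneg (Real.log_nonneg hp.le) (by linarith [one_le_pow₀ hp.le (n := k)])
  · have hp : (2 : ℝ) ≤ (p : ℕ) := by exact_mod_cast p.2.two_le
    have h2 : ((p : ℕ) : ℝ) ^ 2 ≤ ((p : ℕ) : ℝ) ^ k := pow_le_pow_right₀ (by linarith) hk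
    refine div_le_div_of_nonneg_left (Real.log_nonneg (by linarith))
      (mul_pos (by linarith) (by linarith)) ?_
    nlinarith

end PrimeSums

/-! ### The numerical value of the limit -/

section KappaValue

theorem cast_tailValue (k : ℕ) (a b l : ℚ) (N : ℕ) :
    ((tailValue k a b l N : ℚ) : ℝ) = tailValue k (a : ℝ) (b : ℝ) (l : ℝ) N := by
  simp only [tailValue]
  push_cast
  rfl

theorem cast_tailError (k : ℕ) (a b l : ℚ) (N : ℕ) :
    ((tailError k a b l N : ℚ) : ℝ) = tailError k (a : ℝ) (b : ℝ) (l : ℝ) N := by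
  simp only [tailError]
  push_cast
  rfl

theorem tailValue_mono {k N : ℕ} (hk : 2 ≤ k) {l l' : ℝ} (h : l ≤ l') :
    tailValue k (1 : ℝ) 0 l N ≤ tailValue k (1 : ℝ) 0 l' N := by
  have hk1 : (0 : ℝ) ≤ (k : ℝ) - 1 := by
    have : (2 : ℝ) ≤ k := by exact_mod_cast hk
    linarith
  have e1 : tailValue k (1 : ℝ) 0 l' N - tailValue k (1 : ℝ) 0 l N =
      (1 / ((k : ℝ) - 1) / (N : ℝ) ^ (k - 1) + 1 / (2 * (N : ℝ) ^ k) +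
        k / (12 * (N : ℝ) ^ (k + 1))) * (l' - l) := by
    rw [tailValue, tailValue]
    ring
  have e2 := mul_nonneg (show 0 ≤ 1 / ((k : ℝ) - 1) / (N : ℝ) ^ (k - 1) + 1 / (2 * (N : ℝ) ^ k) +
    k / (12 * (N : ℝ) ^ (k + 1)) by positivity) (sub_nonneg.mpr h)
  linarith

theorem tailError_mono {k N : ℕ} {l l' : ℝ} (h : l ≤ l') :
    tailError k (1 : ℝ) 0 l N ≤ tailError k (1 : ℝ) 0 l' N := by
  simp only [tailError]
  gcongr

theorem sum_add_tailValue_le {k N : ℕ} (hk : 2 ≤ k) (hN : 1 ≤ N) :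
    ∑ n ∈ Finset.range N, 1 / (n : ℝ) ^ k + (tailValue k 0 1 0 N - tailError k 0 1 0 N) ≤
      ∑' n : ℕ, 1 / (n : ℝ) ^ k ∧
    ∑' n : ℕ, 1 / (n : ℝ) ^ k ≤ ∑ n ∈ Finset.range N, 1 / (n : ℝ) ^ k + tailValue k 0 1 0 N := by
  obtain ⟨h1, h2⟩ := tsum_log_div_pow_bounds hk hN (a := 0) (b := 1) le_rfl
    (by rw [zero_mul, zero_add, mul_zero, sub_zero, mul_one]; positivity)
  have e : ∀ l, tailValue k (0 : ℝ) 1 l N = tailValue k 0 1 0 N := fun l => by simp [tailValue]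
  have e' : ∀ l, tailError k (0 : ℝ) 1 l N = tailError k 0 1 0 N := fun l => by simp [tailError]
  rw [e, e'] at h1
  rw [e] at h2
  simp only [zero_mul, zero_add] at h1 h2
  have hs : Summable fun n : ℕ => 1 / (n : ℝ) ^ k := Real.summable_one_div_nat_pow.mpr (by omega)
  have h3 := hs.sum_add_tsum_nat_add N
  constructor <;> linarith

theorem logSum_add_tailValue_le {k N : ℕ} (hk : 2 ≤ k) (hN : 1 ≤ N) {l l' : ℝ} (hl2 : 2 ≤ l)
    (hl : l ≤ Real.log N) (hl' : Real.log N ≤ l') :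
    ∑ n ∈ Finset.range N, Real.log n / (n : ℝ) ^ k +
      (tailValue k 1 0 l N - tailError k 1 0 l' N) ≤ ∑' n : ℕ, Real.log n / (n : ℝ) ^ k ∧
    ∑' n : ℕ, Real.log n / (n : ℝ) ^ k ≤
      ∑ n ∈ Finset.range N, Real.log n / (n : ℝ) ^ k + tailValue k 1 0 l' N := by
  obtain ⟨h1, h2⟩ := tsum_log_div_pow_bounds hk hN (a := 1) (b := 0) zero_le_one (by
    obtain ⟨j, rfl⟩ : ∃ j, k = j + 2 := ⟨k - 2, by omega⟩
    have e1 : (0 : ℝ) ≤ j := by positivity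
    have e2 : ((j : ℝ) + 2 + 3) * (j + 2 + 2) * (j + 2 + 1) * (j + 2) * 2 ≤
      (j + 2 + 3) * (j + 2 + 2) * (j + 2 + 1) * (j + 2) * Real.log N :=
      mul_le_mul_of_nonneg_left (hl2.trans hl) (by positivity)
    push_cast
    nlinarith [mul_nonneg e1 e1, mul_nonneg e1 (mul_nonneg e1 e1),
      mul_nonneg (mul_nonneg e1 e1) (mul_nonneg e1 e1)])
  simp only [one_mul, add_zero] at h1 h2
  have hs := summable_log_div_pow hk 1 0
  simp only [one_mul, add_zero] at hs
  have h3 := hs.sum_add_tsum_nat_add N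
  have h4 := tailValue_mono (N := N) hk hl
  have h5 := tailValue_mono (N := N) hk hl'
  have h6 := tailError_mono (k := k) (N := N) hl'
  constructor <;> linarith

/-- A rational lower bound for `∑ 1 / n ^ k`. -/
def zetaLo (k N : ℕ) : ℚ :=
  ∑ n ∈ Finset.range N, 1 / (n : ℚ) ^ k + (tailValue k 0 1 0 N - tailError k 0 1 0 N)

/-- A rational upper bound for `∑ 1 / n ^ k`. -/
def zetaHi (k N : ℕ) : ℚ := ∑ n ∈ Finset.range N, 1 / (n : ℚ) ^ k + tailValue k 0 1 0 N

/-- A rational lower bound for `∑ log n / n ^ k`. -/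
def logSumLo (k N : ℕ) : ℚ :=
  ∑ n ∈ Finset.range N, logLo n / (n : ℚ) ^ k +
    (tailValue k 1 0 (logLo N) N - tailError k 1 0 (logHi N) N)

/-- A rational upper bound for `∑ log n / n ^ k`. -/
def logSumHi (k N : ℕ) : ℚ :=
  ∑ n ∈ Finset.range N, logHi n / (n : ℚ) ^ k + tailValue k 1 0 (logHi N) N

theorem zeta_bounds {k N : ℕ} (hk : 2 ≤ k) (hN : 1 ≤ N) :
    (zetaLo k N : ℝ) ≤ ∑' n : ℕ, 1 / (n : ℝ) ^ k ∧
      ∑' n : ℕ, 1 / (n : ℝ) ^ k ≤ (zetaHi k N : ℝ) := by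
  have h := sum_add_tailValue_le hk hN
  rw [zetaLo, zetaHi]
  push_cast [cast_tailValue, cast_tailError]
  exact h

theorem logSum_bounds {k N : ℕ} (hk : 2 ≤ k) (hN : 1 ≤ N) (hl : 2 ≤ logLo N) :
    (logSumLo k N : ℝ) ≤ ∑' n : ℕ, Real.log n / (n : ℝ) ^ k ∧
      ∑' n : ℕ, Real.log n / (n : ℝ) ^ k ≤ (logSumHi k N : ℝ) := by
  obtain ⟨h1, h2⟩ := logSum_add_tailValue_le hk hN (l := logLo N) (l' := logHi N)
    (by exact_mod_cast hl) (logLo_le hN) (le_logHi hN)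
  have hterm : ∀ n : ℕ, (logLo n : ℝ) / (n : ℝ) ^ k ≤ Real.log n / (n : ℝ) ^ k ∧
      Real.log n / (n : ℝ) ^ k ≤ (logHi n : ℝ) / (n : ℝ) ^ k := fun n => by
    rcases Nat.eq_zero_or_pos n with rfl | hn
    · rw [Nat.cast_zero, zero_pow (by omega)]
      simp
    · exact ⟨div_le_div_of_nonneg_right (logLo_le hn) (by positivity),
        div_le_div_of_nonneg_right (le_logHi hn) (by positivity)⟩
  have h3 := Finset.sum_le_sum fun n (_ : n ∈ Finset.range N) => (hterm n).1
  have h4 := Finset.sum_le_sum fun n (_ : n ∈ Finset.range N) => (hterm n).2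
  rw [logSumLo, logSumHi]
  push_cast [cast_tailValue, cast_tailError]
  constructor <;> linarith

theorem tsum_primes_bounds {k N : ℕ} (hk : 2 ≤ k) (hN : 1 ≤ N) (hl : 2 ≤ logLo N) {u v : ℚ}
    (hu0 : 0 ≤ u) (hz : 0 < zetaLo k N) (hu : u * zetaHi k N ≤ logSumLo k N)
    (hv : logSumHi k N ≤ v * zetaLo k N) :
    (u : ℝ) ≤ ∑' p : Nat.Primes, Real.log (p : ℕ) / (((p : ℕ) : ℝ) ^ k - 1) ∧
      ∑' p : Nat.Primes, Real.log (p : ℕ) / (((p : ℕ) : ℝ) ^ k - 1) ≤ v := by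
  obtain ⟨z1, z2⟩ := zeta_bounds hk hN
  obtain ⟨d1, d2⟩ := logSum_bounds hk hN hl
  have hz' : (0 : ℝ) < zetaLo k N := by exact_mod_cast hz
  have hz0 := hz'.trans_le z1
  have hu' : (u : ℝ) * zetaHi k N ≤ logSumLo k N := by exact_mod_cast hu
  have hv' : (logSumHi k N : ℝ) ≤ v * zetaLo k N := by exact_mod_cast hv
  have hu0' : (0 : ℝ) ≤ u := by exact_mod_cast hu0
  rw [tsum_primes_eq_div hk]
  constructor
  · rw [le_div_iff₀ hz0]
    linarith [mul_le_mul_of_nonneg_left z2 hu0']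
  · rw [div_le_iff₀ hz0]
    have hv0 : (0 : ℝ) ≤ v := by
      by_contra h
      have e1 := mul_neg_of_neg_of_pos (not_le.mp h) hz'
      have e2 : 0 ≤ ∑' n : ℕ, Real.log n / (n : ℝ) ^ k := tsum_nonneg fun n =>
        div_nonneg (Real.log_natCast_nonneg n) (by positivity)
      linarith
    linarith [mul_le_mul_of_nonneg_left z1 hv0]

/-- What remains of `1 / (p (p - 1)) = ∑_{j ≥ 2} p ^ (-j)` after subtracting the combination of
`1 / (p ^ k - 1)` with `k = 2, 3, 5, 6, 7` that agrees with it up to the order `p ^ (-10)`. -/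
def geometricDefect {K : Type} [Field K] (p : K) : K :=
  1 / (p * (p - 1)) - 1 / (p ^ 2 - 1) - 1 / (p ^ 3 - 1) - 1 / (p ^ 5 - 1) + 1 / (p ^ 6 - 1) -
    1 / (p ^ 7 - 1)

theorem abs_geometricDefect_le {p : ℝ} (hp : 30 ≤ p) : |geometricDefect p| ≤ 3 / p ^ 10 := by
  obtain ⟨x, hx⟩ : ∃ x, x = 1 / p := ⟨_, rfl⟩
  have hp0 : 0 < p := by linarith
  have hx0 : 0 < x := by rw [hx]; positivity
  have hx1 : x ≤ 1 / 30 := by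
    rw [hx]
    exact one_div_le_one_div_of_le (by norm_num) hp
  have hg : ∀ k : ℕ, 1 ≤ k → ∃ g : ℝ, 1 / (p ^ k - 1) = g ∧ g = x ^ k + x ^ k * g ∧ 0 ≤ g ∧
      g ≤ 30 / 29 * x ^ k := fun k hk => by
    have h1 : 30 ≤ p ^ k := hp.trans (le_self_pow₀ (by linarith) (by omega))
    refine ⟨_, rfl, ?_, div_nonneg zero_le_one (by linarith), ?_⟩
    · have : p ^ k - 1 ≠ 0 := by linarith
      rw [hx, div_pow, one_pow]
      field_simp
      ring
    · rw [hx, div_pow, one_pow, div_le_iff₀ (by linarith)]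
      field_simp
      linarith
  obtain ⟨g₁, e₁, f₁, p₁, q₁⟩ := hg 1 (by norm_num)
  obtain ⟨g₂, e₂, f₂, p₂, q₂⟩ := hg 2 (by norm_num)
  obtain ⟨g₃, e₃, f₃, p₃, q₃⟩ := hg 3 (by norm_num)
  obtain ⟨g₅, e₅, f₅, p₅, q₅⟩ := hg 5 (by norm_num)
  obtain ⟨g₆, e₆, f₆, p₆, q₆⟩ := hg 6 (by norm_num)
  obtain ⟨g₇, e₇, f₇, p₇, q₇⟩ := hg 7 (by norm_num)
  have e₀ : 1 / (p * (p - 1)) = x * g₁ := by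
    have : p - 1 ≠ 0 := by linarith
    rw [← e₁, hx]
    field_simp
  have e₁₀ : 3 / p ^ 10 = 3 * x ^ 10 := by
    rw [hx, div_pow, one_pow]
    ring
  rw [geometricDefect, e₀, e₂, e₃, e₅, e₆, e₇, e₁₀]
  rw [pow_one] at f₁ q₁
  -- all terms up to the order `x ^ 9` cancel
  have key : x * g₁ - g₂ - g₃ - g₅ + g₆ - g₇ =
      x ^ 8 * (x * g₁ - g₂) - x ^ 9 * g₃ - x ^ 5 * g₅ + x ^ 6 * g₆ - x ^ 7 * g₇ := by
    have t1 : x * g₁ = x ^ 2 + x ^ 3 + x ^ 4 + x ^ 5 + x ^ 6 + x ^ 7 + x ^ 8 + x ^ 9 +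
        x ^ 9 * g₁ := by
      have s1 : x * g₁ = x * (x + x * g₁) := congrArg _ f₁
      have s2 : x ^ 2 * g₁ = x ^ 2 * (x + x * g₁) := congrArg _ f₁
      have s3 : x ^ 3 * g₁ = x ^ 3 * (x + x * g₁) := congrArg _ f₁
      have s4 : x ^ 4 * g₁ = x ^ 4 * (x + x * g₁) := congrArg _ f₁
      have s5 : x ^ 5 * g₁ = x ^ 5 * (x + x * g₁) := congrArg _ f₁
      have s6 : x ^ 6 * g₁ = x ^ 6 * (x + x * g₁) := congrArg _ f₁
      have s7 : x ^ 7 * g₁ = x ^ 7 * (x + x * g₁) := congrArg _ f₁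
      have s8 : x ^ 8 * g₁ = x ^ 8 * (x + x * g₁) := congrArg _ f₁
      linarith
    have t2 : g₂ = x ^ 2 + x ^ 4 + x ^ 6 + x ^ 8 + x ^ 8 * g₂ := by
      have s2 : x ^ 2 * g₂ = x ^ 2 * (x ^ 2 + x ^ 2 * g₂) := congrArg _ f₂
      have s4 : x ^ 4 * g₂ = x ^ 4 * (x ^ 2 + x ^ 2 * g₂) := congrArg _ f₂
      have s6 : x ^ 6 * g₂ = x ^ 6 * (x ^ 2 + x ^ 2 * g₂) := congrArg _ f₂
      linarith
    have t3 : g₃ = x ^ 3 + x ^ 6 + x ^ 9 + x ^ 9 * g₃ := by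
      have s3 : x ^ 3 * g₃ = x ^ 3 * (x ^ 3 + x ^ 3 * g₃) := congrArg _ f₃
      have s6 : x ^ 6 * g₃ = x ^ 6 * (x ^ 3 + x ^ 3 * g₃) := congrArg _ f₃
      linarith
    linarith
  have pw : ∀ n : ℕ, 0 ≤ x ^ n := fun n => by positivity
  have x11 : x ^ 12 ≤ x ^ 10 * (1 / 30) := by
    have : x ^ 2 ≤ 1 / 30 := by nlinarith
    calc x ^ 12 = x ^ 10 * x ^ 2 := by ring
      _ ≤ _ := mul_le_mul_of_nonneg_left this (pw 10)
  have x14 : x ^ 14 ≤ x ^ 10 * (1 / 30) := by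
    have : x ^ 4 ≤ 1 / 30 := by
      calc x ^ 4 ≤ (1 / 30) ^ 4 := pow_le_pow_left₀ hx0.le hx1 4
        _ ≤ _ := by norm_num
    calc x ^ 14 = x ^ 10 * x ^ 4 := by ring
      _ ≤ _ := mul_le_mul_of_nonneg_left this (pw 10)
  have m1 := mul_le_mul_of_nonneg_left q₁ (pw 9)
  have m2 := mul_le_mul_of_nonneg_left q₂ (pw 8)
  have m3 := mul_le_mul_of_nonneg_left q₃ (pw 9)
  have m5 := mul_le_mul_of_nonneg_left q₅ (pw 5)
  have m6 := mul_le_mul_of_nonneg_left q₆ (pw 6)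
  have m7 := mul_le_mul_of_nonneg_left q₇ (pw 7)
  have n1 := mul_nonneg (pw 9) p₁
  have n2 := mul_nonneg (pw 8) p₂
  have n3 := mul_nonneg (pw 9) p₃
  have n5 := mul_nonneg (pw 5) p₅
  have n6 := mul_nonneg (pw 6) p₆
  have n7 := mul_nonneg (pw 7) p₇
  rw [key, abs_le]
  have z := pw 10
  constructor <;> linarith

theorem abs_geometricDefect_mul_log_le {n : ℕ} (hn : 30 ≤ n) :
    |geometricDefect (n : ℝ) * Real.log n| ≤ 3 * (1 / (n : ℝ) ^ 9) := by
  have h30 : (30 : ℝ) ≤ n := by exact_mod_cast hn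
  have h1 := abs_geometricDefect_le h30
  have h2 : Real.log n ≤ n := (Real.log_le_sub_one_of_pos (by linarith)).trans (by linarith)
  rw [abs_mul, abs_of_nonneg (Real.log_natCast_nonneg n)]
  calc _ ≤ 3 / (n : ℝ) ^ 10 * n :=
        mul_le_mul h1 h2 (Real.log_natCast_nonneg n) (by positivity)
    _ = _ := by field_simp

/-- The primes below `30` account for the sum of the defects, up to an explicit error. -/
theorem abs_tsum_defect_sub_le :
    |∑' p : Nat.Primes, geometricDefect ((p : ℕ) : ℝ) * Real.log (p : ℕ) -
      ∑ p ∈ (Finset.range 30).filter Nat.Prime, geometricDefect (p : ℝ) * Real.log p| ≤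
      3 * (tailValue 9 0 1 0 30 : ℚ) := by
  obtain ⟨g, hg⟩ : ∃ g : ℕ → ℝ, g = Set.indicator {p : ℕ | p.Prime}
    (fun p : ℕ => geometricDefect (p : ℝ) * Real.log p) := ⟨_, rfl⟩
  have hts : ∑' p : Nat.Primes, geometricDefect ((p : ℕ) : ℝ) * Real.log (p : ℕ) = ∑' n, g n := by
    rw [hg]
    exact tsum_subtype {p : ℕ | p.Prime} (fun p : ℕ => geometricDefect (p : ℝ) * Real.log p)
  have hfin : ∑ p ∈ (Finset.range 30).filter Nat.Prime, geometricDefect (p : ℝ) * Real.log p =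
      ∑ n ∈ Finset.range 30, g n := by
    rw [Finset.sum_filter, hg]
    refine Finset.sum_congr rfl fun n _ => ?_
    by_cases hn : n.Prime
    · rw [if_pos hn, Set.indicator_of_mem (by exact hn)]
    · rw [if_neg hn, Set.indicator_of_notMem (by exact hn)]
  have hbound : ∀ n : ℕ, ‖g (n + 30)‖ ≤ 3 * (1 / ((n + 30 : ℕ) : ℝ) ^ 9) := fun n => by
    rw [hg, Real.norm_eq_abs]
    by_cases hn : (n + 30).Prime
    · rw [Set.indicator_of_mem (by exact hn)]
      exact abs_geometricDefect_mul_log_le (by omega)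
    · rw [Set.indicator_of_notMem (by exact hn), abs_zero]
      positivity
  have hs9 : Summable fun n : ℕ => 1 / (n : ℝ) ^ 9 := Real.summable_one_div_nat_pow.mpr (by norm_num)
  have hs9' : Summable fun n : ℕ => 3 * (1 / ((n + 30 : ℕ) : ℝ) ^ 9) :=
    ((summable_nat_add_iff (f := fun n : ℕ => 1 / (n : ℝ) ^ 9) 30).mpr hs9).mul_left 3
  have hsg : Summable g := (summable_nat_add_iff (f := g) 30).mp
    (Summable.of_norm_bounded hs9' hbound)
  rw [hts, hfin, ← hsg.sum_add_tsum_nat_add 30, add_sub_cancel_left, ← Real.norm_eq_abs]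
  refine (tsum_of_norm_bounded hs9'.hasSum hbound).trans ?_
  rw [tsum_mul_left]
  have h1 := (sum_add_tailValue_le (k := 9) (N := 30) (by norm_num) (by norm_num)).2
  rw [← hs9.sum_add_tsum_nat_add 30] at h1
  rw [cast_tailValue]
  push_cast
  push_cast at h1
  linarith

/-- A rational lower bound for `∑ c_p log p` over the primes below `30`. -/
def defectSumLo : ℚ := ∑ p ∈ (Finset.range 30).filter Nat.Prime,
  min (geometricDefect (p : ℚ) * logLo p) (geometricDefect (p : ℚ) * logHi p)

/-- A rational upper bound for `∑ c_p log p` over the primes below `30`. -/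
def defectSumHi : ℚ := ∑ p ∈ (Finset.range 30).filter Nat.Prime,
  max (geometricDefect (p : ℚ) * logLo p) (geometricDefect (p : ℚ) * logHi p)

theorem defectSum_bounds :
    (defectSumLo : ℝ) ≤
      ∑ p ∈ (Finset.range 30).filter Nat.Prime, geometricDefect (p : ℝ) * Real.log p ∧
    ∑ p ∈ (Finset.range 30).filter Nat.Prime, geometricDefect (p : ℝ) * Real.log p ≤
      (defectSumHi : ℝ) := by
  have hcast : ∀ p : ℕ, ((geometricDefect (p : ℚ) : ℚ) : ℝ) = geometricDefect (p : ℝ) := fun p => by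
    simp only [geometricDefect]
    push_cast
    rfl
  rw [defectSumLo, defectSumHi]
  push_cast [hcast]
  constructor <;> refine Finset.sum_le_sum fun p hp => ?_
  · have hp' := (Finset.mem_filter.mp hp).2
    rcases le_total 0 (geometricDefect (p : ℝ)) with h | h
    · exact (min_le_left _ _).trans (mul_le_mul_of_nonneg_left (logLo_le hp'.one_lt.le) h)
    · exact (min_le_right _ _).trans (mul_le_mul_of_nonpos_left (le_logHi hp'.one_lt.le) h)
  · have hp' := (Finset.mem_filter.mp hp).2
    rcases le_total 0 (geometricDefect (p : ℝ)) with h | h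
    · exact (mul_le_mul_of_nonneg_left (le_logHi hp'.one_lt.le) h).trans (le_max_right _ _)
    · exact (mul_le_mul_of_nonpos_left (logLo_le hp'.one_lt.le) h).trans (le_max_left _ _)

theorem tsum_log_prime_eq :
    ∑' p : Nat.Primes, Real.log (p : ℕ) / (((p : ℕ) : ℝ) * (((p : ℕ) : ℝ) - 1)) =
      ∑' p : Nat.Primes, Real.log (p : ℕ) / (((p : ℕ) : ℝ) ^ 2 - 1) +
      ∑' p : Nat.Primes, Real.log (p : ℕ) / (((p : ℕ) : ℝ) ^ 3 - 1) +
      ∑' p : Nat.Primes, Real.log (p : ℕ) / (((p : ℕ) : ℝ) ^ 5 - 1) -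
      ∑' p : Nat.Primes, Real.log (p : ℕ) / (((p : ℕ) : ℝ) ^ 6 - 1) +
      ∑' p : Nat.Primes, Real.log (p : ℕ) / (((p : ℕ) : ℝ) ^ 7 - 1) +
      ∑' p : Nat.Primes, geometricDefect ((p : ℕ) : ℝ) * Real.log (p : ℕ) := by
  have s1 := summable_log_prime_div
  have s2 := summable_primes_div (k := 2) (by norm_num)
  have s3 := summable_primes_div (k := 3) (by norm_num)
  have s5 := summable_primes_div (k := 5) (by norm_num)
  have s6 := summable_primes_div (k := 6) (by norm_num)
  have s7 := summable_primes_div (k := 7) (by norm_num)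
  have h := ((((s1.hasSum.sub s2.hasSum).sub s3.hasSum).sub s5.hasSum).add s6.hasSum).sub s7.hasSum
  have h' : ∑' p : Nat.Primes, geometricDefect ((p : ℕ) : ℝ) * Real.log (p : ℕ) = _ :=
    (tsum_congr fun p => by rw [geometricDefect]; ring).trans h.tsum_eq
  rw [h']
  ring

end KappaValue

section KappaDigits

theorem tsum_primes_bounds_two :
    ((0.56996099309443 : ℚ) : ℝ) ≤ ∑' p : Nat.Primes, Real.log (p : ℕ) / (((p : ℕ) : ℝ) ^ 2 - 1) ∧
      ∑' p : Nat.Primes, Real.log (p : ℕ) / (((p : ℕ) : ℝ) ^ 2 - 1) ≤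
        ((0.56996099309459 : ℚ) : ℝ) :=
  tsum_primes_bounds (N := 300) (by norm_num) (by norm_num) (by decide +kernel) (by norm_num)
    (by decide +kernel) (by decide +kernel) (by decide +kernel)

theorem tsum_primes_bounds_three :
    ((0.16482268215827 : ℚ) : ℝ) ≤ ∑' p : Nat.Primes, Real.log (p : ℕ) / (((p : ℕ) : ℝ) ^ 3 - 1) ∧
      ∑' p : Nat.Primes, Real.log (p : ℕ) / (((p : ℕ) : ℝ) ^ 3 - 1) ≤
        ((0.16482268215829 : ℚ) : ℝ) :=
  tsum_primes_bounds (N := 300) (by norm_num) (by norm_num) (by decide +kernel) (by norm_num)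
    (by decide +kernel) (by decide +kernel) (by decide +kernel)

theorem tsum_primes_bounds_five :
    ((0.02755619219153 : ℚ) : ℝ) ≤ ∑' p : Nat.Primes, Real.log (p : ℕ) / (((p : ℕ) : ℝ) ^ 5 - 1) ∧
      ∑' p : Nat.Primes, Real.log (p : ℕ) / (((p : ℕ) : ℝ) ^ 5 - 1) ≤
        ((0.02755619219154 : ℚ) : ℝ) :=
  tsum_primes_bounds (N := 100) (by norm_num) (by norm_num) (by decide +kernel) (by norm_num)
    (by decide +kernel) (by decide +kernel) (by decide +kernel)

theorem tsum_primes_bounds_six :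
    ((0.01263306903251 : ℚ) : ℝ) ≤ ∑' p : Nat.Primes, Real.log (p : ℕ) / (((p : ℕ) : ℝ) ^ 6 - 1) ∧
      ∑' p : Nat.Primes, Real.log (p : ℕ) / (((p : ℕ) : ℝ) ^ 6 - 1) ≤
        ((0.01263306903252 : ℚ) : ℝ) :=
  tsum_primes_bounds (N := 100) (by norm_num) (by norm_num) (by decide +kernel) (by norm_num)
    (by decide +kernel) (by decide +kernel) (by decide +kernel)

theorem tsum_primes_bounds_seven :
    ((0.00598355857063 : ℚ) : ℝ) ≤ ∑' p : Nat.Primes, Real.log (p : ℕ) / (((p : ℕ) : ℝ) ^ 7 - 1) ∧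
      ∑' p : Nat.Primes, Real.log (p : ℕ) / (((p : ℕ) : ℝ) ^ 7 - 1) ≤
        ((0.00598355857064 : ℚ) : ℝ) :=
  tsum_primes_bounds (N := 100) (by norm_num) (by norm_num) (by decide +kernel) (by norm_num)
    (by decide +kernel) (by decide +kernel) (by decide +kernel)

theorem tsum_log_prime_bounds :
    0.75536661083 ≤
      ∑' p : Nat.Primes, Real.log (p : ℕ) / (((p : ℕ) : ℝ) * (((p : ℕ) : ℝ) - 1)) ∧
    ∑' p : Nat.Primes, Real.log (p : ℕ) / (((p : ℕ) : ℝ) * (((p : ℕ) : ℝ) - 1)) <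
      0.75536661084 := by
  obtain ⟨a2, b2⟩ := tsum_primes_bounds_two
  obtain ⟨a3, b3⟩ := tsum_primes_bounds_three
  obtain ⟨a5, b5⟩ := tsum_primes_bounds_five
  obtain ⟨a6, b6⟩ := tsum_primes_bounds_six
  obtain ⟨a7, b7⟩ := tsum_primes_bounds_seven
  obtain ⟨c1, c2⟩ := defectSum_bounds
  have h1 : ((-0.00032374615078 : ℚ) : ℝ) ≤ (defectSumLo : ℝ) :=
    Rat.cast_le.mpr (by decide +kernel)
  have h2 : (defectSumHi : ℝ) ≤ ((-0.00032374615077 : ℚ) : ℝ) :=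
    Rat.cast_le.mpr (by decide +kernel)
  have h3 : ((tailValue 9 0 1 0 30 : ℚ) : ℝ) ≤ ((0.00000000000022 : ℚ) : ℝ) :=
    Rat.cast_le.mpr (by decide +kernel)
  obtain ⟨d1, d2⟩ := abs_le.mp abs_tsum_defect_sub_le
  rw [tsum_log_prime_eq]
  norm_num at a2 b2 a3 b3 a5 b5 a6 b6 a7 b7 h1 h2 h3
  constructor <;> norm_num <;> linarith

end KappaDigits

/-! ### The transcendence measure -/

section TranscendenceMeasure

theorem logFactorTotal_div_le_one {m : ℕ} (hm : 0 < m) : logFactorTotal m / m ≤ 0.76 :=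
  (logFactorTotal_div_le hm).trans (tsum_log_prime_bounds.2.le.trans (by norm_num))

/-- The bounds for `ω(m, H)` decrease in the prime sum, so the weights `w_p ≤ 1` in `kappa` only
weaken them. -/
theorem exponent_bound_antitone {L k k' e e' C : ℝ} (hL : 1.6 ≤ L) (hk : k' ≤ k) (hk1 : k ≤ 0.76)
    (he : e' ≤ e) (he1 : e ≤ L ^ 2) (hC : 0 ≤ C) :
    (1 - e / L ^ 2) * (1 - k / L) * C ≤ (1 - e' / L ^ 2) * (1 - k' / L) * C := by
  have hL0 : 0 < L := by linarith
  have h1 : 1 - e / L ^ 2 ≤ 1 - e' / L ^ 2 :=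
    sub_le_sub_left (div_le_div_of_nonneg_right he (by positivity)) 1
  have h2 : 1 - k / L ≤ 1 - k' / L :=
    sub_le_sub_left (div_le_div_of_nonneg_right hk hL0.le) 1
  have h3 : 0 ≤ 1 - e / L ^ 2 := sub_nonneg.mpr ((div_le_one (by positivity)).mpr he1)
  have h4 : 0 ≤ 1 - k / L := sub_nonneg.mpr ((div_le_one hL0).mpr (by linarith))
  exact mul_le_mul_of_nonneg_right (mul_le_mul h1 h2 h4 (h3.trans h1)) hC

theorem theorem1p1 :
    (∀ (m : ℕ) (H : ℝ), 2 ≤ m → 1 ≤ H →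
      sFun m * Real.exp (sFun m) ≤ Real.log H →
        (m = 2 → omegaE m H ≤ ((2 + 4.93 / Real.log (Real.log H) : ℝ) : EReal)) ∧
        (m = 3 → omegaE m H ≤ ((3 + 6.49 / Real.log (Real.log H) : ℝ) : EReal)) ∧
        (m = 4 → omegaE m H ≤ ((4 + 15.7 / Real.log (Real.log H) : ℝ) : EReal)) ∧
        (5 ≤ m → m ≤ 14 → omegaE m H ≤
          (((m : ℝ) + (1 - 2 * kappa m / Real.log m ^ 2) * (1 - kappa m / Real.log m) *
            ((m : ℝ) ^ 2 * Real.log m / Real.log (Real.log H)) : ℝ) : EReal)) ∧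
        (15 ≤ m → omegaE m H ≤
          (((m : ℝ) + (1 - (1 + kappa m) / Real.log m ^ 2) * (1 - kappa m / Real.log m) *
            ((m : ℝ) ^ 2 * Real.log m / Real.log (Real.log H)) : ℝ) : EReal))) ∧
    ∃ κ : ℝ,
      HasSum (fun p : Nat.Primes => Real.log (p : ℕ) / (((p : ℕ) : ℝ) * (((p : ℕ) : ℝ) - 1))) κ ∧
      Filter.Tendsto kappa Filter.atTop (nhds κ) ∧
      0.75536661083 ≤ κ ∧ κ < 0.75536661084 := by
  refine ⟨fun m H hm hH hs => ?_, _, summable_log_prime_div.hasSum, tendsto_kappa,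
    tsum_log_prime_bounds⟩
  have hC : 0 ≤ (m : ℝ) ^ 2 * Real.log m / Real.log (Real.log H) := by
    have h1 := le_sFun hm
    have h2 : (2 : ℝ) ≤ m := by exact_mod_cast hm
    have h3 := add_log_le_log_log (by linarith) hs
    have h4 : 0 ≤ Real.log (sFun m) := Real.log_nonneg (by linarith)
    exact div_nonneg (mul_nonneg (by positivity) (Real.log_natCast_nonneg m)) (by linarith)
  have hk := kappa_le hm
  have hk1 := logFactorTotal_div_le_one (m := m) (by omega)
  refine ⟨?_, ?_, ?_, fun h5 h14 => ?_, fun h15 => ?_⟩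
  · rintro rfl
    exact omegaE_two_le hH hs
  · rintro rfl
    exact omegaE_three_le hH hs
  · rintro rfl
    exact omegaE_four_le hH hs
  · have hL : 1.6 ≤ Real.log m := by linarith [(twelve_nine_le h5).2]
    have hL2 : 1.6 ^ 2 ≤ Real.log m ^ 2 := pow_le_pow_left₀ (by norm_num) hL 2
    refine (omegaE_le_of_le_fourteen h5 h14 hH hs).trans (EReal.coe_le_coe_iff.mpr ?_)
    exact add_le_add_right (exponent_bound_antitone hL hk hk1 (by linarith) (by linarith) hC) _
  · have hL : 1.6 ≤ Real.log m := by linarith [(twelve_nine_le (show 5 ≤ m by omega)).2]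
    have hL2 : 1.6 ^ 2 ≤ Real.log m ^ 2 := pow_le_pow_left₀ (by norm_num) hL 2
    have h := exponent_bound_antitone hL hk hk1 (e := 1 + logFactorTotal m / m)
      (e' := 1 + kappa m) (by linarith) (by linarith) hC
    rcases Nat.lt_or_ge m 128 with h128 | h128
    · refine (omegaE_le_of_lt h15 h128 hH hs).trans (EReal.coe_le_coe_iff.mpr ?_)
      exact add_le_add_right h _
    · have hm0 : (0 : ℝ) < m := by exact_mod_cast (show 0 < m by omega)
      refine (omegaE_le_of_large h128 hH ((div_le_one hm0).mp (by linarith)) hs).trans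
        (EReal.coe_le_coe_iff.mpr ?_)
      exact add_le_add_right h _

end TranscendenceMeasure
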